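/- Let $K$ be a field, let $V$ be a $K$-vector space of finite dimension $v$ with basis $e_1,\dots,e_v$, and let $W=V^*$ with dual basis $x_1,\dots,x_v$. Put $S=\operatorname{Sym}(W)$ and $E=\bigwedge V$, graded so that $W$ has degree $1$ and $V$ has degree $-1$. Modules are left modules. Complexes are written cohomologically, the subscript denotes the internal degree, and differentials and morphisms preserve internal degrees. For a complex $F$ of graded $S$-modules let $\mathbf R(F)$ be the complex of graded $E$-modules $$\mathbf R(F)^k=\bigoplus_{i+m=k}\operatorname{Hom}_K(E,(F^i)_m),\qquad \alpha\mapsto\Big[a\mapsto d_F(\alpha(a))+(-1)^i\sum_r x_r\,\alpha(e_r a)\Big]\quad\text{for }\alpha\in\operatorname{Hom}_K(E,(F^i)_m),$$ where $E$ acts by $(a\alpha)(b)=\alpha(ba)$ and $\alpha$ has internal degree $t$ if it vanishes on $E_s$ for $s\ne m-t$. For a complex $G$ of graded $E$-modules let $\mathbf L(G)$ be the complex of graded free $S$-modules $$\mathbf L(G)^k=\bigoplus_{i-j=k}S\otimes_K (G^i)_j,\qquad s\otimes g\mapsto s\otimes d_G(g)+(-1)^i\sum_r x_r s\otimes e_r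 g\quad\text{for }g\in (G^i)_j .$$ A graded module is regarded as a complex concentrated in cohomological degree $0$, and $H^\bullet(C)$ denotes the homology of $C$, regarded as a complex with zero differential. A free resolution of a complex $M$ of graded $S$-modules is a complex $F$ of graded free modules for which there is a quasi-isomorphism $F\to M$. An injective resolution of a complex $G$ of graded $E$-modules is a bounded below complex $I$ of graded injective modules for which there is a quasi-isomorphism $G\to I$. A complex $C$ over $S$ or $E$ is minimal if $d(C)\subseteq\mathfrak m C$, where $\mathfrak m$ is the ideal generated by $W$ or $V$, respectively. The linear part of a minimal complex of graded free modules, with respect to a homogeneous basis, is obtained by erasing from the matrices of its differentials all entries whose degree has absolute value greater than $1$. **Theorem.** (a) (Reciprocity) Let $M$ be a finitely generated graded $S$-module and $P$ a finitely generated graded $E$-module. Then $\mathbf L(P)$ is a free resolution of $M$ if and only if $\mathbf R(M)$ is an injective resolution of $P$. (b) Let $M$ be a bounded complex of finitely generated graded $S$-modules (for instance a minimal one). Then $M$ has a minimal free resolution, and the linear part of every minimal free resolution of $M$, with respect to every homogeneous basis, is isomorphic to $\mathbf L(H^\bullet(\mathbf R(M)))$ as a complex of graded $S$-modules. Dually,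 let $G$ be a bounded complex of finitely generated graded $E$-modules (for instance a minimal one). Then $G$ has a minimal injective resolution with graded free terms, and the linear part of every minimal injective resolution of $G$, with respect to every homogeneous basis, is isomorphic to $\mathbf R(H^\bullet(\mathbf L(G)))$ as a complex of graded $E$-modules. -/

import Mathlib

open scoped TensorProduct

universe u

noncomputable section

namespace BGG

/-! ### Internal direct sums -/

section Internal

variable {K : Type*} [Field K] {M : Type*} [AddCommGroup M] [Module K M]
  {N : Type*} [AddCommGroup N] [Module K N] {ι : Type*} [DecidableEq ι]

/-- The linear map out of an internal direct sum that agrees with `f i` on the `i`-th summand. -/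
def glue {A : ι → Submodule K M} (h : DirectSum.IsInternal A) (f : ι → M →ₗ[K] N) : M →ₗ[K] N :=
  DirectSum.toModule K ι N (fun i => f i ∘ₗ (A i).subtype) ∘ₗ
    (LinearEquiv.ofBijective (DirectSum.coeLinearMap A) h).symm.toLinearMap

theorem glue_apply {A : ι → Submodule K M} (h : DirectSum.IsInternal A) (f : ι → M →ₗ[K] N)
    {i : ι} {m : M} (hm : m ∈ A i) : glue h f m = f i m := by
  have : (LinearEquiv.ofBijective (DirectSum.coeLinearMap A) h).symm m
      = DirectSum.lof K ι (fun i => A i) i ⟨m, hm⟩ := by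
    rw [LinearEquiv.symm_apply_eq]
    exact (DirectSum.coeLinearMap_lof A i ⟨m, hm⟩).symm
  simp [glue, this]

/-- The projection onto the `i`-th summand of an internal direct sum. -/
def proj {A : ι → Submodule K M} (h : DirectSum.IsInternal A) (i : ι) : M →ₗ[K] M :=
  glue h (fun j => if j = i then LinearMap.id else 0)

theorem proj_same {A : ι → Submodule K M} (h : DirectSum.IsInternal A) {i : ι} {m : M}
    (hm : m ∈ A i) : proj h i m = m := by
  simp [proj, glue_apply h _ hm]

theorem proj_ne {A : ι → Submodule K M} (h : DirectSum.IsInternal A) {i j : ι} {m : M}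
    (hm : m ∈ A j) (hij : j ≠ i) : proj h i m = 0 := by
  simp [proj, glue_apply h _ hm, hij]

theorem internal_induction {A : ι → Submodule K M} (h : DirectSum.IsInternal A) {p : M → Prop}
    (mem : ∀ i, ∀ m ∈ A i, p m) (zero : p 0) (add : ∀ x y, p x → p y → p (x + y)) (m : M) :
    p m :=
  Submodule.iSup_induction A (motive := p)
    (by rw [h.submodule_iSup_eq_top]; trivial : m ∈ iSup A) mem zero add

theorem proj_mem {A : ι → Submodule K M} (h : DirectSum.IsInternal A) (i : ι) (m : M) :
    proj h i m ∈ A i := by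
  induction m using internal_induction h with
  | mem j m hm =>
    by_cases hj : j = i
    · subst hj; rwa [proj_same h hm]
    · rw [proj_ne h hm hj]; exact zero_mem _
  | zero => simp
  | add x y hx hy => rw [map_add]; exact add_mem hx hy

/-- A spanning family of submodules that is separated by linear maps is an internal direct sum. -/
theorem isInternal_of_proj {A : ι → Submodule K M} (π : ι → M →ₗ[K] M)
    (h1 : ∀ i, ∀ m ∈ A i, π i m = m) (h2 : ∀ i j, j ≠ i → ∀ m ∈ A j, π i m = 0)
    (h3 : iSup A = ⊤) : DirectSum.IsInternal A := by
  refine DirectSum.isInternal_submodule_of_iSupIndep_of_iSup_eq_top ?_ h3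
  rw [iSupIndep_def]
  intro i
  rw [Submodule.disjoint_def]
  intro x hx hx'
  have hle : (⨆ j, ⨆ (_ : j ≠ i), A j) ≤ LinearMap.ker (π i) :=
    iSup₂_le fun j hj m hm => h2 i j hj m hm
  rw [← h1 i x hx]
  exact hle hx'

/-- Regrading of an internal direct sum along a map of index sets. -/
theorem isInternal_regrade {A : ι → Submodule K M} (h : DirectSum.IsInternal A)
    {κ : Type*} [DecidableEq κ] (g : ι → κ) :
    DirectSum.IsInternal (fun k => ⨆ (i : ι) (_ : g i = k), A i) := by
  refine isInternal_of_proj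
    (fun k => glue h (fun i => if g i = k then LinearMap.id else 0)) ?_ ?_ ?_
  · intro k m hm
    have hle : (⨆ (i : ι) (_ : g i = k), A i) ≤ LinearMap.eqLocus
        (glue h (fun i => if g i = k then LinearMap.id else 0)) (LinearMap.id (R := K) (M := M)) :=
      iSup₂_le fun j hj m hm => by
        simp [LinearMap.mem_eqLocus, glue_apply h _ hm, hj]
    exact hle hm
  · intro k k' hk m hm
    have hle : (⨆ (i : ι) (_ : g i = k'), A i) ≤ LinearMap.ker
        (glue h (fun i => if g i = k then (LinearMap.id : M →ₗ[K] M) else 0)) :=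
      iSup₂_le fun j hj m hm => by
        simp [glue_apply h _ hm, hj, hk]
    exact hle hm
  · rw [eq_top_iff, ← h.submodule_iSup_eq_top]
    exact iSup_le fun i => le_iSup_of_le (g i) (le_iSup₂_of_le i rfl le_rfl)

/-- The tensor product of two internal direct sums. -/
theorem isInternal_tensor {κ : Type*} [DecidableEq κ] {A : ι → Submodule K M}
    {B : κ → Submodule K N} (hA : DirectSum.IsInternal A) (hB : DirectSum.IsInternal B) :
    DirectSum.IsInternal fun q : ι × κ =>
      Submodule.map₂ (TensorProduct.mk K M N) (A q.1) (B q.2) := by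
  have key : ∀ (i : ι) (k : κ) (π : M ⊗[K] N →ₗ[K] M ⊗[K] N) (c : K),
      (∀ a ∈ A i, ∀ b ∈ B k, π (a ⊗ₜ b) = c • (a ⊗ₜ[K] b)) →
      ∀ m ∈ Submodule.map₂ (TensorProduct.mk K M N) (A i) (B k), π m = c • m := by
    intro i k π c h m hm
    have hle : Submodule.map₂ (TensorProduct.mk K M N) (A i) (B k) ≤
        LinearMap.ker (π - c • LinearMap.id) :=
      Submodule.map₂_le.2 fun a ha b hb => by simp [h a ha b hb]
    simpa [sub_eq_zero] using hle hm
  refine isInternal_of_proj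
    (fun q => TensorProduct.map (proj hA q.1) (proj hB q.2)) ?_ ?_ ?_
  · rintro ⟨i, k⟩ m hm
    refine (key i k _ 1 (fun a ha b hb => ?_) m hm).trans (one_smul K m)
    rw [TensorProduct.map_tmul, proj_same hA ha, proj_same hB hb, one_smul]
  · rintro ⟨i, k⟩ ⟨i', k'⟩ hq m hm
    refine (key i' k' _ 0 (fun a ha b hb => ?_) m hm).trans (zero_smul K m)
    rw [TensorProduct.map_tmul, zero_smul]
    by_cases h : i' = i
    · rw [proj_ne hB hb fun h' => hq (Prod.ext h h'), TensorProduct.tmul_zero]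
    · rw [proj_ne hA ha h, TensorProduct.zero_tmul]
  · rw [eq_top_iff, ← TensorProduct.map₂_mk_top_top_eq_top,
      ← hA.submodule_iSup_eq_top, ← hB.submodule_iSup_eq_top]
    simp only [Submodule.map₂_iSup_left, Submodule.map₂_iSup_right]
    exact iSup_le fun s => iSup_le fun p => le_iSup_of_le (p, s) le_rfl

end Internal

/-! ### The two graded algebras -/

section Algebras

variable (K : Type u) [Field K]

/-- The grading of the symmetric algebra of `W` in which `W` has degree `1`: the component of
degree `k` is `Sym_k W = W ^ k` for `k ≥ 0`, and the components of negative degree vanish. -/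
def symGrading (W : Type u) [AddCommGroup W] [Module K W] (s : ℤ) :
    Submodule K (SymmetricAlgebra K W) :=
  ⨆ (k : ℕ) (_ : (k : ℤ) = s), LinearMap.range (SymmetricAlgebra.ι K W) ^ k

/-- The grading of the exterior algebra of `V` in which `V` has degree `-1`: the component of
degree `-k` is `⋀^k V` for `k ≥ 0`, and the components of positive degree vanish. -/
def extGrading (V : Type u) [AddCommGroup V] [Module K V] (s : ℤ) :
    Submodule K (ExteriorAlgebra K V) :=
  ⨆ (k : ℕ) (_ : -(k : ℤ) = s), ⋀[K]^k V

section Sym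

variable (W : Type u) [AddCommGroup W] [Module K W]

instance symPowGradedMonoid :
    SetLike.GradedMonoid fun k : ℕ => LinearMap.range (SymmetricAlgebra.ι K W) ^ k :=
  Submodule.nat_power_gradedMonoid (LinearMap.range (SymmetricAlgebra.ι K W))

open scoped DirectSum in
/-- The homomorphism that splits an element of the symmetric algebra into its homogeneous parts. -/
def symSplit :
    SymmetricAlgebra K W →ₐ[K] ⨁ k : ℕ, ↥(LinearMap.range (SymmetricAlgebra.ι K W) ^ k) :=
  SymmetricAlgebra.lift
    (DirectSum.lof K ℕ (fun k => ↥(LinearMap.range (SymmetricAlgebra.ι K W) ^ k)) 1 ∘ₗ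
      (SymmetricAlgebra.ι K W).codRestrict _ fun m => by
        simpa only [pow_one] using LinearMap.mem_range_self _ m)

theorem symSplit_ι (w : W) : symSplit K W (SymmetricAlgebra.ι K W w) =
    DirectSum.of (fun k : ℕ => ↥(LinearMap.range (SymmetricAlgebra.ι K W) ^ k)) 1
      ⟨SymmetricAlgebra.ι K W w, by
        simpa only [pow_one] using LinearMap.mem_range_self _ w⟩ := by
  simp only [symSplit, SymmetricAlgebra.lift_ι_apply]
  rfl

theorem symSplit_coe (i : ℕ) (x : ↥(LinearMap.range (SymmetricAlgebra.ι K W) ^ i)) :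
    symSplit K W x =
      DirectSum.of (fun k : ℕ => ↥(LinearMap.range (SymmetricAlgebra.ι K W) ^ k)) i x := by
  obtain ⟨x, hx⟩ := x
  dsimp only [Subtype.coe_mk]
  induction hx using Submodule.pow_induction_on_left' with
  | algebraMap => simp_rw [AlgHom.commutes, DirectSum.algebraMap_apply]; rfl
  | add _ _ _ _ _ ihx ihy => simp_rw [map_add, ihx, ihy, ← map_add]; rfl
  | mem_mul _ hm _ _ _ ih =>
      obtain ⟨_, rfl⟩ := hm
      simp_rw [map_mul, ih, symSplit_ι, DirectSum.of_mul_of]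
      exact DirectSum.of_eq_of_gradedMonoid_eq (Sigma.subtype_ext (add_comm _ _) rfl)

theorem symPow_isInternal :
    DirectSum.IsInternal fun k : ℕ => LinearMap.range (SymmetricAlgebra.ι K W) ^ k := by
  let 𝒮 : ℕ → Submodule K (SymmetricAlgebra K W) :=
    fun k => LinearMap.range (SymmetricAlgebra.ι K W) ^ k
  have h : (DirectSum.coeAlgHom 𝒮).comp (symSplit K W) = AlgHom.id K _ := by
    refine SymmetricAlgebra.algHom_ext (LinearMap.ext fun w => ?_)
    change DirectSum.coeAlgHom 𝒮 (symSplit K W (SymmetricAlgebra.ι K W w)) = _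
    rw [symSplit_ι]
    exact DirectSum.coeAlgHom_of 𝒮 _ _
  let _ := GradedAlgebra.ofAlgHom 𝒮 (symSplit K W) h (symSplit_coe K W)
  exact DirectSum.Decomposition.isInternal 𝒮

theorem symGrading_isInternal : DirectSum.IsInternal (symGrading K W) :=
  isInternal_regrade (symPow_isInternal K W) (fun k : ℕ => (k : ℤ))

theorem symGrading_natCast (k : ℕ) :
    symGrading K W k = LinearMap.range (SymmetricAlgebra.ι K W) ^ k := by
  simp [symGrading]

theorem ι_mem_symGrading (w : W) : SymmetricAlgebra.ι K W w ∈ symGrading K W 1 := by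
  have := symGrading_natCast K W 1
  rw [Nat.cast_one, pow_one] at this
  rw [this]
  exact LinearMap.mem_range_self _ w

theorem mul_mem_symGrading {s t : ℤ} {a b : SymmetricAlgebra K W} (ha : a ∈ symGrading K W s)
    (hb : b ∈ symGrading K W t) : a * b ∈ symGrading K W (s + t) := by
  have h : symGrading K W s * symGrading K W t ≤ symGrading K W (s + t) := by
    simp only [symGrading, Submodule.iSup_mul, Submodule.mul_iSup]
    refine iSup₂_le fun k hk => iSup₂_le fun l hl => ?_
    refine le_iSup₂_of_le (l + k) (by push_cast; rw [hk, hl]) ?_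
    rw [pow_add]
  exact h (Submodule.mul_mem_mul ha hb)

end Sym

section Ext

variable (V : Type u) [AddCommGroup V] [Module K V]

theorem extGrading_isInternal : DirectSum.IsInternal (extGrading K V) :=
  isInternal_regrade (DirectSum.Decomposition.isInternal fun k : ℕ => ⋀[K]^k V)
    (fun k : ℕ => -(k : ℤ))

theorem extGrading_neg_natCast (k : ℕ) : extGrading K V (-(k : ℤ)) = ⋀[K]^k V := by
  simp [extGrading]

theorem ι_mem_extGrading (x : V) : ExteriorAlgebra.ι K x ∈ extGrading K V (-1) := by
  have := extGrading_neg_natCast K V 1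
  rw [Nat.cast_one] at this
  rw [this, ExteriorAlgebra.exteriorPower, pow_one]
  exact LinearMap.mem_range_self _ x

theorem mul_mem_extGrading {s t : ℤ} {a b : ExteriorAlgebra K V} (ha : a ∈ extGrading K V s)
    (hb : b ∈ extGrading K V t) : a * b ∈ extGrading K V (s + t) := by
  have h : extGrading K V s * extGrading K V t ≤ extGrading K V (s + t) := by
    simp only [extGrading, Submodule.iSup_mul, Submodule.mul_iSup]
    refine iSup₂_le fun k hk => iSup₂_le fun l hl => ?_
    refine le_iSup₂_of_le (l + k) (by push_cast; rw [← hk, ← hl]; ring) ?_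
    simp only [ExteriorAlgebra.exteriorPower]
    rw [pow_add]
  exact h (Submodule.mul_mem_mul ha hb)

end Ext

end Algebras

/-! ### Complexes of graded modules -/

/-- A complex of graded (left) modules over a graded `K`-algebra `A = ⨁ 𝒜 s`, encoded as the direct
sum of its terms: an `A`-module with a bigrading, in which `deg i j` is the component `(C^i)_j` of
cohomological degree `i` and internal degree `j`, and with a differential that is `A`-linear,
raises the cohomological degree by one and preserves the internal degree. The term `C^i` is the
graded `A`-module `⨁_j deg i j`. -/
structure GrComplex (K : Type u) [Field K] {A : Type u} [Ring A] [Algebra K A]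
    (𝒜 : ℤ → Submodule K A) : Type (u + 1) where
  carrier : Type u
  [addCommGroup : AddCommGroup carrier]
  [moduleK : Module K carrier]
  [moduleA : Module A carrier]
  [tower : IsScalarTower K A carrier]
  deg : ℤ → ℤ → Submodule K carrier
  internal : DirectSum.IsInternal fun p : ℤ × ℤ => deg p.1 p.2
  smul_mem : ∀ {s i j : ℤ} {a : A} {m : carrier},
    a ∈ 𝒜 s → m ∈ deg i j → a • m ∈ deg i (s + j)
  d : carrier →ₗ[A] carrier
  d_mem : ∀ {i j : ℤ} {m : carrier}, m ∈ deg i j → d m ∈ deg (i + 1) j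
  d_d : ∀ m, d (d m) = 0

namespace GrComplex

attribute [instance] GrComplex.addCommGroup GrComplex.moduleK GrComplex.moduleA GrComplex.tower

variable {K : Type u} [Field K] {A : Type u} [Ring A] [Algebra K A] {𝒜 : ℤ → Submodule K A}

/-- The term of cohomological degree `i`. -/
def term (C : GrComplex K 𝒜) (i : ℤ) : Submodule A C.carrier :=
  Submodule.span A (⋃ j, (C.deg i j : Set C.carrier))

/-- A graded module, regarded as a complex with only one term, in cohomological degree `0`. -/
def IsModule (C : GrComplex K 𝒜) : Prop :=
  ∀ i j, i ≠ 0 → C.deg i j = ⊥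

/-- All but finitely many terms vanish. -/
def IsBounded (C : GrComplex K 𝒜) : Prop :=
  ∃ a b : ℤ, ∀ i j, i < a ∨ b < i → C.deg i j = ⊥

/-- The terms of sufficiently negative cohomological degree vanish. -/
def IsBoundedBelow (C : GrComplex K 𝒜) : Prop :=
  ∃ a : ℤ, ∀ i j, i < a → C.deg i j = ⊥

/-- All terms are finitely generated modules. -/
def HasFGTerms (C : GrComplex K 𝒜) : Prop :=
  ∀ i, (C.term i).FG

/-- All terms are injective modules. -/
def HasInjectiveTerms (C : GrComplex K 𝒜) : Prop :=
  ∀ i, Module.Injective A (C.term i)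

/-- The image of the differential is contained in the product of the maximal ideal, generated by the
homogeneous elements of nonzero degree, with the complex. -/
def IsMinimal (C : GrComplex K 𝒜) : Prop :=
  ∀ x, C.d x ∈ Submodule.span A
    {y : C.carrier | ∃ s : ℤ, s ≠ 0 ∧ ∃ a ∈ 𝒜 s, ∃ m : C.carrier, y = a • m}

/-- A basis of the terms of a complex of graded modules that consists of bihomogeneous elements.
A graded free complex is one that has such a basis. -/
structure HomogeneousBasis (C : GrComplex K 𝒜) where
  index : Type u
  basis : Module.Basis index A C.carrier
  coh : index → ℤ
  int : index → ℤ
  mem : ∀ i, basis i ∈ C.deg (coh i) (int i)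

/-- A graded free complex. -/
def IsFree (C : GrComplex K 𝒜) : Prop :=
  Nonempty C.HomogeneousBasis

/-- The linear part of the differential of a graded free complex in a homogeneous basis `b`. The
matrix of the differential has the entries `a_{ij}` with `d (b j) = ∑ i, a_{ij} • b i`. The entry
`a_{ij}` is homogeneous of degree `int j - int i`, and it is erased if the absolute value of its
degree is greater than one. -/
def HomogeneousBasis.linearPart {C : GrComplex K 𝒜} (b : C.HomogeneousBasis) :
    C.carrier →ₗ[A] C.carrier :=
  b.basis.constr ℕ fun j =>
    (b.basis.repr (C.d (b.basis j))).sum fun i a =>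
      if |b.int j - b.int i| ≤ 1 then a • b.basis i else 0

/-- The linear part of the free complex `C`, formed in the homogeneous basis `b` (the bigraded
module `C` with the linear part of the differential), is isomorphic to the complex `D`. -/
def HomogeneousBasis.LinearPartIso {C : GrComplex K 𝒜} (b : C.HomogeneousBasis)
    (D : GrComplex K 𝒜) : Prop :=
  ∃ Φ : C.carrier ≃ₗ[A] D.carrier,
    (∀ i j m, m ∈ C.deg i j ↔ Φ m ∈ D.deg i j) ∧ ∀ m, Φ (b.linearPart m) = D.d (Φ m)

/-! #### Homology and quasi-isomorphisms -/

/-- The homology of a complex, as an `A`-module: cycles modulo boundaries. -/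
abbrev HomologyModule (C : GrComplex K 𝒜) : Type u :=
  ↥(LinearMap.ker C.d) ⧸ (LinearMap.range C.d).submoduleOf (LinearMap.ker C.d)

/-- The homology class of a cycle. -/
def homologyClass (C : GrComplex K 𝒜) : ↥(LinearMap.ker C.d) →ₗ[A] C.HomologyModule :=
  Submodule.mkQ _

/-- A morphism of complexes of graded modules. -/
structure Hom (C D : GrComplex K 𝒜) where
  toLin : C.carrier →ₗ[A] D.carrier
  map_mem : ∀ {i j : ℤ} {m : C.carrier}, m ∈ C.deg i j → toLin m ∈ D.deg i j
  comm : ∀ m, toLin (C.d m) = D.d (toLin m)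

/-- The map on cycles induced by a morphism of complexes. -/
def Hom.cyclesMap {C D : GrComplex K 𝒜} (f : Hom C D) :
    ↥(LinearMap.ker C.d) →ₗ[A] ↥(LinearMap.ker D.d) :=
  f.toLin.restrict fun x hx => by
    rw [LinearMap.mem_ker] at hx ⊢
    rw [← f.comm, hx, map_zero]

/-- The map on homology induced by a morphism of complexes. -/
def Hom.homologyMap {C D : GrComplex K 𝒜} (f : Hom C D) :
    C.HomologyModule →ₗ[A] D.HomologyModule :=
  Submodule.mapQ _ _ f.cyclesMap <| by
    rintro ⟨x, hx⟩ ⟨y, hy⟩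
    exact ⟨f.toLin y, by rw [← f.comm, hy]; rfl⟩

/-- A quasi-isomorphism: a morphism of complexes that induces an isomorphism on homology. -/
def Hom.IsQuasiIso {C D : GrComplex K 𝒜} (f : Hom C D) : Prop :=
  Function.Bijective f.homologyMap

/-- `F` is a (graded) free resolution of the complex `M`. -/
def IsFreeResolution (F M : GrComplex K 𝒜) : Prop :=
  F.IsFree ∧ ∃ f : Hom F M, f.IsQuasiIso

/-- `I` is a (graded) injective resolution of the complex `P`. -/
def IsInjectiveResolution (I P : GrComplex K 𝒜) : Prop :=
  I.HasInjectiveTerms ∧ I.IsBoundedBelow ∧ ∃ f : Hom P I, f.IsQuasiIso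

/-! #### Signs and projections -/

/-- The projection of a complex onto a bigraded component. -/
def projDeg (C : GrComplex K 𝒜) (p : ℤ × ℤ) : C.carrier →ₗ[K] C.carrier :=
  proj C.internal p

theorem projDeg_same (C : GrComplex K 𝒜) {i j : ℤ} {m : C.carrier} (hm : m ∈ C.deg i j) :
    C.projDeg (i, j) m = m :=
  proj_same C.internal (i := (i, j)) hm

theorem projDeg_ne (C : GrComplex K 𝒜) {i j : ℤ} {p : ℤ × ℤ} {m : C.carrier}
    (hm : m ∈ C.deg i j) (h : (i, j) ≠ p) : C.projDeg p m = 0 :=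
  proj_ne C.internal (j := (i, j)) hm h

theorem projDeg_mem (C : GrComplex K 𝒜) (p : ℤ × ℤ) (m : C.carrier) :
    C.projDeg p m ∈ C.deg p.1 p.2 :=
  proj_mem C.internal p m

theorem induction (C : GrComplex K 𝒜) {p : C.carrier → Prop}
    (mem : ∀ i j, ∀ m ∈ C.deg i j, p m) (zero : p 0) (add : ∀ x y, p x → p y → p (x + y))
    (m : C.carrier) : p m :=
  internal_induction C.internal (fun i m hm => mem i.1 i.2 m hm) zero add m

theorem projDeg_d (C : GrComplex K 𝒜) (i j : ℤ) (m : C.carrier) :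
    C.projDeg (i + 1, j) (C.d m) = C.d (C.projDeg (i, j) m) := by
  induction m using C.induction with
  | mem i' j' m hm =>
    by_cases h : (i', j') = (i, j)
    · cases h
      rw [C.projDeg_same hm, C.projDeg_same (C.d_mem hm)]
    · rw [C.projDeg_ne hm h, C.projDeg_ne (C.d_mem hm), map_zero]
      intro h'
      simp only [Prod.mk.injEq, add_left_inj] at h' h
      exact h h'
  | zero => simp
  | add x y hx hy => simp only [map_add, hx, hy]

/-- The involution that is multiplication by `(-1) ^ i` on the term of cohomological degree `i`. -/
def sign (C : GrComplex K 𝒜) : C.carrier →ₗ[K] C.carrier :=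
  glue C.internal fun p => ((Int.negOnePow p.1 : ℤˣ) : ℤ) • LinearMap.id

theorem sign_apply (C : GrComplex K 𝒜) {i j : ℤ} {m : C.carrier} (hm : m ∈ C.deg i j) :
    C.sign m = ((Int.negOnePow i : ℤˣ) : ℤ) • m := by
  rw [sign, glue_apply (i := (i, j)) C.internal _ hm]
  rfl

theorem sign_mem (C : GrComplex K 𝒜) {i j : ℤ} {m : C.carrier} (hm : m ∈ C.deg i j) :
    C.sign m ∈ C.deg i j := by
  rw [C.sign_apply hm]
  exact zsmul_mem hm _

theorem sign_d (C : GrComplex K 𝒜) (m : C.carrier) : C.sign (C.d m) = -C.d (C.sign m) := by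
  induction m using C.induction with
  | mem i j m hm =>
    rw [C.sign_apply hm, C.sign_apply (C.d_mem hm), Int.negOnePow_succ, map_zsmul]
    simp
  | zero => simp
  | add x y hx hy => simp only [map_add, hx, hy, neg_add]

theorem sign_smul (C : GrComplex K 𝒜) {s : ℤ} {a : A} (ha : a ∈ 𝒜 s) (m : C.carrier) :
    C.sign (a • m) = a • C.sign m := by
  induction m using C.induction with
  | mem i j m hm =>
    rw [C.sign_apply hm, C.sign_apply (C.smul_mem ha hm), smul_comm]
  | zero => simp
  | add x y hx hy => simp only [map_add, smul_add, hx, hy]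

theorem sign_sign (C : GrComplex K 𝒜) (m : C.carrier) : C.sign (C.sign m) = m := by
  induction m using C.induction with
  | mem i j m hm =>
    rw [C.sign_apply hm, map_zsmul, C.sign_apply hm, smul_smul, ← Units.val_mul,
      Int.units_mul_self]
    simp
  | zero => simp
  | add x y hx hy => simp only [map_add, hx, hy]

/-! #### The homology as a complex with zero differential -/

/-- The classes of the cycles of cohomological degree `i` and internal degree `j`. -/
def homologyDeg (C : GrComplex K 𝒜) (i j : ℤ) : Submodule K C.HomologyModule :=
  ((C.deg i j).comap ((LinearMap.ker C.d).subtype.restrictScalars K)).map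
    (C.homologyClass.restrictScalars K)

/-- The projection of a cycle onto a bigraded component. -/
def projCycles (C : GrComplex K 𝒜) (p : ℤ × ℤ) :
    ↥(LinearMap.ker C.d) →ₗ[K] ↥(LinearMap.ker C.d) :=
  (C.projDeg p).restrict (p := (LinearMap.ker C.d).restrictScalars K)
    (q := (LinearMap.ker C.d).restrictScalars K) fun x hx => by
      have h := C.projDeg_d p.1 p.2 x
      have hx' : C.d x = 0 := hx
      rw [hx', map_zero] at h
      exact h.symm

theorem projCycles_coe (C : GrComplex K 𝒜) (p : ℤ × ℤ) (x : ↥(LinearMap.ker C.d)) :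
    (C.projCycles p x : C.carrier) = C.projDeg p x := rfl

/-- The projection of the homology onto a bigraded component. -/
def projHomology (C : GrComplex K 𝒜) (p : ℤ × ℤ) : C.HomologyModule →ₗ[K] C.HomologyModule :=
  let N := (LinearMap.range C.d).submoduleOf (LinearMap.ker C.d)
  (Submodule.Quotient.restrictScalarsEquiv K N).toLinearMap ∘ₗ
    Submodule.mapQ (N.restrictScalars K) (N.restrictScalars K) (C.projCycles p) (by
      rintro ⟨x, hx⟩ ⟨y, hy⟩
      refine ⟨C.projDeg (p.1 - 1, p.2) y, ?_⟩
      have h := C.projDeg_d (p.1 - 1) p.2 y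
      rw [sub_add_cancel, hy] at h
      exact h.symm) ∘ₗ
    (Submodule.Quotient.restrictScalarsEquiv K N).symm.toLinearMap

theorem projHomology_class (C : GrComplex K 𝒜) (p : ℤ × ℤ) (x : ↥(LinearMap.ker C.d)) :
    C.projHomology p (C.homologyClass x) = C.homologyClass (C.projCycles p x) := rfl

theorem homologyDeg_isInternal (C : GrComplex K 𝒜) :
    DirectSum.IsInternal fun p : ℤ × ℤ => C.homologyDeg p.1 p.2 := by
  refine isInternal_of_proj C.projHomology ?_ ?_ ?_
  · rintro ⟨i, j⟩ _ ⟨x, hx, rfl⟩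
    refine (C.projHomology_class _ x).trans ?_
    refine congrArg C.homologyClass (Subtype.ext ?_)
    exact C.projDeg_same hx
  · rintro p ⟨i, j⟩ h _ ⟨x, hx, rfl⟩
    refine (C.projHomology_class _ x).trans ?_
    rw [show C.projCycles p x = 0 from Subtype.ext (C.projDeg_ne hx h), map_zero]
  · rw [eq_top_iff]
    rintro z -
    obtain ⟨x, rfl⟩ := Submodule.mkQ_surjective _ z
    have key : ∀ S : Finset (ℤ × ℤ), ∀ x : ↥(LinearMap.ker C.d),
        (x : C.carrier) = ∑ p ∈ S, C.projDeg p x →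
        C.homologyClass x ∈ ⨆ p : ℤ × ℤ, C.homologyDeg p.1 p.2 := by
      intro S x hS
      have hx : x = ∑ p ∈ S, C.projCycles p x := by
        apply Subtype.ext
        rw [AddSubmonoidClass.coe_finsetSum]
        exact hS
      rw [hx, map_sum]
      refine Submodule.sum_mem _ fun p _ => ?_
      refine Submodule.mem_iSup_of_mem p ⟨C.projCycles p x, ?_, rfl⟩
      exact C.projDeg_mem p x
    have hfin : ∀ m : C.carrier, ∃ S : Finset (ℤ × ℤ), ∀ T, S ⊆ T → m = ∑ p ∈ T, C.projDeg p m := by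
      intro m
      induction m using C.induction with
      | mem i j m hm =>
        refine ⟨{(i, j)}, fun T hT => ?_⟩
        rw [Finset.sum_eq_single (i, j)]
        · exact (C.projDeg_same hm).symm
        · intro p _ hp
          exact C.projDeg_ne hm hp.symm
        · intro h
          exact absurd (hT (Finset.mem_singleton_self _)) h
      | zero => exact ⟨∅, fun T _ => by simp⟩
      | add x y hx hy =>
        obtain ⟨S, hS⟩ := hx
        obtain ⟨T, hT⟩ := hy
        refine ⟨S ∪ T, fun U hU => ?_⟩
        simp only [map_add, Finset.sum_add_distrib]
        rw [← hS U (Finset.union_subset_left hU), ← hT U (Finset.union_subset_right hU)]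
    obtain ⟨S, hS⟩ := hfin x
    exact key S x (hS S subset_rfl)

/-- The homology `H^•(C)` of a complex of graded modules: the complex with zero differential whose
term of cohomological degree `i` is the graded module `H^i(C)`. -/
def homology (C : GrComplex K 𝒜) : GrComplex K 𝒜 where
  carrier := C.HomologyModule
  deg := C.homologyDeg
  internal := C.homologyDeg_isInternal
  smul_mem := by
    rintro s i j a _ ha ⟨x, hx, rfl⟩
    exact ⟨a • x, C.smul_mem ha hx, by simp⟩
  d := 0
  d_mem := fun _ => zero_mem _
  d_d := fun _ => rfl

end GrComplex

/-! ### The functor `L` -/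

section L

variable {K : Type u} [Field K] {V : Type u} [AddCommGroup V] [Module K V]

/-- The exterior algebra on `V`. -/
abbrev E (K V : Type u) [Field K] [AddCommGroup V] [Module K V] : Type u :=
  ExteriorAlgebra K V

/-- The symmetric algebra on the dual space `W` of `V`. -/
abbrev S (K V : Type u) [Field K] [AddCommGroup V] [Module K V] : Type u :=
  SymmetricAlgebra K (Module.Dual K V)

/-- Complexes of graded `E`-modules. -/
abbrev EComplex (K V : Type u) [Field K] [AddCommGroup V] [Module K V] : Type (u + 1) :=
  GrComplex K (extGrading K V)

/-- Complexes of graded `S`-modules. -/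
abbrev SComplex (K V : Type u) [Field K] [AddCommGroup V] [Module K V] : Type (u + 1) :=
  GrComplex K (symGrading K (Module.Dual K V))

variable {v : ℕ} (e : Module.Basis (Fin v) K V)

/-- The element `e_i` of the basis, in `E`. -/
def eE (i : Fin v) : E K V := ExteriorAlgebra.ι K (e i)

/-- The element `x_i` of the dual basis of `W`, in `S`. -/
def xS (i : Fin v) : S K V := SymmetricAlgebra.ι K (Module.Dual K V) (e.coord i)

theorem eE_mem (i : Fin v) : eE e i ∈ extGrading K V (-1) := ι_mem_extGrading K V _

theorem xS_mem (i : Fin v) : xS e i ∈ symGrading K (Module.Dual K V) 1 := ι_mem_symGrading K _ _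

theorem eE_swap (i j : Fin v) : eE e i * eE e j = -(eE e j * eE e i) :=
  eq_neg_of_add_eq_zero_left (ExteriorAlgebra.ι_add_mul_swap _ _)

/-- A sum over pairs of indices of antisymmetric terms with zero diagonal vanishes. -/
theorem sum_sum_antisymm {M : Type*} [AddCommGroup M] (f : Fin v → Fin v → M)
    (h0 : ∀ i, f i i = 0) (h : ∀ i j, f i j = -f j i) : ∑ i, ∑ j, f i j = 0 := by
  rw [← Finset.sum_product' Finset.univ Finset.univ f]
  refine Finset.sum_involution (fun p _ => (p.2, p.1)) ?_ ?_ ?_ ?_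
  · rintro ⟨i, j⟩ -
    simp only
    rw [h i j, neg_add_cancel]
  · rintro ⟨i, j⟩ - hne heq
    simp only [Prod.mk.injEq] at heq
    obtain rfl := heq.1
    exact hne (h0 _)
  · intros; simp
  · intros; rfl

/-- The bigraded components of `S ⊗ G` with respect to the total cohomological degree: an element
`s ⊗ g` with `s` of degree `a` and with `g` of cohomological degree `i` and internal degree `j` has
cohomological degree `i - j` and internal degree `a + j`. -/
def LDeg (G : EComplex K V) (k t : ℤ) : Submodule K (S K V ⊗[K] G.carrier) :=
  ⨆ (q : ℤ × ℤ × ℤ) (_ : (q.2.1 - q.2.2, q.1 + q.2.2) = (k, t)),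
    Submodule.map₂ (TensorProduct.mk K (S K V) G.carrier)
      (symGrading K (Module.Dual K V) q.1) (G.deg q.2.1 q.2.2)

theorem LDeg_isInternal (G : EComplex K V) :
    DirectSum.IsInternal fun p : ℤ × ℤ => LDeg G p.1 p.2 := by
  exact isInternal_regrade (isInternal_tensor (symGrading_isInternal K (Module.Dual K V)) G.internal)
    (fun q : ℤ × ℤ × ℤ => (q.2.1 - q.2.2, q.1 + q.2.2))

theorem tmul_mem_LDeg (G : EComplex K V) {a i j k t : ℤ} {s : S K V} {g : G.carrier}
    (hs : s ∈ symGrading K (Module.Dual K V) a) (hg : g ∈ G.deg i j) (hk : i - j = k)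
    (ht : a + j = t) : s ⊗ₜ[K] g ∈ LDeg G k t :=
  Submodule.mem_iSup_of_mem (a, i, j) <|
    Submodule.mem_iSup_of_mem (by simp [hk, ht]) (Submodule.apply_mem_map₂ _ hs hg)

theorem LDeg_le (G : EComplex K V) {k t : ℤ} {N : Submodule K (S K V ⊗[K] G.carrier)}
    (h : ∀ a i j : ℤ, i - j = k → a + j = t → ∀ s ∈ symGrading K (Module.Dual K V) a,
      ∀ g ∈ G.deg i j, s ⊗ₜ[K] g ∈ N) : LDeg G k t ≤ N := by
  refine iSup₂_le fun q hq => Submodule.map₂_le.2 fun s hs g hg => ?_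
  simp only [Prod.mk.injEq] at hq
  exact h q.1 q.2.1 q.2.2 hq.1 hq.2 s hs g hg

/-- The differential of `L(G)`, the total complex of a double complex: for `g` of cohomological
degree `i` it sends `s ⊗ g` to `s ⊗ d g + (-1) ^ i ∑ r, x_r s ⊗ e_r g`. -/
def Ld (G : EComplex K V) : S K V ⊗[K] G.carrier →ₗ[S K V] S K V ⊗[K] G.carrier :=
  (G.d.restrictScalars K).baseChange (S K V) +
    ∑ r, xS e r • (G.sign ∘ₗ Algebra.lsmul K K G.carrier (eE e r)).baseChange (S K V)

theorem Ld_tmul (G : EComplex K V) (s : S K V) (g : G.carrier) :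
    Ld e G (s ⊗ₜ g) =
      s ⊗ₜ[K] G.d g + ∑ r, (xS e r * s) ⊗ₜ[K] G.sign (eE e r • g) := by
  simp [Ld, LinearMap.sum_apply, TensorProduct.smul_tmul']

/-- The complex of graded free `S`-modules `L(G)` of a complex `G` of graded `E`-modules. -/
def L (G : EComplex K V) : SComplex K V where
  carrier := S K V ⊗[K] G.carrier
  deg := LDeg G
  internal := LDeg_isInternal G
  smul_mem := by
    intro c k t b m hb hm
    refine LDeg_le G (N := (LDeg G k (c + t)).comap (Algebra.lsmul K K _ b)) ?_ hm
    intro a i j hk ht s hs g hg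
    refine tmul_mem_LDeg G (mul_mem_symGrading K _ hb hs) hg hk ?_
    rw [add_assoc, ht]
  d := Ld e G
  d_mem := by
    intro k t m hm
    refine LDeg_le G (N := (LDeg G (k + 1) t).comap ((Ld e G).restrictScalars K)) ?_ hm
    intro a i j hk ht s hs g hg
    simp only [Submodule.mem_comap, LinearMap.coe_restrictScalars, Ld_tmul]
    refine add_mem (tmul_mem_LDeg G hs (G.d_mem hg) (by omega) ht)
      (Submodule.sum_mem _ fun r _ => ?_)
    exact tmul_mem_LDeg G (mul_mem_symGrading K _ (xS_mem e r) hs)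
      (G.sign_mem (G.smul_mem (eE_mem e r) hg)) (by omega) (by omega)
  d_d := by
    intro m
    induction m using TensorProduct.induction_on with
    | zero => simp
    | add x y hx hy => simp only [map_add, hx, hy, add_zero]
    | tmul s g =>
      simp only [Ld_tmul, map_add, map_sum, G.d_d, TensorProduct.tmul_zero, zero_add,
        Finset.sum_add_distrib]
      rw [← add_assoc, ← Finset.sum_add_distrib]
      have h1 : ∀ r, (xS e r * s) ⊗ₜ[K] G.sign (eE e r • G.d g) +
          (xS e r * s) ⊗ₜ[K] G.d (G.sign (eE e r • g)) = 0 := by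
        intro r
        rw [← TensorProduct.tmul_add, ← map_smul, G.sign_d, neg_add_cancel,
          TensorProduct.tmul_zero]
      simp only [h1, Finset.sum_const_zero, zero_add]
      refine sum_sum_antisymm _ (fun i => ?_) (fun i j => ?_)
      · rw [← G.sign_smul (eE_mem e i), smul_smul, eE, ExteriorAlgebra.ι_sq_zero]
        simp
      · rw [← G.sign_smul (eE_mem e j), ← G.sign_smul (eE_mem e i), smul_smul, smul_smul,
          eE_swap e j i, neg_smul, map_neg, map_neg, TensorProduct.tmul_neg, mul_left_comm]

end L

/-! ### The functor `R` -/

section R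

variable {K : Type u} [Field K] {V : Type u} [AddCommGroup V] [Module K V]
  {v : ℕ}

/-- The space `Hom_K(E, F)` of `K`-linear maps. -/
def HomE (K V : Type u) [Field K] [AddCommGroup V] [Module K V] (F : Type u) [AddCommGroup F]
    [Module K F] : Type u :=
  E K V →ₗ[K] F

namespace HomE

variable {F : Type u} [AddCommGroup F] [Module K F]

instance : AddCommGroup (HomE K V F) := inferInstanceAs (AddCommGroup (E K V →ₗ[K] F))

instance : Module K (HomE K V F) := inferInstanceAs (Module K (E K V →ₗ[K] F))

instance : FunLike (HomE K V F) (E K V) F := inferInstanceAs (FunLike (E K V →ₗ[K] F) (E K V) F)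

instance : LinearMapClass (HomE K V F) K (E K V) F :=
  inferInstanceAs (LinearMapClass (E K V →ₗ[K] F) K (E K V) F)

@[ext] theorem ext {α β : HomE K V F} (h : ∀ a, α a = β a) : α = β := LinearMap.ext h

@[simp] theorem zero_apply (a : E K V) : (0 : HomE K V F) a = 0 := rfl

@[simp] theorem add_apply (α β : HomE K V F) (a : E K V) : (α + β) a = α a + β a := rfl

@[simp] theorem smulK_apply (c : K) (α : HomE K V F) (a : E K V) : (c • α) a = c • α a := rfl

/-- The left `E`-module structure on `Hom_K(E, F)`: `(a α)(b) = α(b a)`. -/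
instance : SMul (E K V) (HomE K V F) where
  smul a α := LinearMap.comp (show E K V →ₗ[K] F from α) (LinearMap.mulRight K a)

@[simp] theorem smul_apply (a : E K V) (α : HomE K V F) (b : E K V) : (a • α) b = α (b * a) := rfl

instance : Module (E K V) (HomE K V F) where
  one_smul α := by ext; simp
  mul_smul a b α := by ext; simp [mul_assoc]
  smul_zero a := by ext; simp
  smul_add a α β := by ext; simp
  add_smul a b α := by ext; simp [mul_add]
  zero_smul α := by ext; simp

instance : IsScalarTower K (E K V) (HomE K V F) where
  smul_assoc c a α := by ext; simp

@[simp] theorem sum_apply {κ : Type*} (T : Finset κ) (f : κ → HomE K V F) (a : E K V) :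
    (∑ r ∈ T, f r) a = ∑ r ∈ T, f r a :=
  LinearMap.sum_apply T f a

end HomE

/-- The bigraded components of `Hom_K(E, F)`: a `K`-linear map `α` has internal degree `t` if it
sends the component of `E` of degree `s` to elements of internal degree `s + t`, and the total
cohomological degree of a map to elements of cohomological degree `i` and internal degree `m` is
`i + m`. -/
def RDeg (F : SComplex K V) (k t : ℤ) : Submodule K (HomE K V F.carrier) where
  carrier := {α | ∀ s : ℤ, ∀ a ∈ extGrading K V s, α a ∈ F.deg (k - (s + t)) (s + t)}
  zero_mem' := fun _ _ _ => zero_mem _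
  add_mem' := fun hα hβ s a ha => add_mem (hα s a ha) (hβ s a ha)
  smul_mem' := fun c _ hα s a ha => Submodule.smul_mem _ c (hα s a ha)

theorem E_finite (e : Module.Basis (Fin v) K V) : Module.Finite K (E K V) :=
  Module.Finite.of_basis e.ExteriorAlgebra

theorem extGrading_finite (e : Module.Basis (Fin v) K V) : {s : ℤ | extGrading K V s ≠ ⊥}.Finite := by
  have := E_finite e
  exact WellFoundedGT.finite_ne_bot_of_iSupIndep (extGrading_isInternal K V).submodule_iSupIndep

/-- The projection onto a bigraded component of `Hom_K(E, F)`, where `T` contains the degrees in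
which `E` does not vanish. -/
def RProj (T : Finset ℤ) (F : SComplex K V) (p : ℤ × ℤ) :
    HomE K V F.carrier →ₗ[K] HomE K V F.carrier where
  toFun α := (
    { toFun := fun a => ∑ s ∈ T, F.projDeg (p.1 - (s + p.2), s + p.2)
        (α (proj (extGrading_isInternal K V) s a))
      map_add' := fun a b => by simp only [map_add, Finset.sum_add_distrib]
      map_smul' := fun c a => by simp only [map_smul, Finset.smul_sum, RingHom.id_apply] } :
    E K V →ₗ[K] F.carrier)
  map_add' α β := by
    ext a
    change ∑ s ∈ T, F.projDeg (p.1 - (s + p.2), s + p.2)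
        ((α + β) (proj (extGrading_isInternal K V) s a)) = ∑ s ∈ T, _ + ∑ s ∈ T, _
    simp only [HomE.add_apply, map_add, Finset.sum_add_distrib]
  map_smul' c α := by
    ext a
    change ∑ s ∈ T, F.projDeg (p.1 - (s + p.2), s + p.2)
        ((c • α) (proj (extGrading_isInternal K V) s a)) = c • ∑ s ∈ T, _
    simp only [HomE.smulK_apply, map_smul, Finset.smul_sum]

theorem RProj_apply (T : Finset ℤ) (F : SComplex K V) (p : ℤ × ℤ) (α : HomE K V F.carrier)
    {s : ℤ} (hs : s ∈ T) {a : E K V} (ha : a ∈ extGrading K V s) :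
    RProj T F p α a = F.projDeg (p.1 - (s + p.2), s + p.2) (α a) := by
  have h : RProj T F p α a = ∑ r ∈ T, F.projDeg (p.1 - (r + p.2), r + p.2)
      (α (proj (extGrading_isInternal K V) r a)) := rfl
  rw [h, Finset.sum_eq_single s]
  · rw [proj_same _ ha]
  · intro r _ hr
    rw [proj_ne _ ha hr.symm, map_zero, map_zero]
  · exact fun h => absurd hs h

/-- Two linear maps on `E` agree if they agree on homogeneous elements. -/
theorem HomE.ext_homogeneous {T : Finset ℤ} (hT : ∀ s, extGrading K V s ≠ ⊥ → s ∈ T)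
    {F : Type u} [AddCommGroup F] [Module K F] {α β : HomE K V F}
    (h : ∀ s ∈ T, ∀ a ∈ extGrading K V s, α a = β a) : α = β := by
  ext a
  induction a using internal_induction (extGrading_isInternal K V) with
  | mem s a ha =>
    by_cases hs : extGrading K V s = ⊥
    · rw [hs, Submodule.mem_bot] at ha
      rw [ha, map_zero, map_zero]
    · exact h s (hT s hs) a ha
  | zero => rw [map_zero, map_zero]
  | add x y hx hy => rw [map_add, map_add, hx, hy]

/-- The linear map `a ↦ f (a_s) • m`, where `a_s` is the component of `a` of degree `s`. -/
def rankOne (F : SComplex K V) (s : ℤ) (f : E K V →ₗ[K] K) :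
    F.carrier →ₗ[K] HomE K V F.carrier where
  toFun m := ((f ∘ₗ proj (extGrading_isInternal K V) s).smulRight m : E K V →ₗ[K] F.carrier)
  map_add' m n := by ext a; exact smul_add _ _ _
  map_smul' c m := by ext a; exact smul_comm _ _ _

theorem rankOne_apply (F : SComplex K V) (s : ℤ) (f : E K V →ₗ[K] K) (m : F.carrier) (a : E K V) :
    rankOne F s f m a = f (proj (extGrading_isInternal K V) s a) • m := rfl

theorem rankOne_mem (F : SComplex K V) (s : ℤ) (f : E K V →ₗ[K] K) {i j : ℤ} {m : F.carrier}
    (hm : m ∈ F.deg i j) : rankOne F s f m ∈ RDeg F (i + j) (j - s) := by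
  intro s' a ha
  rw [rankOne_apply]
  by_cases h : s' = s
  · subst h
    rw [show s' + (j - s') = j by ring, show i + j - j = i by ring]
    exact Submodule.smul_mem _ _ hm
  · rw [proj_ne _ ha h, map_zero, zero_smul]
    exact zero_mem _

theorem RDeg_isInternal (e : Module.Basis (Fin v) K V) (F : SComplex K V) :
    DirectSum.IsInternal fun p : ℤ × ℤ => RDeg F p.1 p.2 := by
  have hT : ∀ s, extGrading K V s ≠ ⊥ → s ∈ (extGrading_finite e).toFinset := by
    intro s hs
    simpa using hs
  generalize (extGrading_finite e).toFinset = T at hT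
  refine isInternal_of_proj (RProj T F) ?_ ?_ ?_
  · intro p α hα
    refine HomE.ext_homogeneous hT fun s hs a ha => ?_
    rw [RProj_apply T F p α hs ha, F.projDeg_same (hα s a ha)]
  · intro p q hq α hα
    refine HomE.ext_homogeneous hT fun s hs a ha => ?_
    rw [RProj_apply T F p α hs ha, F.projDeg_ne (hα s a ha)]
    · rfl
    · intro h
      simp only [Prod.mk.injEq] at h
      exact hq (Prod.ext (by omega) (by omega))
  · rw [eq_top_iff]
    rintro α -
    have := E_finite e
    have hα : α = ∑ s ∈ T, ∑ b, rankOne F s ((Module.finBasis K (E K V)).coord b)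
        (α (Module.finBasis K (E K V) b)) := by
      refine HomE.ext_homogeneous hT fun s hs a ha => ?_
      rw [HomE.sum_apply, Finset.sum_eq_single s]
      · simp only [HomE.sum_apply, rankOne_apply, proj_same _ ha, Module.Basis.coord_apply]
        conv_lhs => rw [← (Module.finBasis K (E K V)).sum_repr a]
        simp only [map_sum, map_smul]
      · intro r _ hr
        simp only [HomE.sum_apply, rankOne_apply, proj_ne _ ha hr.symm, map_zero, zero_smul,
          Finset.sum_const_zero]
      · exact fun h => absurd hs h
    rw [hα]
    refine Submodule.sum_mem _ fun s _ => Submodule.sum_mem _ fun b _ => ?_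
    generalize α (Module.finBasis K (E K V) b) = m
    induction m using F.induction with
    | mem i j m hm => exact Submodule.mem_iSup_of_mem (i + j, j - s) (rankOne_mem F s _ hm)
    | zero => rw [map_zero]; exact zero_mem _
    | add x y hx hy => rw [map_add]; exact add_mem hx hy

/-- The differential of `R(F)`, the total complex of a double complex: for `α` with values of
cohomological degree `i` it sends `α` to `a ↦ d (α a) + (-1) ^ i ∑ r, x_r α(e_r a)`. -/
def Rd (e : Module.Basis (Fin v) K V) (F : SComplex K V) :
    HomE K V F.carrier →ₗ[E K V] HomE K V F.carrier where
  toFun α := (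
    { toFun := fun a => F.d (α a) + ∑ r, F.sign (xS e r • α (eE e r * a))
      map_add' := fun a b => by
        simp only [mul_add, map_add, smul_add, Finset.sum_add_distrib]
        abel
      map_smul' := fun c a => by
        simp only [mul_smul_comm, map_smul, smul_add, Finset.smul_sum, RingHom.id_apply,
          smul_comm _ c, LinearMap.map_smul_of_tower] } :
    E K V →ₗ[K] F.carrier)
  map_add' α β := by
    ext a
    change F.d ((α + β) a) + ∑ r, F.sign (xS e r • (α + β) (eE e r * a)) =
      (F.d (α a) + ∑ r, F.sign (xS e r • α (eE e r * a))) +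
        (F.d (β a) + ∑ r, F.sign (xS e r • β (eE e r * a)))
    simp only [HomE.add_apply, map_add, smul_add, Finset.sum_add_distrib]
    abel
  map_smul' b α := by
    ext a
    change F.d (α (a * b)) + ∑ r, F.sign (xS e r • α (eE e r * a * b)) =
      F.d (α (a * b)) + ∑ r, F.sign (xS e r • α (eE e r * (a * b)))
    simp only [mul_assoc]

@[simp] theorem Rd_apply (e : Module.Basis (Fin v) K V) (F : SComplex K V)
    (α : HomE K V F.carrier) (a : E K V) :
    Rd e F α a = F.d (α a) + ∑ r, F.sign (xS e r • α (eE e r * a)) := rfl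

/-- The complex of graded `E`-modules `R(F)` of a complex `F` of graded `S`-modules. -/
def R (e : Module.Basis (Fin v) K V) (F : SComplex K V) : EComplex K V where
  carrier := HomE K V F.carrier
  deg := RDeg F
  internal := RDeg_isInternal e F
  smul_mem := by
    intro s k t b α hb hα s' a ha
    rw [HomE.smul_apply, ← add_assoc]
    exact hα (s' + s) (a * b) (mul_mem_extGrading K V ha hb)
  d := Rd e F
  d_mem := by
    intro k t α hα s a ha
    rw [Rd_apply]
    refine add_mem ?_ (Submodule.sum_mem _ fun r _ => F.sign_mem ?_)
    · have h := F.d_mem (hα s a ha)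
      rwa [show k - (s + t) + 1 = k + 1 - (s + t) by ring] at h
    · have h := F.smul_mem (xS_mem e r)
        (hα (-1 + s) _ (mul_mem_extGrading K V (eE_mem e r) ha))
      rwa [show k - (-1 + s + t) = k + 1 - (s + t) by ring,
        show 1 + (-1 + s + t) = s + t by ring] at h
  d_d := by
    intro α
    ext a
    simp only [Rd_apply, map_add, map_sum, F.d_d, zero_add, smul_add, Finset.smul_sum,
      Finset.sum_add_distrib, HomE.zero_apply]
    rw [← add_assoc, ← Finset.sum_add_distrib]
    have h1 : ∀ r, F.d (F.sign (xS e r • α (eE e r * a))) +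
        F.sign (xS e r • F.d (α (eE e r * a))) = 0 := by
      intro r
      rw [← map_smul F.d, F.sign_d, add_neg_cancel]
    simp only [h1, Finset.sum_const_zero, zero_add]
    refine sum_sum_antisymm _ (fun i => ?_) (fun i j => ?_)
    · rw [← mul_assoc, eE, ExteriorAlgebra.ι_sq_zero]
      simp
    · rw [← mul_assoc, ← mul_assoc, eE_swap e j i, neg_mul, map_neg]
      simp only [smul_neg, map_neg, ← F.sign_smul (xS_mem e _), smul_smul, mul_comm]

end R

end BGG

end

/-! The differentials of L(G) and R(F) are sums of an internal part, induced by the differential of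
the argument, and a Koszul part, the signed sum of the operators x_r ⊗ e_r. Everything rests on two
facts, one for each part. When the Koszul part dominates, the natural maps G → R(L(G)) and L(R(M)) →
M are quasi-isomorphisms (`unit_isQuasiIso`, `counit_isQuasiIso`). Division by x_r together with
contraction of e_r is a homotopy for the r-th Koszul operator, and these combine to a homotopy for
the sum (`IsKoszul.homotopy`). The outcome is `exists_R_boundary` (over a free complex F, a cycle α
of R(F) with α(1) in mF bounds) and `exists_L_boundary` (L(I) is carried by 1 ⊗ soc I, up to
boundaries, if I has Clifford operators). When the internal part dominates, R preserves
quasi-isomorphisms, and so does L between bounded below complexes (`Rmap_isQuasiIso`,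
`Lmap_isQuasiIso`): a contracting homotopy over K contracts up to a locally nilpotent error.
Reciprocity: from L(P) → M one gets P → R(L(P)) → R(M), and from P → R(M) one gets L(P) → L(R(M)) →
M. The terms of R(M) are coinduced, hence injective. Linear parts over S: for minimal free F, the
value at 1 modulo m identifies H(R(F)) with the K-span of the basis. A cycle α satisfies dα(1) = ± ∑
x_r α(e_r), and α(e_r) = (e_r α)(1), so the linear entries of d are the action of E on H(R(F)). If F
resolves M, then H(R(F)) = H(R(M)). Linear parts over E: for minimal free I, g ↦ 1 ⊗ g identifies
soc I with H(L(I)), and the Frobenius property of E identifies I with Hom_K(E, soc I). Existence: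
L(R(M)) and R(L(G)) are resolutions. A splitting of the internal part over K and homological
perturbation (`Perturbation.model`) retract them onto S ⊗ H(R(M)) and Hom_K(E, H(L(G))), with a
differential that is minimal because the Koszul part has coefficients in the maximal ideal. -/

noncomputable section

namespace BGG

/-! ### Internal direct sums and linear algebra -/

section LinearAlgebra

variable {K : Type*} [Field K] {M : Type*} [AddCommGroup M] [Module K M]
  {N : Type*} [AddCommGroup N] [Module K N] {ι : Type*} [DecidableEq ι]

/-- A linear map that respects internal direct sums commutes with the projections. -/
theorem map_proj {A : ι → Submodule K M} {B : ι → Submodule K N} (hA : DirectSum.IsInternal A)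
    (hB : DirectSum.IsInternal B) (f : M →ₗ[K] N) (σ : ι → ι) (hσ : Function.Injective σ)
    (hf : ∀ i, ∀ m ∈ A i, f m ∈ B (σ i)) (i : ι) (m : M) :
    f (proj hA i m) = proj hB (σ i) (f m) := by
  induction m using internal_induction hA with
  | mem j m hm =>
    by_cases h : j = i
    · subst h; rw [proj_same hA hm, proj_same hB (hf _ _ hm)]
    · rw [proj_ne hA hm h, proj_ne hB (hf _ _ hm) (fun h' => h (hσ h')), map_zero]
  | zero => simp
  | add x y hx hy => simp only [map_add, hx, hy]

/-- An injective linear map that respects internal direct sums reflects the summands. -/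
theorem mem_of_map_mem {A : ι → Submodule K M} {B : ι → Submodule K N}
    (hA : DirectSum.IsInternal A) (hB : DirectSum.IsInternal B) (f : M →ₗ[K] N)
    (hf : ∀ i, ∀ m ∈ A i, f m ∈ B i) (hinj : Function.Injective f) {i : ι} {m : M}
    (h : f m ∈ B i) : m ∈ A i := by
  have := map_proj hA hB f id Function.injective_id hf i m
  rw [id, proj_same hB h] at this
  rw [← hinj this]
  exact proj_mem hA i m

theorem linearMap_ext_internal {A : ι → Submodule K M} (hA : DirectSum.IsInternal A)
    {f g : M →ₗ[K] N} (h : ∀ i, ∀ m ∈ A i, f m = g m) : f = g := by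
  ext m
  induction m using internal_induction hA with
  | mem j m hm => exact h j m hm
  | zero => simp
  | add x y hx hy => rw [map_add, map_add, hx, hy]

/-- A linear map has a generalized inverse. -/
theorem exists_generalized_inverse (f : M →ₗ[K] N) : ∃ g : N →ₗ[K] M, ∀ x, f (g (f x)) = f x := by
  obtain ⟨s, hs⟩ := f.rangeRestrict.exists_rightInverse_of_surjective f.range_rangeRestrict
  obtain ⟨g, hg⟩ := s.exists_extend
  refine ⟨g, fun x => ?_⟩
  have h1 : g (f x) = s ⟨f x, LinearMap.mem_range_self f x⟩ :=
    LinearMap.congr_fun hg ⟨f x, LinearMap.mem_range_self f x⟩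
  have h2 := LinearMap.congr_fun hs ⟨f x, LinearMap.mem_range_self f x⟩
  rw [h1]
  exact congrArg Subtype.val h2

end LinearAlgebra

/-! ### Locally nilpotent endomorphisms -/

section LocallyNilpotent

/-- An endomorphism such that every element is killed by one of its iterates. -/
def LocNilpotent {M : Type*} (n : M → M) [Zero M] : Prop :=
  ∀ x, ∃ k : ℕ, n^[k] x = 0

theorem LocNilpotent.of_filtration {R M : Type*} [Semiring R] [AddCommMonoid M] [Module R M]
    {n : M → M}
    (Fil : ℕ → Submodule R M) (h0 : Fil 0 = ⊥) (hex : ∀ x, ∃ k, x ∈ Fil k)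
    (hn : ∀ k, ∀ x ∈ Fil (k + 1), n x ∈ Fil k) : LocNilpotent n := by
  intro x
  obtain ⟨k, hk⟩ := hex x
  refine ⟨k, ?_⟩
  induction k generalizing x with
  | zero => simpa [h0] using hk
  | succ k ih => exact ih _ (hn k x hk)

/-- If `n x = -x`, then every iterate of `n` at `x` is `± x`, so `x = 0`. A preimage of `x` is the
finite alternating sum of its iterates, built recursively as `x - y` with `y` a preimage of `n x`.
-/
theorem LocNilpotent.bijective_one_add {R M : Type*} [Ring R] [AddCommGroup M] [Module R M]
    {n : M →ₗ[R] M} (h : LocNilpotent ⇑n) : Function.Bijective ((LinearMap.id : M →ₗ[R] M) + n) := by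
  constructor
  · rw [← LinearMap.ker_eq_bot, LinearMap.ker_eq_bot']
    intro x hx
    have key : ∀ k : ℕ, n^[k] x = 0 → x = 0 := by
      intro k
      induction k with
      | zero => exact fun h => h
      | succ k ih =>
        intro hk
        refine ih ?_
        have h1 : n x = -x := by
          rw [LinearMap.add_apply, LinearMap.id_apply] at hx
          exact eq_neg_of_add_eq_zero_right hx
        rw [Function.iterate_succ_apply, h1, ← Module.End.pow_apply, map_neg, neg_eq_zero] at hk
        rwa [Module.End.pow_apply] at hk
    obtain ⟨k, hk⟩ := h x
    exact key k hk
  · intro x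
    have key : ∀ k : ℕ, ∀ x, n^[k] x = 0 → ∃ y, ((LinearMap.id : M →ₗ[R] M) + n) y = x := by
      intro k
      induction k with
      | zero => exact fun x hx => ⟨0, by simpa using hx.symm⟩
      | succ k ih =>
        intro x hx
        obtain ⟨y, hy⟩ := ih (n x) hx
        exact ⟨x - y, by rw [map_sub, hy]; simp⟩
    obtain ⟨k, hk⟩ := h x
    exact key k x hk

/-- If the identity is homotopic to a locally nilpotent map modulo a subcomplex `Z`, then the
relative cycles modulo `Z` are boundaries modulo `Z`. -/
theorem exists_sub_mem_of_homotopy {R M : Type*} [Ring R] [AddCommGroup M] [Module R M]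
    (D : M →ₗ[R] M) (hD : ∀ x, D (D x) = 0) (Y Z : Submodule R M) (hZ : ∀ z ∈ Z, D z ∈ Z)
    (h : M → M) (n : M → M) (hn : LocNilpotent n) (hY : ∀ x ∈ Y, h x ∈ Y)
    (hnY : ∀ x ∈ Y, n x ∈ Y) (hom : ∀ x ∈ Y, D x ∈ Z → x - D (h x) - n x ∈ Z) {x : M}
    (hx : x ∈ Y) (hDx : D x ∈ Z) : ∃ y ∈ Y, x - D y ∈ Z := by
  have key : ∀ k : ℕ, ∀ x ∈ Y, D x ∈ Z → n^[k] x = 0 → ∃ y ∈ Y, x - D y ∈ Z := by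
    intro k
    induction k with
    | zero =>
      intro x _ _ h0
      exact ⟨0, zero_mem _, by rw [Function.iterate_zero, id] at h0; simp [h0]⟩
    | succ k ih =>
      intro x hx hDx hk
      have h1 := hom x hx hDx
      -- Modulo `Z`, `n x` is `x - D (h x)`, so it is again a relative cycle, and one iterate fewer
      -- kills it.
      have h2 : D (n x) ∈ Z := by
        have := sub_mem hDx (hZ _ h1)
        rwa [map_sub, map_sub, hD, sub_zero, sub_sub_cancel] at this
      obtain ⟨y, hy, hy'⟩ := ih (n x) (hnY x hx) h2 hk
      refine ⟨h x + y, add_mem (hY x hx) hy, ?_⟩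
      have := add_mem h1 hy'
      rw [map_add]
      convert this using 1
      abel
  obtain ⟨k, hk⟩ := hn x
  exact key k x hx hDx hk

end LocallyNilpotent

/-! ### Morphisms of complexes -/

namespace GrComplex

variable {K : Type u} [Field K] {A : Type u} [Ring A] [Algebra K A] {𝒜 : ℤ → Submodule K A}

/-- The differential, as a linear map over the ground field. -/
def dK (C : GrComplex K 𝒜) : C.carrier →ₗ[K] C.carrier := C.d.restrictScalars K

@[simp] theorem dK_apply (C : GrComplex K 𝒜) (x : C.carrier) : C.dK x = C.d x := rfl

/-- A morphism of complexes, as a linear map over the ground field. -/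
def Hom.toLinK {C D : GrComplex K 𝒜} (f : Hom C D) : C.carrier →ₗ[K] D.carrier :=
  f.toLin.restrictScalars K

@[simp] theorem Hom.toLinK_apply {C D : GrComplex K 𝒜} (f : Hom C D) (x : C.carrier) :
    f.toLinK x = f.toLin x := rfl

/-- The composition of morphisms of complexes. -/
def Hom.comp {C D T : GrComplex K 𝒜} (g : Hom D T) (f : Hom C D) : Hom C T where
  toLin := g.toLin ∘ₗ f.toLin
  map_mem h := g.map_mem (f.map_mem h)
  comm m := by simp [f.comm, g.comm]

theorem Hom.homologyMap_class {C D : GrComplex K 𝒜} (f : Hom C D) (x : ↥(LinearMap.ker C.d)) :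
    f.homologyMap (C.homologyClass x) = D.homologyClass (f.cyclesMap x) := rfl

theorem homologyClass_surjective (C : GrComplex K 𝒜) : Function.Surjective C.homologyClass :=
  Submodule.mkQ_surjective _

theorem homologyClass_eq_zero_iff (C : GrComplex K 𝒜) (x : ↥(LinearMap.ker C.d)) :
    C.homologyClass x = 0 ↔ ∃ y, C.d y = x := by
  rw [homologyClass, Submodule.mkQ_apply, Submodule.Quotient.mk_eq_zero]
  rfl

theorem homologyClass_eq_iff (C : GrComplex K 𝒜) (x y : ↥(LinearMap.ker C.d)) :
    C.homologyClass x = C.homologyClass y ↔ ∃ z, C.d z = (x : C.carrier) - y := by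
  rw [← sub_eq_zero, ← map_sub, homologyClass_eq_zero_iff]
  rfl

/-- Elementwise form, in which injectivity and surjectivity on homology can be proved without
quotients. -/
theorem Hom.isQuasiIso_iff {C D : GrComplex K 𝒜} (f : Hom C D) :
    f.IsQuasiIso ↔ (∀ x, C.d x = 0 → ∀ z, f.toLin x = D.d z → ∃ w, C.d w = x) ∧
      ∀ y, D.d y = 0 → ∃ x, C.d x = 0 ∧ ∃ z, D.d z = f.toLin x - y := by
  unfold Hom.IsQuasiIso Function.Bijective
  refine and_congr ?_ ?_
  · rw [← LinearMap.ker_eq_bot, LinearMap.ker_eq_bot']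
    constructor
    · intro h x hx z hz
      have := h (C.homologyClass ⟨x, hx⟩) (by
        rw [f.homologyMap_class, homologyClass_eq_zero_iff]
        exact ⟨z, hz.symm⟩)
      rwa [homologyClass_eq_zero_iff] at this
    · intro h q hq
      obtain ⟨⟨x, hx⟩, rfl⟩ := C.homologyClass_surjective q
      rw [f.homologyMap_class, homologyClass_eq_zero_iff] at hq
      obtain ⟨z, hz⟩ := hq
      rw [homologyClass_eq_zero_iff]
      exact h x hx z hz.symm
  · constructor
    · intro h y hy
      obtain ⟨q, hq⟩ := h (D.homologyClass ⟨y, hy⟩)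
      obtain ⟨⟨x, hx⟩, rfl⟩ := C.homologyClass_surjective q
      rw [f.homologyMap_class, homologyClass_eq_iff] at hq
      exact ⟨x, hx, hq⟩
    · intro h q
      obtain ⟨⟨y, hy⟩, rfl⟩ := D.homologyClass_surjective q
      obtain ⟨x, hx, hz⟩ := h y hy
      refine ⟨C.homologyClass ⟨x, hx⟩, ?_⟩
      rw [f.homologyMap_class, homologyClass_eq_iff]
      exact hz

theorem Hom.IsQuasiIso.comp {C D T : GrComplex K 𝒜} {g : Hom D T} {f : Hom C D}
    (hg : g.IsQuasiIso) (hf : f.IsQuasiIso) : (g.comp f).IsQuasiIso := by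
  have h : ⇑(g.comp f).homologyMap = g.homologyMap ∘ f.homologyMap := by
    ext q
    obtain ⟨x, rfl⟩ := C.homologyClass_surjective q
    rfl
  unfold Hom.IsQuasiIso
  rw [h]
  exact Function.Bijective.comp hg hf

/-- The morphism of the homology complexes induced by a morphism of complexes. -/
def Hom.homology {C D : GrComplex K 𝒜} (f : Hom C D) : Hom C.homology D.homology where
  toLin := f.homologyMap
  map_mem := by
    rintro i j _ ⟨x, hx, rfl⟩
    exact ⟨f.cyclesMap x, f.map_mem hx, rfl⟩
  comm _ := map_zero _

/-- A bijective morphism of complexes reflects degrees. -/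
theorem Hom.mem_iff {C D : GrComplex K 𝒜} (f : Hom C D) (hf : Function.Injective f.toLin)
    {i j : ℤ} {m : C.carrier} : m ∈ C.deg i j ↔ f.toLin m ∈ D.deg i j :=
  ⟨f.map_mem, fun h => mem_of_map_mem (i := (i, j)) C.internal D.internal f.toLinK
    (fun _ _ hm => f.map_mem hm) hf h⟩

theorem HomogeneousBasis.LinearPartIso.comp {C D T : GrComplex K 𝒜} {b : C.HomogeneousBasis}
    (h : b.LinearPartIso D) (f : Hom D T) (hf : Function.Bijective f.toLin) :
    b.LinearPartIso T := by
  obtain ⟨Φ, h1, h2⟩ := h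
  refine ⟨Φ.trans (LinearEquiv.ofBijective f.toLin hf), fun i j m => ?_, fun m => ?_⟩
  · rw [h1, f.mem_iff hf.1]; rfl
  · simp [h2, f.comm]

/-- A resolution over `E` is a map into the injective complex, so the comparison of homologies
points the other way than over `S`. -/
theorem HomogeneousBasis.LinearPartIso.comp_symm {C D T : GrComplex K 𝒜} {b : C.HomogeneousBasis}
    (h : b.LinearPartIso D) (f : Hom T D) (hf : Function.Bijective f.toLin) :
    b.LinearPartIso T := by
  obtain ⟨Φ, h1, h2⟩ := h
  refine ⟨Φ.trans (LinearEquiv.ofBijective f.toLin hf).symm, fun i j m => ?_, fun m => ?_⟩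
  · rw [h1, f.mem_iff hf.1]
    simp only [LinearEquiv.trans_apply]
    rw [← LinearEquiv.ofBijective_apply f.toLin (hf := hf), LinearEquiv.apply_symm_apply]
  · simp only [LinearEquiv.trans_apply, h2]
    rw [LinearEquiv.symm_apply_eq, LinearEquiv.ofBijective_apply, f.comm]
    rw [← LinearEquiv.ofBijective_apply f.toLin (hf := hf), LinearEquiv.apply_symm_apply]

/-! #### Contracting homotopies -/

/-- The homogeneous part of cohomological degree `-1` and internal degree `0` of a linear map. -/
def homogenize (C : GrComplex K 𝒜) (s : C.carrier →ₗ[K] C.carrier) : C.carrier →ₗ[K] C.carrier :=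
  glue C.internal fun p => C.projDeg (p.1 - 1, p.2) ∘ₗ s

theorem homogenize_apply (C : GrComplex K 𝒜) (s : C.carrier →ₗ[K] C.carrier) {i j : ℤ}
    {m : C.carrier} (hm : m ∈ C.deg i j) : C.homogenize s m = C.projDeg (i - 1, j) (s m) :=
  glue_apply (i := (i, j)) C.internal _ hm

/-- A splitting of the differential over the ground field: a homotopy onto the homology. -/
structure Splitting (C : GrComplex K 𝒜) where
  h : C.carrier →ₗ[K] C.carrier
  mem : ∀ {i j : ℤ} {m : C.carrier}, m ∈ C.deg i j → h m ∈ C.deg (i - 1) j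
  h_h : ∀ m, h (h m) = 0
  d_h_d : ∀ m, C.d (h (C.d m)) = C.d m
  h_d_h : ∀ m, h (C.d (h m)) = h m

/-- Over a field `d` has a generalized inverse, and its homogeneous part `t` is still one. The other
identities are forced in two steps: `g = t d t` satisfies `g d g = g`, and `g - g g d` in addition
squares to zero. -/
theorem exists_splitting (C : GrComplex K 𝒜) : Nonempty C.Splitting := by
  obtain ⟨s, hs⟩ := exists_generalized_inverse C.dK
  simp only [dK_apply] at hs
  let t := C.homogenize s
  have ht : ∀ {i j m}, m ∈ C.deg i j → t m ∈ C.deg (i - 1) j := by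
    intro i j m hm
    rw [C.homogenize_apply s hm]
    exact C.projDeg_mem (i - 1, j) (s m)
  have htd : ∀ m, C.d (t (C.d m)) = C.d m := by
    intro m
    induction m using C.induction with
    | mem i j m hm =>
      rw [C.homogenize_apply s (C.d_mem hm), add_sub_cancel_right, ← C.projDeg_d, hs,
        C.projDeg_same (C.d_mem hm)]
    | zero => simp
    | add x y hx hy => simp only [map_add, hx, hy]
  let g : C.carrier →ₗ[K] C.carrier := t ∘ₗ C.dK ∘ₗ t
  have hg : ∀ {i j m}, m ∈ C.deg i j → g m ∈ C.deg (i - 1) j := by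
    intro i j m hm
    have := ht (C.d_mem (ht hm))
    rwa [sub_add_cancel] at this
  have g1 : ∀ m, C.d (g (C.d m)) = C.d m := fun m => by
    change C.d (t (C.d (t (C.d m)))) = _
    rw [htd, htd]
  have g2 : ∀ m, g (C.d (g m)) = g m := fun m => by
    change t (C.d (t (C.d (t (C.d (t m)))))) = t (C.d (t m))
    rw [htd, htd]
  refine ⟨⟨g - g ∘ₗ g ∘ₗ C.dK, ?_, ?_, ?_, ?_⟩⟩
  · intro i j m hm
    refine sub_mem (hg hm) ?_
    have := hg (hg (C.d_mem hm))
    rwa [add_sub_cancel_right] at this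
  · intro m
    simp only [LinearMap.sub_apply, LinearMap.comp_apply, dK_apply, map_sub, g2, sub_self]
  · intro m
    simp only [LinearMap.sub_apply, LinearMap.comp_apply, dK_apply, g1, C.d_d, map_zero, sub_zero]
  · intro m
    simp only [LinearMap.sub_apply, LinearMap.comp_apply, dK_apply, map_sub, g2, C.d_d,
      map_zero, sub_zero]

/-- A complex without homology. -/
def IsAcyclic (C : GrComplex K 𝒜) : Prop :=
  ∀ x, C.d x = 0 → ∃ y, C.d y = x

/-- The element `x - h d x` is a cycle because `d h d = d`, hence a boundary, and `d h` is the
identity on boundaries. The relation `h h = 0` removes the correction term. -/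
theorem IsAcyclic.splitting {C : GrComplex K 𝒜} (hC : C.IsAcyclic) (s : C.Splitting)
    (x : C.carrier) : C.d (s.h x) + s.h (C.d x) = x := by
  obtain ⟨z, hz⟩ := hC (x - s.h (C.d x)) (by rw [map_sub, s.d_h_d, sub_self])
  have h1 : C.d (s.h (x - s.h (C.d x))) = x - s.h (C.d x) := by rw [← hz, s.d_h_d]
  rw [map_sub, s.h_h, sub_zero] at h1
  rw [h1, sub_add_cancel]

/-! #### The mapping cone -/

/-- The mapping cone of a morphism of complexes. -/
def cone {C D : GrComplex K 𝒜} (f : Hom C D) : GrComplex K 𝒜 where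
  carrier := D.carrier × C.carrier
  deg i j := (D.deg i j).prod (C.deg (i + 1) j)
  internal := by
    refine isInternal_of_proj
      (fun p => (D.projDeg p).prodMap (C.projDeg (p.1 + 1, p.2))) ?_ ?_ ?_
    · rintro ⟨i, j⟩ ⟨y, x⟩ ⟨hy, hx⟩
      exact Prod.ext (D.projDeg_same hy) (C.projDeg_same hx)
    · rintro ⟨i, j⟩ ⟨i', j'⟩ hne ⟨y, x⟩ ⟨hy, hx⟩
      refine Prod.ext (D.projDeg_ne hy hne) (C.projDeg_ne hx fun h => hne ?_)
      simp only [Prod.mk.injEq, add_left_inj] at h ⊢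
      exact h
    · rw [eq_top_iff]
      rintro ⟨y, x⟩ -
      have hy : ((y, 0) : D.carrier × C.carrier) ∈
          ⨆ p : ℤ × ℤ, (D.deg p.1 p.2).prod (C.deg (p.1 + 1) p.2) := by
        induction y using D.induction with
        | mem i j m hm => exact Submodule.mem_iSup_of_mem (i, j) ⟨hm, zero_mem _⟩
        | zero => exact zero_mem _
        | add a b ha hb => simpa using add_mem ha hb
      have hx : ((0, x) : D.carrier × C.carrier) ∈
          ⨆ p : ℤ × ℤ, (D.deg p.1 p.2).prod (C.deg (p.1 + 1) p.2) := by
        induction x using C.induction with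
        | mem i j m hm =>
          exact Submodule.mem_iSup_of_mem (i - 1, j) ⟨zero_mem _, by
            change m ∈ C.deg (i - 1 + 1) j
            rwa [sub_add_cancel]⟩
        | zero => exact zero_mem _
        | add a b ha hb => simpa using add_mem ha hb
      simpa using add_mem hy hx
  smul_mem := fun ha hm => ⟨D.smul_mem ha hm.1, C.smul_mem ha hm.2⟩
  d := (D.d ∘ₗ LinearMap.fst A _ _ + f.toLin ∘ₗ LinearMap.snd A _ _).prod
    (-(C.d ∘ₗ LinearMap.snd A _ _))
  d_mem := fun hm => ⟨add_mem (D.d_mem hm.1) (f.map_mem hm.2), neg_mem (C.d_mem hm.2)⟩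
  d_d := by
    rintro ⟨y, x⟩
    ext
    · simp [D.d_d, f.comm]
    · simp [C.d_d]

theorem cone_d {C D : GrComplex K 𝒜} (f : Hom C D) (y : D.carrier) (x : C.carrier) :
    (cone f).d (y, x) = (D.d y + f.toLin x, -C.d x) := rfl

/-- The first projection of the mapping cone. -/
def coneFst {C D : GrComplex K 𝒜} (f : Hom C D) : (cone f).carrier →ₗ[A] D.carrier :=
  LinearMap.fst A D.carrier C.carrier

/-- The second projection of the mapping cone. -/
def coneSnd {C D : GrComplex K 𝒜} (f : Hom C D) : (cone f).carrier →ₗ[A] C.carrier :=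
  LinearMap.snd A D.carrier C.carrier

/-- The inclusion of the target in the mapping cone. -/
def coneInl {C D : GrComplex K 𝒜} (f : Hom C D) : D.carrier →ₗ[A] (cone f).carrier :=
  LinearMap.inl A D.carrier C.carrier

/-- The inclusion of the shifted source in the mapping cone. -/
def coneInr {C D : GrComplex K 𝒜} (f : Hom C D) : C.carrier →ₗ[A] (cone f).carrier :=
  LinearMap.inr A D.carrier C.carrier

section cone

variable {C D : GrComplex K 𝒜} (f : Hom C D)

@[simp] theorem coneFst_inl (y : D.carrier) : coneFst f (coneInl f y) = y := rfl

@[simp] theorem coneFst_inr (x : C.carrier) : coneFst f (coneInr f x) = 0 := rfl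

@[simp] theorem coneSnd_inl (y : D.carrier) : coneSnd f (coneInl f y) = 0 := rfl

@[simp] theorem coneSnd_inr (x : C.carrier) : coneSnd f (coneInr f x) = x := rfl

theorem cone_eq (z : (cone f).carrier) :
    coneInl f (coneFst f z) + coneInr f (coneSnd f z) = z :=
  Prod.ext (add_zero z.1) (zero_add z.2)

theorem coneFst_d (z : (cone f).carrier) :
    coneFst f ((cone f).d z) = D.d (coneFst f z) + f.toLin (coneSnd f z) := rfl

theorem coneSnd_d (z : (cone f).carrier) : coneSnd f ((cone f).d z) = -C.d (coneSnd f z) := rfl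

theorem coneFst_sign (z : (cone f).carrier) :
    coneFst f ((cone f).sign z) = D.sign (coneFst f z) := by
  induction z using (cone f).induction with
  | mem i j m hm =>
    rw [(cone f).sign_apply hm, map_zsmul]
    exact (D.sign_apply hm.1).symm
  | zero => simp
  | add x y hx hy => simp only [map_add, hx, hy]

/-- The source sits in the cone shifted by one degree, which changes the sign. -/
theorem coneSnd_sign (z : (cone f).carrier) :
    coneSnd f ((cone f).sign z) = -C.sign (coneSnd f z) := by
  induction z using (cone f).induction with
  | mem i j m hm =>
    rw [(cone f).sign_apply hm, map_zsmul, show C.sign (coneSnd f m) = _ from C.sign_apply hm.2,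
      Int.negOnePow_succ, Units.val_neg, neg_smul, neg_neg]
  | zero => simp
  | add x y hx hy => simp only [map_add, hx, hy, neg_add]

end cone

/-- For a cycle `(y, x)` one has `f x = -d y`, so injectivity on homology gives `x = d w`, and
surjectivity applies to the cycle `y + f w`. This reduces the preservation of quasi-isomorphisms by
`L` and `R` to acyclic complexes. -/
theorem Hom.IsQuasiIso.cone_acyclic {C D : GrComplex K 𝒜} {f : Hom C D} (hf : f.IsQuasiIso) :
    (cone f).IsAcyclic := by
  rw [f.isQuasiIso_iff] at hf
  rintro ⟨y, x⟩ h
  rw [cone_d] at h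
  have h1 : D.d y + f.toLin x = 0 := congrArg Prod.fst h
  have h2 : C.d x = 0 := neg_eq_zero.1 (congrArg Prod.snd h)
  obtain ⟨w, rfl⟩ := hf.1 x h2 (-y) (by rw [map_neg, eq_neg_iff_add_eq_zero, add_comm, h1])
  obtain ⟨x', hx', z, hz⟩ := hf.2 (y + f.toLin w) (by rw [map_add, ← f.comm, h1])
  refine ⟨(-z, x' - w), ?_⟩
  rw [cone_d, map_neg, hz, map_sub, map_sub, hx']
  refine Prod.ext ?_ ?_
  · change -(f.toLin x' - (y + f.toLin w)) + (f.toLin x' - f.toLin w) = y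
    abel
  · change -(0 - C.d w) = C.d w
    simp

end GrComplex

/-! ### The functors `L` and `R` on morphisms -/

section Functors

variable {K : Type u} [Field K] {V : Type u} [AddCommGroup V] [Module K V]
  {v : ℕ} (e : Module.Basis (Fin v) K V)

theorem extGrading_pos {s : ℤ} (hs : 0 < s) : extGrading K V s = ⊥ := by
  rw [extGrading, eq_bot_iff]
  refine iSup₂_le fun k hk => ?_
  omega

include e in
theorem exists_extGrading_eq_bot : ∃ p : ℕ, ∀ s : ℤ, s ≤ -(p : ℤ) → extGrading K V s = ⊥ := by
  obtain ⟨b, hb⟩ := (extGrading_finite e).bddBelow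
  refine ⟨(1 - b).toNat, fun s hs => ?_⟩
  by_contra h
  have := hb (show s ∈ {s : ℤ | extGrading K V s ≠ ⊥} from h)
  omega

/-- A linear map on `E` is determined by its values on homogeneous elements. -/
theorem HomE.ext_of_mem {F : Type u} [AddCommGroup F] [Module K F] {α β : HomE K V F}
    (h : ∀ s : ℤ, ∀ a ∈ extGrading K V s, α a = β a) : α = β :=
  linearMap_ext_internal (extGrading_isInternal K V) h

/-- Composition with a linear map. -/
def HomE.post {F F' : Type u} [AddCommGroup F] [Module K F] [AddCommGroup F'] [Module K F']
    (f : F →ₗ[K] F') : HomE K V F →ₗ[E K V] HomE K V F' where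
  toFun α := (f ∘ₗ (α : E K V →ₗ[K] F) : E K V →ₗ[K] F')
  map_add' α β := by ext a; exact map_add f _ _
  map_smul' b α := rfl

@[simp] theorem HomE.post_apply {F F' : Type u} [AddCommGroup F] [Module K F] [AddCommGroup F']
    [Module K F'] (f : F →ₗ[K] F') (α : HomE K V F) (a : E K V) :
    HomE.post f α a = f (α a) := rfl

@[simp] theorem HomE.neg_apply {F : Type u} [AddCommGroup F] [Module K F] (α : HomE K V F)
    (a : E K V) : (-α) a = -α a := rfl

@[simp] theorem HomE.sub_apply {F : Type u} [AddCommGroup F] [Module K F] (α β : HomE K V F)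
    (a : E K V) : (α - β) a = α a - β a := rfl

/-- The Koszul part of the differential of `R(F)`. -/
def Rδ (F : SComplex K V) : HomE K V F.carrier →ₗ[E K V] HomE K V F.carrier :=
  Rd e F - HomE.post F.dK

theorem Rδ_apply (F : SComplex K V) (α : HomE K V F.carrier) (a : E K V) :
    Rδ e F α a = ∑ r, F.sign (xS e r • α (eE e r * a)) := by
  rw [Rδ, LinearMap.sub_apply, HomE.sub_apply, Rd_apply, HomE.post_apply, F.dK_apply,
    add_sub_cancel_left]

theorem Rd_eq (F : SComplex K V) (α : HomE K V F.carrier) :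
    Rd e F α = HomE.post F.dK α + Rδ e F α := by
  rw [Rδ, LinearMap.sub_apply, add_sub_cancel]

/-- The Koszul part of the differential of `L(G)`. -/
def Lδ (G : EComplex K V) : S K V ⊗[K] G.carrier →ₗ[S K V] S K V ⊗[K] G.carrier :=
  ∑ r, xS e r • (G.sign ∘ₗ Algebra.lsmul K K G.carrier (eE e r)).baseChange (S K V)

theorem Lδ_tmul (G : EComplex K V) (s : S K V) (g : G.carrier) :
    Lδ e G (s ⊗ₜ g) = ∑ r, (xS e r * s) ⊗ₜ[K] G.sign (eE e r • g) := by
  simp [Lδ, LinearMap.sum_apply, TensorProduct.smul_tmul']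

theorem Ld_eq (G : EComplex K V) (x : S K V ⊗[K] G.carrier) :
    Ld e G x = G.dK.baseChange (S K V) x + Lδ e G x := rfl

theorem GrComplex.Hom.map_sign {A : Type u} [Ring A] [Algebra K A] {𝒜 : ℤ → Submodule K A}
    {C D : GrComplex K 𝒜} (f : GrComplex.Hom C D) (m : C.carrier) :
    f.toLin (C.sign m) = D.sign (f.toLin m) := by
  induction m using C.induction with
  | mem i j m hm =>
    rw [C.sign_apply hm, D.sign_apply (f.map_mem hm), map_zsmul]
  | zero => simp
  | add x y hx hy => simp only [map_add, hx, hy]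

theorem post_Rd {F F' : SComplex K V} (f : GrComplex.Hom F F') (α : HomE K V F.carrier) :
    HomE.post f.toLinK (Rd e F α) = Rd e F' (HomE.post f.toLinK α) := by
  refine HomE.ext fun a => ?_
  simp only [HomE.post_apply, Rd_apply, GrComplex.Hom.toLinK_apply, map_add, map_sum, f.comm,
    f.map_sign, map_smul]

/-- The functor `R` on morphisms. -/
def Rmap {F F' : SComplex K V} (f : GrComplex.Hom F F') : GrComplex.Hom (R e F) (R e F') where
  toLin := HomE.post f.toLinK
  map_mem hα s a ha := f.map_mem (hα s a ha)
  comm := post_Rd e f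

/-- The functor `L` on morphisms. -/
def Lmap {G G' : EComplex K V} (f : GrComplex.Hom G G') : GrComplex.Hom (L e G) (L e G') where
  toLin := f.toLinK.baseChange (S K V)
  map_mem {k t m} hm := by
    refine LDeg_le G (N := (LDeg G' k t).comap ((f.toLinK.baseChange (S K V)).restrictScalars K))
      ?_ hm
    intro a i j hk ht s hs g hg
    exact tmul_mem_LDeg G' hs (f.map_mem hg) hk ht
  comm x := by
    change f.toLinK.baseChange (S K V) (Ld e G x) = Ld e G' (f.toLinK.baseChange (S K V) x)
    induction x using TensorProduct.induction_on with
    | zero => simp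
    | add x y hx hy => simp only [map_add, hx, hy]
    | tmul s g =>
      simp [Ld_tmul, f.comm, f.map_sign]

theorem Rmap_bijective {F F' : SComplex K V} {f : GrComplex.Hom F F'}
    (hf : Function.Bijective f.toLin) : Function.Bijective (Rmap e f).toLin := by
  let g : F.carrier ≃ₗ[K] F'.carrier := LinearEquiv.ofBijective f.toLinK hf
  refine Function.bijective_iff_has_inverse.2
    ⟨HomE.post g.symm.toLinearMap, fun α => ?_, fun α => ?_⟩
  · exact HomE.ext fun a => g.symm_apply_apply ((show HomE K V F.carrier from α) a)
  · exact HomE.ext fun a => g.apply_symm_apply ((show HomE K V F'.carrier from α) a)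

theorem Lmap_bijective {G G' : EComplex K V} {f : GrComplex.Hom G G'}
    (hf : Function.Bijective f.toLin) : Function.Bijective (Lmap e f).toLin :=
  ((LinearEquiv.ofBijective f.toLinK hf).baseChange K (S K V) _ _).bijective

/-! ### The functors `L` and `R` preserve quasi-isomorphisms -/

/-- The maps that vanish on the components of `E` of degree at most `-n`. -/
def RFil (V : Type u) [AddCommGroup V] [Module K V] (F : Type u) [AddCommGroup F] [Module K F]
    (n : ℕ) : Submodule K (HomE K V F) where
  carrier := {α | ∀ s : ℤ, s ≤ -(n : ℤ) → ∀ a ∈ extGrading K V s, α a = 0}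
  zero_mem' := fun _ _ _ _ => rfl
  add_mem' := fun hα hβ s hs a ha => by rw [HomE.add_apply, hα s hs a ha, hβ s hs a ha, add_zero]
  smul_mem' := fun c α hα s hs a ha => by rw [HomE.smulK_apply, hα s hs a ha, smul_zero]

theorem RFil_zero (F : Type u) [AddCommGroup F] [Module K F] : RFil V F 0 = (⊥ : Submodule K _) := by
  rw [eq_bot_iff]
  intro α hα
  refine HomE.ext_of_mem fun s a ha => ?_
  by_cases hs : s ≤ 0
  · exact hα s (by simpa using hs) a ha
  · rw [extGrading_pos (not_le.1 hs), Submodule.mem_bot] at ha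
    rw [ha, map_zero, map_zero]

include e in
theorem exists_mem_RFil (F : Type u) [AddCommGroup F] [Module K F] (α : HomE K V F) :
    ∃ n, α ∈ RFil V F n := by
  obtain ⟨p, hp⟩ := exists_extGrading_eq_bot e
  refine ⟨p, fun s hs a ha => ?_⟩
  rw [hp s hs, Submodule.mem_bot] at ha
  rw [ha, map_zero]

theorem post_mem_RFil {F F' : Type u} [AddCommGroup F] [Module K F] [AddCommGroup F'] [Module K F']
    (f : F →ₗ[K] F') {n : ℕ} {α : HomE K V F} (hα : α ∈ RFil V F n) :
    HomE.post f α ∈ RFil V F' n := fun s hs a ha => by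
  rw [HomE.post_apply, hα s hs a ha, map_zero]

/-- The Koszul part evaluates at `e_r a`, one degree below `a`, which shifts the filtration by one.
-/
theorem Rδ_mem_RFil (F : SComplex K V) {n : ℕ} {α : HomE K V F.carrier}
    (hα : α ∈ RFil V F.carrier (n + 1)) : Rδ e F α ∈ RFil V F.carrier n := fun s hs a ha => by
  rw [Rδ_apply]
  refine Finset.sum_eq_zero fun r _ => ?_
  rw [hα (-1 + s) (by push_cast; omega) _ (mul_mem_extGrading K V (eE_mem e r) ha), smul_zero,
    map_zero]

/-- A contracting homotopy of `F` over `K`, applied to the values of maps, contracts `R(F)` up to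
its anticommutator with the Koszul part. This error lowers `RFil`, a filtration that is finite
because `E` is finite-dimensional. -/
theorem R_acyclic {F : SComplex K V} (hF : F.IsAcyclic) : (R e F).IsAcyclic := by
  obtain ⟨sp⟩ := F.exists_splitting
  intro (α : HomE K V F.carrier) (hα : Rd e F α = 0)
  let h : HomE K V F.carrier →ₗ[E K V] HomE K V F.carrier := HomE.post sp.h
  obtain ⟨β, -, hβ⟩ := exists_sub_mem_of_homotopy (Rd e F) (R e F).d_d ⊤ ⊥ (by simp)
    h (fun α => -(h (Rδ e F α) + Rδ e F (h α)))
    (LocNilpotent.of_filtration (RFil V F.carrier) (RFil_zero _) (exists_mem_RFil e _)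
      fun n α hα => neg_mem (add_mem (post_mem_RFil _ (Rδ_mem_RFil e F hα))
        (Rδ_mem_RFil e F (post_mem_RFil _ hα))))
    (fun _ _ => trivial) (fun _ _ => trivial) (x := α) (by
      intro α _ hα
      rw [Submodule.mem_bot] at hα ⊢
      have h1 : HomE.post F.dK (h α) + h (HomE.post F.dK α) = α :=
        HomE.ext fun a => hF.splitting sp (α a)
      rw [Rd_eq] at hα ⊢
      -- On a cycle the internal part of the differential is minus the Koszul part, so the
      -- contraction identity becomes `α - D (h α) = -(h δ + δ h) α`.
      rw [eq_neg_of_add_eq_zero_left hα, map_neg] at h1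
      nth_rewrite 1 [← h1]
      abel) trivial hα
  rw [Submodule.mem_bot, sub_eq_zero] at hβ
  exact ⟨β, hβ.symm⟩

/-- The two projections identify `R` of the cone of `f`, which is acyclic, with the cone of `R(f)`.
Acyclicity of the latter gives back injectivity and surjectivity on homology. -/
theorem Rmap_isQuasiIso {F F' : SComplex K V} {f : GrComplex.Hom F F'} (hf : f.IsQuasiIso) :
    (Rmap e f).IsQuasiIso := by
  have hc := R_acyclic e hf.cone_acyclic
  let i1 := (GrComplex.coneInl f).restrictScalars K
  let i2 := (GrComplex.coneInr f).restrictScalars K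
  let p1 := (GrComplex.coneFst f).restrictScalars K
  let p2 := (GrComplex.coneSnd f).restrictScalars K
  have hp1 : ∀ γ, HomE.post p1 (Rd e (GrComplex.cone f) γ) =
      Rd e F' (HomE.post p1 γ) + HomE.post f.toLinK (HomE.post p2 γ) := by
    intro γ
    refine HomE.ext fun a => ?_
    simp only [p1, p2, HomE.add_apply, HomE.post_apply, Rd_apply, LinearMap.coe_restrictScalars,
      map_add, map_sum, GrComplex.coneFst_d, GrComplex.coneFst_sign, map_smul,
      GrComplex.Hom.toLinK_apply]
    abel
  have hp2 : ∀ γ, HomE.post p2 (Rd e (GrComplex.cone f) γ) = -Rd e F (HomE.post p2 γ) := by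
    intro γ
    refine HomE.ext fun a => ?_
    simp only [p2, HomE.neg_apply, HomE.post_apply, Rd_apply, LinearMap.coe_restrictScalars,
      map_add, map_sum, GrComplex.coneSnd_d, GrComplex.coneSnd_sign, map_smul,
      Finset.sum_neg_distrib]
    abel
  have key : ∀ (β : HomE K V F'.carrier) (α : HomE K V F.carrier),
      Rd e F' β + HomE.post f.toLinK α = 0 → Rd e F α = 0 →
      ∃ β' α', Rd e F' β' + HomE.post f.toLinK α' = β ∧ -Rd e F α' = α := by
    intro β α h1 h2
    have e1 : HomE.post p1 (HomE.post i1 β + HomE.post i2 α) = β := HomE.ext fun a => by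
      simp [i1, i2, p1]
    have e2 : HomE.post p2 (HomE.post i1 β + HomE.post i2 α) = α := HomE.ext fun a => by
      simp [i1, i2, p2]
    obtain ⟨γ, hγ⟩ : ∃ γ, Rd e (GrComplex.cone f) γ = HomE.post i1 β + HomE.post i2 α := by
      refine hc (HomE.post i1 β + HomE.post i2 α) ?_
      change Rd e (GrComplex.cone f) (HomE.post i1 β + HomE.post i2 α) = 0
      have h3 := hp1 (HomE.post i1 β + HomE.post i2 α)
      have h4 := hp2 (HomE.post i1 β + HomE.post i2 α)
      rw [e1, e2, h1] at h3
      rw [e2, h2, neg_zero] at h4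
      refine HomE.ext fun a => ?_
      rw [← GrComplex.cone_eq f (Rd e (GrComplex.cone f) _ a)]
      have h5 : GrComplex.coneFst f
        (Rd e (GrComplex.cone f) (HomE.post i1 β + HomE.post i2 α) a) = 0 :=
        congrArg (fun γ : HomE K V F'.carrier => γ a) h3
      have h6 : GrComplex.coneSnd f
        (Rd e (GrComplex.cone f) (HomE.post i1 β + HomE.post i2 α) a) = 0 :=
        congrArg (fun γ : HomE K V F.carrier => γ a) h4
      rw [h5, h6, map_zero, map_zero, add_zero, HomE.zero_apply]
    exact ⟨HomE.post p1 γ, HomE.post p2 γ, by rw [← hp1, hγ, e1], by rw [← hp2, hγ, e2]⟩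
  rw [GrComplex.Hom.isQuasiIso_iff]
  constructor
  · intro (α : HomE K V F.carrier) (hα : Rd e F α = 0) (β : HomE K V F'.carrier)
      (hβ : HomE.post f.toLinK α = Rd e F' β)
    obtain ⟨β', α', -, h⟩ := key (-β) α (by
      rw [map_neg, neg_add_eq_zero]; exact hβ.symm) hα
    exact ⟨-α', (map_neg (Rd e F) α').trans h⟩
  · intro (β : HomE K V F'.carrier) (hβ : Rd e F' β = 0)
    obtain ⟨β', α', h1, h2⟩ := key β 0 (by rw [map_zero, add_zero]; exact hβ) (map_zero _)
    refine ⟨α', neg_eq_zero.1 h2, (-β' : HomE K V F'.carrier), ?_⟩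
    change Rd e F' (-β') = HomE.post f.toLinK α' - β
    rw [map_neg, ← h1]
    abel

/-- The elements of `C` of cohomological degree less than `n`. -/
def cohFil {A : Type u} [Ring A] [Algebra K A] {𝒜 : ℤ → Submodule K A} (C : GrComplex K 𝒜)
    (n : ℤ) : Submodule K C.carrier :=
  ⨆ (p : ℤ × ℤ) (_ : p.1 < n), C.deg p.1 p.2

/-- The elements of `S ⊗ G` of cohomological degree of `G` less than `n`. -/
def LFil (G : EComplex K V) (n : ℤ) : Submodule K (S K V ⊗[K] G.carrier) :=
  Submodule.map₂ (TensorProduct.mk K (S K V) G.carrier) ⊤ (cohFil G n)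

theorem tmul_mem_LFil (G : EComplex K V) {n i j : ℤ} (hi : i < n) (s : S K V) {g : G.carrier}
    (hg : g ∈ G.deg i j) : s ⊗ₜ[K] g ∈ LFil G n :=
  Submodule.apply_mem_map₂ _ trivial <|
    Submodule.mem_iSup_of_mem (i, j) (Submodule.mem_iSup_of_mem hi hg)

theorem LFil_le (G : EComplex K V) {n : ℤ} {N : Submodule K (S K V ⊗[K] G.carrier)}
    (h : ∀ i j : ℤ, i < n → ∀ s : S K V, ∀ g ∈ G.deg i j, s ⊗ₜ[K] g ∈ N) : LFil G n ≤ N := by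
  refine Submodule.map₂_le.2 fun s _ g hg => ?_
  have : cohFil G n ≤ N.comap (TensorProduct.mk K (S K V) G.carrier s) :=
    iSup₂_le fun p hp g hg => h p.1 p.2 hp s g hg
  exact this hg

theorem LFil_eq_bot (G : EComplex K V) {a : ℤ} (ha : ∀ i j, i < a → G.deg i j = ⊥) :
    LFil G a = ⊥ := by
  rw [eq_bot_iff]
  refine LFil_le G fun i j hi s g hg => ?_
  rw [ha i j hi, Submodule.mem_bot] at hg
  rw [hg, TensorProduct.tmul_zero]
  exact zero_mem _

theorem LFil_mono (G : EComplex K V) {m n : ℤ} (h : m ≤ n) : LFil G m ≤ LFil G n :=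
  LFil_le G fun _ _ hi s _ hg => tmul_mem_LFil G (hi.trans_le h) s hg

theorem exists_mem_LFil (G : EComplex K V) (a : ℤ) (x : S K V ⊗[K] G.carrier) :
    ∃ n : ℕ, x ∈ LFil G (a + n) := by
  have hadd : ∀ x y, (∃ n : ℕ, x ∈ LFil G (a + n)) → (∃ n : ℕ, y ∈ LFil G (a + n)) →
      ∃ n : ℕ, x + y ∈ LFil G (a + n) := by
    rintro x y ⟨m, hm⟩ ⟨n, hn⟩
    exact ⟨max m n, add_mem (LFil_mono G (by simp) hm) (LFil_mono G (by simp) hn)⟩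
  induction x using TensorProduct.induction_on with
  | zero => exact ⟨0, zero_mem _⟩
  | add x y hx hy => exact hadd x y hx hy
  | tmul s g =>
    induction g using G.induction with
    | mem i j g hg => exact ⟨(i - a + 1).toNat, tmul_mem_LFil G (by omega) s hg⟩
    | zero => exact ⟨0, by rw [TensorProduct.tmul_zero]; exact zero_mem _⟩
    | add x y hx hy => rw [TensorProduct.tmul_add]; exact hadd _ _ hx hy

theorem Lδ_mem_LFil (G : EComplex K V) {n : ℤ} {x : S K V ⊗[K] G.carrier} (hx : x ∈ LFil G n) :
    Lδ e G x ∈ LFil G n := by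
  refine LFil_le G (N := (LFil G n).comap ((Lδ e G).restrictScalars K)) ?_ hx
  intro i j hi s g hg
  simp only [Submodule.mem_comap, LinearMap.coe_restrictScalars, Lδ_tmul]
  exact Submodule.sum_mem _ fun r _ =>
    tmul_mem_LFil G hi _ (G.sign_mem (G.smul_mem (eE_mem e r) hg))

theorem splitting_mem_LFil {G : EComplex K V} (sp : G.Splitting) {n : ℤ}
    {x : S K V ⊗[K] G.carrier} (hx : x ∈ LFil G (n + 1)) :
    sp.h.baseChange (S K V) x ∈ LFil G n := by
  refine LFil_le G (N := (LFil G n).comap ((sp.h.baseChange (S K V)).restrictScalars K)) ?_ hx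
  intro i j hi s g hg
  exact tmul_mem_LFil G (by omega) s (sp.mem hg)

/-- As for `R`, but with the filtration by cohomological degree in `G`: the contracting homotopy
lowers it by one and the Koszul part preserves it. Boundedness below makes the filtration start at
zero. -/
theorem L_acyclic {G : EComplex K V} (hb : G.IsBoundedBelow) (hG : G.IsAcyclic) :
    (L e G).IsAcyclic := by
  obtain ⟨sp⟩ := G.exists_splitting
  obtain ⟨a, ha⟩ := hb
  intro (x : S K V ⊗[K] G.carrier) (hx : Ld e G x = 0)
  let h := sp.h.baseChange (S K V)
  obtain ⟨y, -, hy⟩ := exists_sub_mem_of_homotopy (Ld e G) (L e G).d_d ⊤ ⊥ (by simp)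
    h (fun x => -(h (Lδ e G x) + Lδ e G (h x)))
    (LocNilpotent.of_filtration (fun n : ℕ => LFil G (a + n)) (by simpa using LFil_eq_bot G ha)
      (exists_mem_LFil G a)
      fun n x hx => by
        rw [Nat.cast_succ, ← add_assoc] at hx
        exact neg_mem (add_mem (splitting_mem_LFil sp (Lδ_mem_LFil e G hx))
          (Lδ_mem_LFil e G (splitting_mem_LFil sp hx))))
    (fun _ _ => trivial) (fun _ _ => trivial) (x := x) (by
      intro x _ hx
      rw [Submodule.mem_bot] at hx ⊢
      have h1 : G.dK.baseChange (S K V) (h x) + h (G.dK.baseChange (S K V) x) = x := by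
        rw [← LinearMap.comp_apply, ← LinearMap.comp_apply, ← LinearMap.baseChange_comp,
          ← LinearMap.baseChange_comp, ← LinearMap.add_apply, ← LinearMap.baseChange_add,
          show G.dK ∘ₗ sp.h + sp.h ∘ₗ G.dK = LinearMap.id from
            LinearMap.ext fun g => hG.splitting sp g, LinearMap.baseChange_id, LinearMap.id_apply]
      rw [Ld_eq] at hx ⊢
      rw [eq_neg_of_add_eq_zero_left hx, map_neg] at h1
      nth_rewrite 1 [← h1]
      abel) trivial hx
  rw [Submodule.mem_bot, sub_eq_zero] at hy
  exact ⟨y, hy.symm⟩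

theorem Lmap_isQuasiIso {G G' : EComplex K V} {f : GrComplex.Hom G G'} (hG : G.IsBoundedBelow)
    (hG' : G'.IsBoundedBelow) (hf : f.IsQuasiIso) : (Lmap e f).IsQuasiIso := by
  have hc := L_acyclic e (G := GrComplex.cone f) (by
    obtain ⟨a, ha⟩ := hG
    obtain ⟨b, hb⟩ := hG'
    -- The source enters the cone in degree `i + 1`, hence the bound `a - 1`.
    refine ⟨min (a - 1) b, fun i j hi => ?_⟩
    change (G'.deg i j).prod (G.deg (i + 1) j) = ⊥
    rw [hb i j (by omega), ha (i + 1) j (by omega), Submodule.prod_bot]) hf.cone_acyclic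
  let i1 := ((GrComplex.coneInl f).restrictScalars K).baseChange (S K V)
  let i2 := ((GrComplex.coneInr f).restrictScalars K).baseChange (S K V)
  let p1 := ((GrComplex.coneFst f).restrictScalars K).baseChange (S K V)
  let p2 := ((GrComplex.coneSnd f).restrictScalars K).baseChange (S K V)
  let f' := f.toLinK.baseChange (S K V)
  have hp1 : ∀ z, p1 (Ld e (GrComplex.cone f) z) = Ld e G' (p1 z) + f' (p2 z) := by
    intro z
    induction z using TensorProduct.induction_on with
    | zero => simp only [map_zero, add_zero]
    | add x y hx hy => rw [map_add, map_add, hx, hy]; simp only [map_add]; abel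
    | tmul s z =>
      simp only [p1, p2, f', Ld_tmul, map_add, map_sum, LinearMap.baseChange_tmul,
        LinearMap.coe_restrictScalars, GrComplex.coneFst_d, GrComplex.coneFst_sign, map_smul,
        TensorProduct.tmul_add, GrComplex.Hom.toLinK_apply]
      abel
  have hp2 : ∀ z, p2 (Ld e (GrComplex.cone f) z) = -Ld e G (p2 z) := by
    intro z
    induction z using TensorProduct.induction_on with
    | zero => simp only [map_zero, neg_zero]
    | add x y hx hy => rw [map_add, map_add, hx, hy]; simp only [map_add]; abel
    | tmul s z =>
      simp only [p2, Ld_tmul, map_add, map_sum, LinearMap.baseChange_tmul,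
        LinearMap.coe_restrictScalars, GrComplex.coneSnd_d, GrComplex.coneSnd_sign, map_smul,
        TensorProduct.tmul_neg, Finset.sum_neg_distrib]
      abel
  -- The identity `i1 p1 + i2 p2 = 1` of the cone survives tensoring with `S`, so the two
  -- projections detect zero.
  have hext : ∀ z, p1 z = 0 → p2 z = 0 → z = 0 := by
    intro z h1 h2
    have : i1 (p1 z) + i2 (p2 z) = z := by
      clear h1 h2
      induction z using TensorProduct.induction_on with
      | zero => simp only [map_zero, add_zero]
      | add x y hx hy =>
        refine Eq.trans ?_ (congrArg₂ (· + ·) hx hy)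
        simp only [map_add]
        abel
      | tmul s z =>
        simp only [p1, p2, i1, i2, LinearMap.baseChange_tmul, LinearMap.coe_restrictScalars,
          ← TensorProduct.tmul_add, GrComplex.cone_eq]
    rw [← this, h1, h2, map_zero, map_zero, add_zero]
  have e1 : ∀ y x, p1 (i1 y + i2 x) = y := fun y x => by
    have h1 : p1 ∘ₗ i1 = LinearMap.id := by
      rw [← LinearMap.baseChange_comp, ← LinearMap.baseChange_id]; rfl
    have h2 : p1 ∘ₗ i2 = 0 := by
      rw [← LinearMap.baseChange_comp, ← LinearMap.baseChange_zero]; rfl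
    rw [map_add, ← LinearMap.comp_apply, h1, ← LinearMap.comp_apply, h2]
    simp
  have e2 : ∀ y x, p2 (i1 y + i2 x) = x := fun y x => by
    have h1 : p2 ∘ₗ i1 = 0 := by
      rw [← LinearMap.baseChange_comp, ← LinearMap.baseChange_zero]; rfl
    have h2 : p2 ∘ₗ i2 = LinearMap.id := by
      rw [← LinearMap.baseChange_comp, ← LinearMap.baseChange_id]; rfl
    rw [map_add, ← LinearMap.comp_apply, h1, ← LinearMap.comp_apply, h2]
    simp
  have key : ∀ (y : S K V ⊗[K] G'.carrier) (x : S K V ⊗[K] G.carrier),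
      Ld e G' y + f' x = 0 → Ld e G x = 0 →
      ∃ y' x', Ld e G' y' + f' x' = y ∧ -Ld e G x' = x := by
    intro y x h1 h2
    obtain ⟨z, hz⟩ : ∃ z, Ld e (GrComplex.cone f) z = i1 y + i2 x := by
      refine hc (i1 y + i2 x) (hext _ ((hp1 _).trans ?_) ((hp2 _).trans ?_))
      · rw [e1, e2, h1]
      · rw [e2, h2, neg_zero]
    exact ⟨p1 z, p2 z, by rw [← hp1, hz, e1], by rw [← hp2, hz, e2]⟩
  rw [GrComplex.Hom.isQuasiIso_iff]
  constructor
  · intro (x : S K V ⊗[K] G.carrier) (hx : Ld e G x = 0) (y : S K V ⊗[K] G'.carrier)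
      (hy : f' x = Ld e G' y)
    obtain ⟨y', x', -, h⟩ := key (-y) x (by
      rw [map_neg, neg_add_eq_zero]; exact hy.symm) hx
    exact ⟨-x', (map_neg (Ld e G) x').trans h⟩
  · intro (y : S K V ⊗[K] G'.carrier) (hy : Ld e G' y = 0)
    obtain ⟨y', x', h1, h2⟩ := key y 0 (by rw [map_zero, add_zero]; exact hy) (map_zero _)
    refine ⟨x', neg_eq_zero.1 h2, (-y' : S K V ⊗[K] G'.carrier), ?_⟩
    change Ld e G' (-y') = f' x' - y
    rw [map_neg, ← h1]
    abel

end Functors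

/-! ### Koszul homotopies -/

section Koszul

variable {𝓡 : Type*} [Ring 𝓡] {ι : Type*} (d h : ι → 𝓡)

/-- The defect of the homotopy `h r` for the differential `d r`. -/
def koszulDefect (r : ι) : 𝓡 := 1 - d r * h r - h r * d r

/-- The product of the defects. -/
def koszulResidue : List ι → 𝓡
  | [] => 1
  | r :: l => koszulDefect d h r * koszulResidue l

/-- The homotopy for the sum of the differentials. -/
def koszulHomotopy : List ι → 𝓡
  | [] => 0
  | r :: l => koszulHomotopy l + h r * koszulResidue d h l

/-- Anticommuting differentials `d r` with homotopies `h r` that anticommute with the differentials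
of different index. -/
structure IsKoszul : Prop where
  anticomm : ∀ q r, d q * d r = -(d r * d q)
  sq : ∀ q, d q * d q = 0
  anticomm_homotopy : ∀ q r, q ≠ r → d q * h r = -(h r * d q)
  d_h_d : ∀ q, d q * h q * d q = d q

variable {d h}

/-- In passing `d r * h r` or `h r * d r`, the factor `d q` changes sign twice. -/
theorem IsKoszul.commute_defect (H : IsKoszul d h) {q r : ι} (hqr : q ≠ r) :
    d q * koszulDefect d h r = koszulDefect d h r * d q := by
  have h1 : d q * (d r * h r) = d r * h r * d q := by
    rw [← mul_assoc, H.anticomm, neg_mul, mul_assoc, H.anticomm_homotopy q r hqr, mul_neg, neg_neg,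
      mul_assoc]
  have h2 : d q * (h r * d r) = h r * d r * d q := by
    rw [← mul_assoc, H.anticomm_homotopy q r hqr, neg_mul, mul_assoc, H.anticomm q r, mul_neg,
      neg_neg, mul_assoc]
  simp only [koszulDefect, mul_sub, sub_mul, mul_one, one_mul, h1, h2]

theorem IsKoszul.d_defect (H : IsKoszul d h) (q : ι) : d q * koszulDefect d h q = 0 := by
  rw [koszulDefect, mul_sub, mul_sub, mul_one, ← mul_assoc, H.sq, zero_mul, ← mul_assoc, H.d_h_d]
  simp

theorem IsKoszul.defect_d (H : IsKoszul d h) (q : ι) : koszulDefect d h q * d q = 0 := by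
  rw [koszulDefect, sub_mul, sub_mul, one_mul, H.d_h_d, mul_assoc, H.sq]
  simp

theorem IsKoszul.commute_residue (H : IsKoszul d h) {q : ι} {l : List ι} (hq : q ∉ l) :
    d q * koszulResidue d h l = koszulResidue d h l * d q := by
  induction l with
  | nil => simp [koszulResidue]
  | cons r l ih =>
    rw [List.mem_cons, not_or] at hq
    rw [koszulResidue, ← mul_assoc, H.commute_defect hq.1, mul_assoc, ih hq.2, mul_assoc]

theorem IsKoszul.d_residue (H : IsKoszul d h) {q : ι} {l : List ι} (hl : l.Nodup) (hq : q ∈ l) :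
    d q * koszulResidue d h l = 0 := by
  induction l with
  | nil => simp at hq
  | cons r l ih =>
    rw [List.nodup_cons] at hl
    rw [koszulResidue, ← mul_assoc]
    by_cases h : q = r
    · subst h
      rw [H.d_defect, zero_mul]
    · rw [H.commute_defect h, mul_assoc, ih hl.2 ((List.mem_cons.1 hq).resolve_left h), mul_zero]

theorem IsKoszul.residue_d (H : IsKoszul d h) {q : ι} {l : List ι} (hl : l.Nodup) (hq : q ∈ l) :
    koszulResidue d h l * d q = 0 := by
  induction l with
  | nil => simp at hq
  | cons r l ih =>
    rw [List.nodup_cons] at hl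
    rw [koszulResidue, mul_assoc]
    rcases List.mem_cons.1 hq with rfl | hq
    · rw [← H.commute_residue hl.1, ← mul_assoc, H.defect_d, zero_mul]
    · rw [ih hl.2 hq, mul_zero]

/-- Induction on the list; the sum of the `d q` always runs over all indices. Adding `r` contributes
the terms with `d q` and `h r` times the residue of `l`. For `q` in `l` they vanish, since `d q`
annihilates the residue from either side. For `q ≠ r` outside `l` they cancel, since `d q` commutes
with the residue and anticommutes with `h r`. What remains is `q = r`, which gives one minus the
defect of `r`. -/
theorem IsKoszul.homotopy [Fintype ι] (H : IsKoszul d h) {l : List ι} (hl : l.Nodup) :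
    (∑ q, d q) * koszulHomotopy d h l + koszulHomotopy d h l * ∑ q, d q =
      1 - koszulResidue d h l := by
  induction l with
  | nil => simp [koszulHomotopy, koszulResidue]
  | cons r l ih =>
    rw [List.nodup_cons] at hl
    have key : (∑ q, d q) * (h r * koszulResidue d h l) + h r * koszulResidue d h l * ∑ q, d q =
        (1 - koszulDefect d h r) * koszulResidue d h l := by
      rw [Finset.sum_mul, Finset.mul_sum, ← Finset.sum_add_distrib, Finset.sum_eq_single r]
      · rw [mul_assoc, ← H.commute_residue hl.1, koszulDefect]
        noncomm_ring
      · intro q _ hqr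
        by_cases hq : q ∈ l
        · rw [mul_assoc, H.residue_d hl.2 hq, ← mul_assoc, H.anticomm_homotopy q r hqr, neg_mul,
            mul_assoc, H.d_residue hl.2 hq]
          simp
        · rw [mul_assoc, ← H.commute_residue hq, ← mul_assoc, ← mul_assoc,
            H.anticomm_homotopy q r hqr, neg_mul, neg_add_cancel]
      · exact fun h => absurd (Finset.mem_univ r) h
    rw [koszulHomotopy, koszulResidue, mul_add, add_mul,
      show ∀ a b c e : 𝓡, a + b + (c + e) = (a + c) + (b + e) by intros; abel, ih hl.2, key]
    noncomm_ring

variable {K : Type*} [Field K] {X : Type*} [AddCommGroup X] [Module K X]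
  {d h : ι → Module.End K X}

/-- Both `d h` and `h d` preserve a positive step of the filtration: one factor raises it and the
other lowers it by one. -/
theorem koszulResidue_mem {Fil : ℕ → Submodule K X} (hh : ∀ r n, ∀ x ∈ Fil (n + 1), h r x ∈ Fil n)
    (hd : ∀ r n, ∀ x ∈ Fil n, d r x ∈ Fil (n + 1)) (l : List ι) (n : ℕ) (x : X)
    (hx : x ∈ Fil (n + 1)) : koszulResidue d h l x ∈ Fil (n + 1) := by
  induction l with
  | nil => exact hx
  | cons r l ih =>
    exact sub_mem (sub_mem ih (hd r _ _ (hh r _ _ ih))) (hh r _ _ (hd r _ _ ih))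

theorem koszulHomotopy_mem {Fil : ℕ → Submodule K X}
    (hh : ∀ r n, ∀ x ∈ Fil (n + 1), h r x ∈ Fil n)
    (hd : ∀ r n, ∀ x ∈ Fil n, d r x ∈ Fil (n + 1)) (l : List ι) (n : ℕ) (x : X)
    (hx : x ∈ Fil (n + 1)) : koszulHomotopy d h l x ∈ Fil n := by
  induction l with
  | nil => exact zero_mem _
  | cons r l ih => exact add_mem ih (hh r _ _ (koszulResidue_mem hh hd l n x hx))

theorem commute_koszulResidue {σ : X →ₗ[K] X} (hd : ∀ r x, σ (d r x) = d r (σ x))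
    (hh : ∀ r x, σ (h r x) = h r (σ x)) (l : List ι) (x : X) :
    σ (koszulResidue d h l x) = koszulResidue d h l (σ x) := by
  induction l with
  | nil => rfl
  | cons r l ih =>
    simp only [koszulResidue, koszulDefect, Module.End.mul_apply, LinearMap.sub_apply,
      Module.End.one_apply, map_sub, hd, hh, ih]

theorem commute_koszulHomotopy {σ : X →ₗ[K] X} (hd : ∀ r x, σ (d r x) = d r (σ x))
    (hh : ∀ r x, σ (h r x) = h r (σ x)) (l : List ι) (x : X) :
    σ (koszulHomotopy d h l x) = koszulHomotopy d h l (σ x) := by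
  induction l with
  | nil => simp [koszulHomotopy]
  | cons r l ih =>
    simp only [koszulHomotopy, Module.End.mul_apply, LinearMap.add_apply, map_add, ih, hh,
      commute_koszulResidue hd hh]

/-- Relative cycles are relative boundaries for a differential that is the sum of a Koszul
differential and a differential that preserves a filtration lowered by the homotopies. -/
theorem IsKoszul.exists_sub_mem [Fintype ι] (H : IsKoszul d h) {l : List ι} (hl : l.Nodup)
    (D d0 σ : X →ₗ[K] X) (hD : ∀ x, D (D x) = 0) (hσ : ∀ x, σ (σ x) = x)
    (hσd : ∀ r x, σ (d r x) = d r (σ x)) (hσh : ∀ r x, σ (h r x) = h r (σ x))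
    (hsum : ∀ x, D x = d0 x + ∑ r, σ (d r x))
    (Fil : ℕ → Submodule K X) (h0 : Fil 0 = ⊥) (hex : ∀ x, ∃ k, x ∈ Fil k)
    (hFh : ∀ r n, ∀ x ∈ Fil (n + 1), h r x ∈ Fil n)
    (hFd : ∀ r n, ∀ x ∈ Fil n, d r x ∈ Fil (n + 1))
    (hF0 : ∀ n, ∀ x ∈ Fil n, d0 x ∈ Fil n) (hFσ : ∀ n, ∀ x ∈ Fil n, σ x ∈ Fil n)
    (Y Z : Submodule K X) (hZ : ∀ z ∈ Z, D z ∈ Z) (hσZ : ∀ z ∈ Z, σ z ∈ Z)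
    (hHZ : ∀ z ∈ Z, koszulHomotopy d h l z = 0)
    (hHY : ∀ x ∈ Y, koszulHomotopy d h l x ∈ Y) (hσY : ∀ x ∈ Y, σ x ∈ Y)
    (hdY : ∀ x ∈ Y, d0 x ∈ Y) (hE : ∀ x ∈ Y, koszulResidue d h l x ∈ Z)
    {x : X} (hx : x ∈ Y) (hDx : D x ∈ Z) : ∃ y ∈ Y, x - D y ∈ Z := by
  -- Precomposition with `σ` absorbs the signs in front of the `d r` in `D`. Since `T` lowers the
  -- filtration by one and `d0` preserves it, `d0 T + T d0` is locally nilpotent.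
  let T := koszulHomotopy d h l ∘ₗ σ
  refine exists_sub_mem_of_homotopy D hD Y Z hZ T (fun x => -(d0 (T x) + T (d0 x)))
    (LocNilpotent.of_filtration Fil h0 hex fun n x hx => ?_) (fun x hx => hHY _ (hσY _ hx))
    (fun x hx => neg_mem (add_mem (hdY _ (hHY _ (hσY _ hx))) (hHY _ (hσY _ (hdY _ hx)))))
    (fun x hx hDx => ?_) hx hDx
  · have hT : ∀ x ∈ Fil (n + 1), T x ∈ Fil n := fun x hx =>
      koszulHomotopy_mem hFh hFd l n _ (hFσ _ _ hx)
    exact neg_mem (add_mem (hF0 _ _ (hT x hx)) (hT _ (hF0 _ _ hx)))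
  -- The homotopy vanishes on `Z`, so for a relative cycle the term `T D` drops out of the homotopy
  -- formula. The remainder is exactly the Koszul residue, which lies in `Z`.
  · have h1 : T (D x) = 0 := hHZ _ (hσZ _ hDx)
    have h2 : D (T x) = d0 (T x) + (∑ q, d q) (koszulHomotopy d h l x) := by
      rw [hsum, LinearMap.sum_apply]
      congr 1
      refine Finset.sum_congr rfl fun r _ => ?_
      change σ (d r (koszulHomotopy d h l (σ x))) = _
      rw [hσd, commute_koszulHomotopy hσd hσh, hσ]
    have h3 : T (D x) = T (d0 x) + koszulHomotopy d h l ((∑ q, d q) x) := by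
      rw [hsum, map_add, LinearMap.sum_apply, map_sum, map_sum]
      congr 1
      refine Finset.sum_congr rfl fun r _ => ?_
      change koszulHomotopy d h l (σ (σ (d r x))) = _
      rw [hσ]
    have h4 := congrArg (fun f : Module.End K X => f x) (H.homotopy hl)
    simp only [LinearMap.add_apply, Module.End.mul_apply, LinearMap.sub_apply,
      Module.End.one_apply] at h4
    have h5 : x - D (T x) - -(d0 (T x) + T (d0 x)) = koszulResidue d h l x := by
      rw [h1] at h3
      rw [h2, eq_neg_of_add_eq_zero_left h3.symm, ← sub_eq_zero]
      rw [← sub_eq_zero] at h4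
      rw [← neg_eq_zero, ← h4]
      abel
    rw [h5]
    exact hE x hx

end Koszul

/-! ### Division and contraction -/

section Division

variable {K : Type u} [Field K] {V : Type u} [AddCommGroup V] [Module K V]
  {v : ℕ} (e : Module.Basis (Fin v) K V)

/-- The symmetric algebra as a polynomial ring. -/
def symEquiv : S K V ≃ₐ[K] MvPolynomial (Fin v) K :=
  SymmetricAlgebra.equivMvPolynomial e.dualBasis

theorem symEquiv_xS (r : Fin v) : symEquiv e (xS e r) = MvPolynomial.X r := by
  have h := SymmetricAlgebra.equivMvPolynomial_ι_apply e.dualBasis r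
  rwa [Module.Basis.coe_dualBasis] at h

/-- Division by `x_r`, with the monomials that are not divisible by `x_r` sent to zero. -/
def divS (r : Fin v) : S K V →ₗ[K] S K V :=
  let f : MvPolynomial (Fin v) K →ₗ[K] MvPolynomial (Fin v) K :=
    { toFun := fun p => p.divMonomial (Finsupp.single r 1)
      map_add' := fun p q => MvPolynomial.add_divMonomial p q _
      map_smul' := fun c p => by
        ext m
        simp [MvPolynomial.coeff_divMonomial] }
  (symEquiv e).symm.toLinearMap ∘ₗ f ∘ₗ (symEquiv e).toLinearMap

theorem coeff_divS (r : Fin v) (s : S K V) (m : Fin v →₀ ℕ) :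
    (symEquiv e (divS e r s)).coeff m = (symEquiv e s).coeff (Finsupp.single r 1 + m) := by
  simp [divS, MvPolynomial.coeff_divMonomial]

theorem divS_ext {s t : S K V}
    (h : ∀ m, (symEquiv e s).coeff m = (symEquiv e t).coeff m) : s = t :=
  (symEquiv e).injective (MvPolynomial.ext _ _ h)

theorem divS_mul_same (r : Fin v) (s : S K V) : divS e r (xS e r * s) = s := by
  refine divS_ext e fun m => ?_
  rw [coeff_divS, map_mul, symEquiv_xS, MvPolynomial.coeff_X_mul]

theorem divS_mul_ne {q r : Fin v} (h : q ≠ r) (s : S K V) :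
    divS e r (xS e q * s) = xS e q * divS e r s := by
  refine divS_ext e fun m => ?_
  rw [coeff_divS, map_mul, map_mul, symEquiv_xS, MvPolynomial.coeff_X_mul',
    MvPolynomial.coeff_X_mul', coeff_divS]
  have h1 : q ∈ (Finsupp.single r 1 + m).support ↔ q ∈ m.support := by
    simp [h.symm]
  by_cases hq : q ∈ m.support
  · rw [if_pos hq, if_pos (h1.2 hq)]
    congr 1
    ext i
    simp only [Finsupp.coe_tsub, Finsupp.coe_add, Pi.sub_apply, Pi.add_apply, Finsupp.single_apply]
    have : m q ≠ 0 := by simpa using hq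
    split_ifs <;> subst_vars <;> omega
  · rw [if_neg hq, if_neg (fun h' => hq (h1.1 h'))]

theorem divS_one (r : Fin v) : divS e r 1 = 0 := by
  refine divS_ext e fun m => ?_
  rw [coeff_divS, map_one, map_zero, MvPolynomial.coeff_zero, MvPolynomial.coeff_one, if_neg]
  intro h
  have := congrArg (fun f : Fin v →₀ ℕ => f r) h
  simp only [Finsupp.coe_zero, Pi.zero_apply, Finsupp.coe_add, Pi.add_apply,
    Finsupp.single_eq_same] at this
  omega

/-- The polynomials of degree less than `n`. -/
def SFil (n : ℕ) : Submodule K (S K V) where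
  carrier := {s | ∀ m : Fin v →₀ ℕ, n ≤ m.degree → (symEquiv e s).coeff m = 0}
  zero_mem' := fun m _ => by simp
  add_mem' := fun hs ht m hm => by rw [map_add, MvPolynomial.coeff_add, hs m hm, ht m hm, add_zero]
  smul_mem' := fun c s hs m hm => by rw [map_smul, MvPolynomial.coeff_smul, hs m hm, smul_zero]

theorem SFil_zero : SFil e 0 = (⊥ : Submodule K (S K V)) := by
  rw [eq_bot_iff]
  intro s hs
  exact divS_ext e fun m => by rw [hs m (Nat.zero_le _), map_zero, MvPolynomial.coeff_zero]

theorem exists_mem_SFil (s : S K V) : ∃ n, s ∈ SFil e n := by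
  refine ⟨(symEquiv e s).totalDegree + 1, fun m hm => ?_⟩
  exact MvPolynomial.coeff_eq_zero_of_totalDegree_lt (by
    have : m.degree = ∑ i ∈ m.support, m i := rfl
    omega)

theorem SFil_mono {m n : ℕ} (h : m ≤ n) : SFil e m ≤ SFil e n :=
  fun _ hs k hk => hs k (h.trans hk)

theorem divS_mem_SFil (r : Fin v) {n : ℕ} {s : S K V} (hs : s ∈ SFil e (n + 1)) :
    divS e r s ∈ SFil e n := fun m hm => by
  rw [coeff_divS]
  refine hs _ ?_
  rw [map_add, Finsupp.degree_single]
  omega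

theorem xS_mul_mem_SFil (r : Fin v) {n : ℕ} {s : S K V} (hs : s ∈ SFil e n) :
    xS e r * s ∈ SFil e (n + 1) := fun m hm => by
  rw [map_mul, symEquiv_xS, MvPolynomial.coeff_X_mul']
  split_ifs with h
  · refine hs _ ?_
    have h1 : Finsupp.single r 1 + (m - Finsupp.single r 1) = m := by
      refine add_tsub_cancel_of_le ?_
      rw [Finsupp.single_le_iff]
      have : m r ≠ 0 := by simpa using h
      omega
    have h2 := congrArg Finsupp.degree h1
    rw [map_add, Finsupp.degree_single] at h2
    omega
  · rfl

/-- The augmentation of the symmetric algebra. -/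
def augS : S K V →ₐ[K] K := SymmetricAlgebra.algebraMapInv

include e in
theorem S_induction {p : S K V → Prop} (one : ∀ c : K, p (algebraMap K _ c))
    (mul : ∀ r s, p (xS e r * s)) (add : ∀ s t, p s → p t → p (s + t)) (s : S K V) : p s := by
  obtain ⟨f, rfl⟩ := (symEquiv e).symm.surjective s
  induction f using MvPolynomial.induction_on with
  | C c =>
    have := one c
    rwa [← (symEquiv e).symm.commutes] at this
  | add f g hf hg => rw [map_add]; exact add _ _ hf hg
  | mul_X f r _ =>
    rw [map_mul, mul_comm, ← symEquiv_xS e r, AlgEquiv.symm_apply_apply]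
    exact mul _ _

theorem augS_xS_mul (r : Fin v) (s : S K V) : augS (xS e r * s) = 0 := by
  rw [map_mul, augS, xS, SymmetricAlgebra.algebraMapInv_ι, zero_mul]

theorem augS_of_mem {s : ℤ} (hs : s ≠ 0) {a : S K V}
    (ha : a ∈ symGrading K (Module.Dual K V) s) : augS a = 0 := by
  have : symGrading K (Module.Dual K V) s ≤ LinearMap.ker (augS (K := K) (V := V)).toLinearMap := by
    refine iSup₂_le fun k hk => ?_
    obtain ⟨k, rfl⟩ : ∃ l, k = l + 1 := ⟨k - 1, by omega⟩
    rw [pow_succ', Submodule.mul_le]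
    rintro _ ⟨w, rfl⟩ b -
    change augS (_ * b) = 0
    rw [map_mul, augS, SymmetricAlgebra.algebraMapInv_ι, zero_mul]
  exact this ha

/-- Contraction of the exterior algebra with an element of the dual basis. -/
def conE (r : Fin v) : E K V →ₗ[K] E K V :=
  CliffordAlgebra.contractLeft (Q := (0 : QuadraticForm K V)) (e.coord r)

theorem conE_mul_same (r : Fin v) (a : E K V) : conE e r (eE e r * a) = a - eE e r * conE e r a := by
  rw [conE, eE, CliffordAlgebra.contractLeft_ι_mul]
  simp

theorem conE_mul_ne {q r : Fin v} (h : q ≠ r) (a : E K V) :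
    conE e r (eE e q * a) = -(eE e q * conE e r a) := by
  rw [conE, eE, CliffordAlgebra.contractLeft_ι_mul]
  simp [h]

theorem conE_one (r : Fin v) : conE e r 1 = 0 :=
  CliffordAlgebra.contractLeft_one (Q := (0 : QuadraticForm K V)) (e.coord r)

theorem conE_mem (r : Fin v) {s : ℤ} {a : E K V} (ha : a ∈ extGrading K V s) :
    conE e r a ∈ extGrading K V (s + 1) := by
  have key : ∀ k : ℕ, ⋀[K]^k V ≤ (extGrading K V (-(k : ℤ) + 1)).comap (conE e r) := by
    intro k
    induction k with
    | zero =>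
      intro a ha
      rw [ExteriorAlgebra.exteriorPower, pow_zero, Submodule.mem_one] at ha
      obtain ⟨c, rfl⟩ := ha
      rw [Submodule.mem_comap, conE]
      erw [CliffordAlgebra.contractLeft_algebraMap]
      exact zero_mem _
    | succ k ih =>
      rw [ExteriorAlgebra.exteriorPower, pow_succ', Submodule.mul_le]
      rintro _ ⟨x, rfl⟩ b hb
      rw [Submodule.mem_comap, conE]
      erw [CliffordAlgebra.contractLeft_ι_mul]
      have hb' : b ∈ extGrading K V (-(k : ℤ)) := by rwa [extGrading_neg_natCast]
      refine sub_mem (Submodule.smul_mem _ _ ?_) ?_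
      · convert hb' using 2
        push_cast
        ring
      · have := mul_mem_extGrading K V (ι_mem_extGrading K V x) (ih hb)
        rw [show -1 + (-(k : ℤ) + 1) = -((k + 1 : ℕ) : ℤ) + 1 by push_cast; ring] at this
        exact this
  have : extGrading K V s ≤ (extGrading K V (s + 1)).comap (conE e r) :=
    iSup₂_le fun k hk => hk ▸ key k
  exact this ha

/-- The augmentation of the exterior algebra. -/
def augE : E K V →ₐ[K] K := ExteriorAlgebra.algebraMapInv

theorem augE_eE_mul (r : Fin v) (a : E K V) : augE (eE e r * a) = 0 := by
  rw [map_mul, augE, eE]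
  simp [ExteriorAlgebra.algebraMapInv]

theorem augE_mul_eE (r : Fin v) (a : E K V) : augE (a * eE e r) = 0 := by
  rw [map_mul, augE, eE]
  simp [ExteriorAlgebra.algebraMapInv]

include e in
theorem E_induction {p : E K V → Prop} (one : ∀ c : K, p (algebraMap K _ c))
    (mul : ∀ r a, p (eE e r * a)) (add : ∀ a b, p a → p b → p (a + b)) (a : E K V) : p a := by
  have zero : p 0 := by simpa using one 0
  induction a using CliffordAlgebra.left_induction with
  | algebraMap c => exact one c
  | add x y hx hy => exact add x y hx hy
  | ι_mul a x _ =>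
    rw [← e.sum_repr x, map_sum, Finset.sum_mul]
    refine Finset.sum_induction _ p add zero fun r _ => ?_
    rw [map_smul, smul_mul_assoc, ← mul_smul_comm]
    exact mul r _

theorem augE_of_mem {s : ℤ} (hs : s ≠ 0) {a : E K V} (ha : a ∈ extGrading K V s) :
    augE a = 0 := by
  have : extGrading K V s ≤ LinearMap.ker (augE (K := K) (V := V)).toLinearMap := by
    refine iSup₂_le fun k hk => ?_
    obtain ⟨k, rfl⟩ : ∃ l, k = l + 1 := ⟨k - 1, by omega⟩
    rw [ExteriorAlgebra.exteriorPower, pow_succ', Submodule.mul_le]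
    rintro _ ⟨w, rfl⟩ b -
    change augE (_ * b) = 0
    rw [map_mul, augE]
    simp [ExteriorAlgebra.algebraMapInv]
  exact this ha

end Division

/-! ### Homogeneous bases -/

namespace GrComplex

variable {K : Type u} [Field K] {A : Type u} [Ring A] [Algebra K A] {𝒜 : ℤ → Submodule K A}

theorem sign_smul_of_isInternal (h𝒜 : DirectSum.IsInternal 𝒜) (C : GrComplex K 𝒜) (a : A)
    (m : C.carrier) : C.sign (a • m) = a • C.sign m := by
  induction a using internal_induction h𝒜 with
  | mem i a ha => exact C.sign_smul ha m
  | zero => simp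
  | add x y hx hy => simp only [add_smul, map_add, hx, hy]

namespace HomogeneousBasis

variable {C : GrComplex K 𝒜} (b : C.HomogeneousBasis)

theorem induction {p : C.carrier → Prop} (smul : ∀ (a : A) i, p (a • b.basis i)) (zero : p 0)
    (add : ∀ x y, p x → p y → p (x + y)) (m : C.carrier) : p m := by
  rw [← b.basis.repr.symm_apply_apply m]
  induction b.basis.repr m using Finsupp.induction_linear with
  | zero => rwa [map_zero]
  | add f g hf hg => rw [map_add]; exact add _ _ hf hg
  | single i a => rw [Module.Basis.repr_symm_single]; exact smul a i

/-- The linear map that applies `φ` to the coefficients. -/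
def coefMap (φ : A →ₗ[K] A) : C.carrier →ₗ[K] C.carrier :=
  (b.basis.repr.symm.restrictScalars K).toLinearMap ∘ₗ Finsupp.mapRange.linearMap φ ∘ₗ
    (b.basis.repr.restrictScalars K).toLinearMap

@[simp] theorem coefMap_smul (φ : A →ₗ[K] A) (a : A) (i : b.index) :
    b.coefMap φ (a • b.basis i) = φ a • b.basis i := by
  simp [coefMap]

@[simp] theorem repr_coefMap (φ : A →ₗ[K] A) (m : C.carrier) (i : b.index) :
    b.basis.repr (b.coefMap φ m) i = φ (b.basis.repr m i) := by
  simp [coefMap]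

theorem sign_coefMap (h𝒜 : DirectSum.IsInternal 𝒜) (φ : A →ₗ[K] A) (m : C.carrier) :
    C.sign (b.coefMap φ m) = b.coefMap φ (C.sign m) := by
  induction m using b.induction with
  | smul a i =>
    rw [coefMap_smul, C.sign_smul_of_isInternal h𝒜, C.sign_smul_of_isInternal h𝒜,
      C.sign_apply (b.mem i), smul_comm (φ a), smul_comm a, map_zsmul, coefMap_smul]
  | zero => simp
  | add x y hx hy => simp only [map_add, hx, hy]

end HomogeneousBasis

end GrComplex

/-! ### Residues of division operators -/

section Residues

variable {𝓡 : Type*} [Ring 𝓡] {ι : Type*} (X Q : ι → 𝓡)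

/-- The product of the projections `1 - X r * Q r`. -/
def divResidue : List ι → 𝓡
  | [] => 1
  | r :: l => (1 - X r * Q r) * divResidue l

variable {X Q}

theorem divResidue_mul_of_notMem (hX : ∀ q r, X q * X r = X r * X q)
    (h2 : ∀ q r, q ≠ r → Q r * X q = X q * Q r) {q : ι} {l : List ι} (hq : q ∉ l) :
    divResidue X Q l * X q = X q * divResidue X Q l := by
  induction l with
  | nil => simp [divResidue]
  | cons r l ih =>
    rw [List.mem_cons, not_or] at hq
    rw [divResidue, mul_assoc, ih hq.2, ← mul_assoc, ← mul_assoc, sub_mul, mul_assoc (X r),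
      h2 q r hq.1, ← mul_assoc (X r), hX r q]
    noncomm_ring

/-- The factor at `q` kills multiples of `X q` because `Q q * X q = 1`, and the factors to its right
let `X q` pass. With division operators for `Q`, the full product annihilates all multiples of the
maximal ideal. -/
theorem divResidue_mul (hX : ∀ q r, X q * X r = X r * X q) (h1 : ∀ r, Q r * X r = 1)
    (h2 : ∀ q r, q ≠ r → Q r * X q = X q * Q r) {q : ι} {l : List ι} (hq : q ∈ l) :
    divResidue X Q l * X q = 0 := by
  induction l with
  | nil => simp at hq
  | cons r l ih =>
    rw [divResidue, mul_assoc]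
    by_cases hl : q ∈ l
    · rw [ih hl, mul_zero]
    · obtain rfl := (List.mem_cons.1 hq).resolve_right hl
      rw [divResidue_mul_of_notMem hX h2 hl, ← mul_assoc, sub_mul, mul_assoc (X q), h1]
      simp

end Residues

section Acyclicity

variable {K : Type u} [Field K] {V : Type u} [AddCommGroup V] [Module K V]
  {v : ℕ} (e : Module.Basis (Fin v) K V)

/-! ### The homology of `R` of a free complex -/

/-- The product of the maximal ideal of `S` with a complex. -/
def mS (F : SComplex K V) : Submodule K F.carrier :=
  ⨆ r, LinearMap.range (Algebra.lsmul K K F.carrier (xS e r))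

theorem smul_mem_mS (F : SComplex K V) (r : Fin v) (z : F.carrier) : xS e r • z ∈ mS e F :=
  Submodule.mem_iSup_of_mem r ⟨z, rfl⟩

theorem mS_le {F : SComplex K V} {N : Submodule K F.carrier} (h : ∀ r z, xS e r • z ∈ N) :
    mS e F ≤ N := by
  refine iSup_le fun r => ?_
  rintro _ ⟨z, rfl⟩
  exact h r z

/-- Composition on both sides with linear maps. -/
def HomE.sandwich {F F' : Type u} [AddCommGroup F] [Module K F] [AddCommGroup F'] [Module K F']
    (f : F →ₗ[K] F') (g : E K V →ₗ[K] E K V) : HomE K V F →ₗ[K] HomE K V F' where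
  toFun α := (f ∘ₗ (α : E K V →ₗ[K] F) ∘ₗ g : E K V →ₗ[K] F')
  map_add' α β := by ext a; exact map_add f _ _
  map_smul' c α := by ext a; exact map_smul f _ _

@[simp] theorem HomE.sandwich_apply {F F' : Type u} [AddCommGroup F] [Module K F]
    [AddCommGroup F'] [Module K F'] (f : F →ₗ[K] F') (g : E K V →ₗ[K] E K V) (α : HomE K V F)
    (a : E K V) : HomE.sandwich f g α a = f (α (g a)) := rfl

variable {F : SComplex K V} (b : F.HomogeneousBasis)

/-- The division operators on a free complex. -/
def divF (r : Fin v) : F.carrier →ₗ[K] F.carrier := b.coefMap (divS e r)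

theorem divF_smul_same (r : Fin v) (z : F.carrier) : divF e b r (xS e r • z) = z := by
  induction z using b.induction with
  | smul a i => rw [smul_smul, divF, b.coefMap_smul, divS_mul_same]
  | zero => simp
  | add x y hx hy => simp only [smul_add, map_add, hx, hy]

theorem divF_smul_ne {q r : Fin v} (h : q ≠ r) (z : F.carrier) :
    divF e b r (xS e q • z) = xS e q • divF e b r z := by
  induction z using b.induction with
  | smul a i => rw [smul_smul, divF, b.coefMap_smul, b.coefMap_smul, divS_mul_ne e h, smul_smul]
  | zero => simp
  | add x y hx hy => simp only [smul_add, map_add, hx, hy]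

/-- All signs come from the exterior side: on `F`, multiplication and division by variables of
different index commute, while `e_q` anticommutes with `e_r` and with the contraction of another
index. The relation `d h d = d` combines exact division of a multiple of `x_q` with `e_q * e_q = 0`.
-/
theorem isKoszul_R : IsKoszul (𝓡 := Module.End K (HomE K V F.carrier))
    (fun r => HomE.sandwich (Algebra.lsmul K K F.carrier (xS e r)) (LinearMap.mulLeft K (eE e r)))
    (fun r => HomE.sandwich (divF e b r) (conE e r)) where
  anticomm q r := LinearMap.ext fun α => HomE.ext fun a => by
    simp only [Module.End.mul_apply, LinearMap.neg_apply, HomE.sandwich_apply, HomE.neg_apply,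
      LinearMap.mulLeft_apply, Algebra.lsmul_coe, smul_smul, ← mul_assoc]
    rw [eE_swap, neg_mul, map_neg, smul_neg, mul_comm (xS e q)]
  sq q := LinearMap.ext fun α => HomE.ext fun a => by
    simp only [Module.End.mul_apply, HomE.sandwich_apply, LinearMap.mulLeft_apply, ← mul_assoc]
    rw [eE, ExteriorAlgebra.ι_sq_zero]
    simp
  anticomm_homotopy q r h := LinearMap.ext fun α => HomE.ext fun a => by
    simp only [Module.End.mul_apply, LinearMap.neg_apply, HomE.sandwich_apply, HomE.neg_apply,
      LinearMap.mulLeft_apply, Algebra.lsmul_coe]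
    rw [conE_mul_ne e h, map_neg, map_neg, divF_smul_ne e b h, smul_neg]
  d_h_d q := LinearMap.ext fun α => HomE.ext fun a => by
    simp only [Module.End.mul_apply, HomE.sandwich_apply, LinearMap.mulLeft_apply,
      Algebra.lsmul_coe]
    rw [divF_smul_same, conE_mul_same, mul_sub, ← mul_assoc, eE, ExteriorAlgebra.ι_sq_zero]
    simp

-- The Koszul homotopy is applied with `Z = 0` and with `Y` the maps whose value at `1` lies in
-- `mS`; the residue of such a map vanishes. The bound on `β 1` later allows a map to be corrected
-- to a cycle without changing its value at `1` modulo the maximal ideal.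
include b in
theorem exists_R_boundary (α : HomE K V F.carrier) (hα : Rd e F α = 0) (h1 : α 1 ∈ mS e F) :
    ∃ β : HomE K V F.carrier, β 1 ∈ mS e F ∧ Rd e F β = α := by
  obtain ⟨p, hp⟩ := exists_extGrading_eq_bot e
  -- The maps that vanish in degrees above `n - p`; as `E` is zero in degrees at most `-p`, the
  -- shift makes `Fil 0` zero. Contraction raises the degree of the argument by one, so the
  -- homotopies lower this filtration.
  let Fil : ℕ → Submodule K (HomE K V F.carrier) := fun n =>
    { carrier := {α | ∀ s : ℤ, (n : ℤ) - p < s → ∀ a ∈ extGrading K V s, α a = 0}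
      zero_mem' := fun _ _ _ _ => rfl
      add_mem' := fun hα hβ s hs a ha => by
        rw [HomE.add_apply, hα s hs a ha, hβ s hs a ha, add_zero]
      smul_mem' := fun c α hα s hs a ha => by rw [HomE.smulK_apply, hα s hs a ha, smul_zero] }
  let Y : Submodule K (HomE K V F.carrier) :=
    { carrier := {α | α 1 ∈ mS e F}
      zero_mem' := (mS e F).zero_mem
      add_mem' := fun {α β} hα hβ => (mS e F).add_mem (x := α 1) (y := β 1) hα hβ
      smul_mem' := fun c α hα => Submodule.smul_mem (mS e F) c (x := α 1) hα }
  have hsgn : ∀ r z, F.sign (xS e r • z) = xS e r • F.sign z := fun r => F.sign_smul (xS_mem e r)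
  set l := List.finRange v with hl
  have hl1 : ∀ q, q ∈ l := List.mem_finRange
  have hl2 : l.Nodup := List.nodup_finRange v
  have H := isKoszul_R e b
  obtain ⟨β, hβ, hβ'⟩ := H.exists_sub_mem hl2 ((Rd e F).restrictScalars K)
    ((HomE.post F.dK).restrictScalars K) ((HomE.post F.sign).restrictScalars K) (R e F).d_d
    (fun α => HomE.ext fun a => F.sign_sign _)
    (fun r α => HomE.ext fun a => hsgn r _)
    (fun r α => HomE.ext fun a =>
      b.sign_coefMap (symGrading_isInternal K (Module.Dual K V)) (divS e r) _)
    (fun α => HomE.ext fun a => by simp)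
    Fil (by
      rw [eq_bot_iff]
      intro α hα
      refine HomE.ext_of_mem fun s a ha => ?_
      by_cases hs : s ≤ -(p : ℤ)
      · rw [hp s hs, Submodule.mem_bot] at ha
        rw [ha, map_zero, map_zero]
      · exact hα s (by push_cast; omega) a ha)
    (fun α => ⟨p, fun s hs a ha => by
      rw [extGrading_pos (by omega), Submodule.mem_bot] at ha
      rw [ha, map_zero]⟩)
    (fun r n α hα s hs a ha => by
      rw [HomE.sandwich_apply, hα (s + 1) (by push_cast; omega) _ (conE_mem e r ha), map_zero])
    (fun r n α hα s hs a ha => by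
      rw [HomE.sandwich_apply, LinearMap.mulLeft_apply, hα (-1 + s) (by push_cast at hs; omega) _
        (mul_mem_extGrading K V (eE_mem e r) ha), map_zero])
    (fun n α hα s hs a ha => by
      rw [LinearMap.coe_restrictScalars, HomE.post_apply, hα s hs a ha, map_zero])
    (fun n α hα s hs a ha => by
      rw [LinearMap.coe_restrictScalars, HomE.post_apply, hα s hs a ha, map_zero])
    Y ⊥ (by simp) (by simp) (by simp)
    -- Contraction kills `1`, so the homotopy only produces maps that vanish at `1`, and these
    -- belong to `Y`.
    (fun α _ => by
      have : ∀ l : List (Fin v), (koszulHomotopy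
          (fun r => HomE.sandwich (Algebra.lsmul K K F.carrier (xS e r))
            (LinearMap.mulLeft K (eE e r)))
          (fun r => HomE.sandwich (divF e b r) (conE e r)) l : Module.End K (HomE K V F.carrier))
            α 1 = 0 := by
        intro l
        induction l with
        | nil => rfl
        | cons r l ih =>
          rw [koszulHomotopy, LinearMap.add_apply, HomE.add_apply, ih, Module.End.mul_apply,
            HomE.sandwich_apply, conE_one, map_zero, map_zero, add_zero]
      change _ ∈ mS e F
      rw [this]
      exact zero_mem _)
    (fun α hα => mS_le e (N := (mS e F).comap F.sign)
      (fun r z => by rw [Submodule.mem_comap, hsgn]; exact smul_mem_mS e F r _) hα)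
    (fun α hα => mS_le e (N := (mS e F).comap F.dK)
      (fun r z => by
        rw [Submodule.mem_comap, F.dK_apply, map_smul]; exact smul_mem_mS e F r _) hα)
    (fun α hα => by
      rw [Submodule.mem_bot]
      refine HomE.ext fun a => ?_
      -- At scalars the residue is computed by the division residue of `α 1`, which is zero since `α
      -- 1` lies in `mS`. At `e_q a`, the relation `d q * residue = 0` says that `x_q` times the
      -- value vanishes, and division by `x_q` cancels the factor.
      induction a using E_induction e with
      | one c =>
        have h2 : ∀ l : List (Fin v), (koszulResidue
          (fun r => HomE.sandwich (Algebra.lsmul K K F.carrier (xS e r))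
            (LinearMap.mulLeft K (eE e r)))
          (fun r => HomE.sandwich (divF e b r) (conE e r)) l : Module.End K (HomE K V F.carrier))
            α 1 = (divResidue (fun r => (Algebra.lsmul K K F.carrier (xS e r) :
              Module.End K F.carrier)) (divF e b) l : Module.End K F.carrier) (α 1) := by
          intro l
          induction l with
          | nil => rfl
          | cons r l ih =>
            simp only [koszulResidue, koszulDefect, divResidue, Module.End.mul_apply,
              LinearMap.sub_apply, Module.End.one_apply, HomE.sub_apply, HomE.sandwich_apply,
              LinearMap.mulLeft_apply, Algebra.lsmul_coe, conE_one, mul_zero, map_zero,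
              sub_zero, conE_mul_same]
            rw [ih]
        have h3 : mS e F ≤ LinearMap.ker (divResidue (fun r =>
            (Algebra.lsmul K K F.carrier (xS e r) : Module.End K F.carrier)) (divF e b) l :
              Module.End K F.carrier) := by
          refine mS_le e fun q z => ?_
          exact LinearMap.congr_fun (divResidue_mul (𝓡 := Module.End K F.carrier)
            (X := fun r => Algebra.lsmul K K F.carrier (xS e r)) (Q := divF e b)
            (fun q r => by rw [← map_mul, ← map_mul, mul_comm])
            (fun r => LinearMap.ext fun z => divF_smul_same e b r z)
            (fun q r h => LinearMap.ext fun z => divF_smul_ne e b h z) (hl1 q)) z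
        rw [Algebra.algebraMap_eq_smul_one, map_smul, h2, h3 hα, smul_zero]
        rfl
      | mul q a =>
        have h2 := congrArg (fun f : Module.End K (HomE K V F.carrier) => f α a)
          (H.d_residue hl2 (hl1 q))
        have h3 := congrArg (divF e b q) h2
        simp only [Module.End.mul_apply, HomE.sandwich_apply, LinearMap.mulLeft_apply,
          Algebra.lsmul_coe, divF_smul_same] at h3
        rw [h3]
        exact map_zero _
      | add a c ha hc => rw [map_add, map_add, ha, hc])
    (x := α) h1 (by rw [Submodule.mem_bot]; exact hα)
  rw [Submodule.mem_bot, sub_eq_zero] at hβ'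
  exact ⟨β, hβ, hβ'.symm⟩

/-! ### The homology of `L` of a cofree complex -/

/-- The socle of a complex of modules over the exterior algebra. -/
def soc (I : EComplex K V) : Submodule K I.carrier :=
  ⨅ r, LinearMap.ker (Algebra.lsmul K K I.carrier (eE e r))

theorem mem_soc {I : EComplex K V} {g : I.carrier} : g ∈ soc e I ↔ ∀ r, eE e r • g = 0 := by
  simp [soc]

/-- The elements `1 ⊗ g` with `g` in the socle. -/
def socL (I : EComplex K V) : Submodule K (S K V ⊗[K] I.carrier) :=
  (soc e I).map (TensorProduct.mk K (S K V) I.carrier 1)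

theorem Ld_one_tmul {I : EComplex K V} {g : I.carrier} (hg : g ∈ soc e I) :
    Ld e I (1 ⊗ₜ g) = 1 ⊗ₜ I.d g := by
  rw [Ld_tmul, Finset.sum_eq_zero, add_zero]
  intro r _
  rw [(mem_soc e).1 hg r, map_zero, TensorProduct.tmul_zero]

/-- Operators on a complex of `E`-modules that satisfy the Clifford relations with the `e_r`. -/
structure IsClifford (I : EComplex K V) (c : Fin v → I.carrier →ₗ[K] I.carrier) : Prop where
  same : ∀ r m, c r (eE e r • m) = m - eE e r • c r m
  ne : ∀ q r, q ≠ r → ∀ m, c r (eE e q • m) = -(eE e q • c r m)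
  sign : ∀ r m, I.sign (c r m) = c r (I.sign m)

theorem eE_mul_self (r : Fin v) : eE e r * eE e r = 0 := ExteriorAlgebra.ι_sq_zero _

theorem eE_smul_smul_self {N : Type*} [AddCommGroup N] [Module (E K V) N] (r : Fin v) (m : N) :
    eE e r • eE e r • m = 0 := by
  rw [smul_smul, eE_mul_self, zero_smul]

theorem eE_smul_smul_swap {N : Type*} [AddCommGroup N] [Module (E K V) N] (q r : Fin v) (m : N) :
    eE e q • eE e r • m = -(eE e r • eE e q • m) := by
  rw [smul_smul, smul_smul, eE_swap, neg_smul]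

variable {I : EComplex K V} {c : Fin v → I.carrier →ₗ[K] I.carrier}

/-- As for `R`: the signs come from the Clifford relations, while multiplication and division of
polynomials by different variables commute. -/
theorem isKoszul_L (hc : IsClifford e I c) :
    IsKoszul (𝓡 := Module.End K (S K V ⊗[K] I.carrier))
      (fun r => TensorProduct.map (LinearMap.mulLeft K (xS e r))
        (Algebra.lsmul K K I.carrier (eE e r)))
      (fun r => TensorProduct.map (divS e r) (c r)) where
  anticomm q r := TensorProduct.ext' fun s g => by
    simp only [Module.End.mul_apply, LinearMap.neg_apply, TensorProduct.map_tmul,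
      LinearMap.mulLeft_apply, Algebra.lsmul_coe]
    rw [eE_smul_smul_swap, TensorProduct.tmul_neg, mul_left_comm]
  sq q := TensorProduct.ext' fun s g => by
    simp only [Module.End.mul_apply, TensorProduct.map_tmul, Algebra.lsmul_coe]
    rw [eE_smul_smul_self, TensorProduct.tmul_zero, LinearMap.zero_apply]
  anticomm_homotopy q r h := TensorProduct.ext' fun s g => by
    simp only [Module.End.mul_apply, LinearMap.neg_apply, TensorProduct.map_tmul,
      LinearMap.mulLeft_apply, Algebra.lsmul_coe]
    rw [hc.ne q r h, divS_mul_ne e h, TensorProduct.tmul_neg, neg_neg]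
  d_h_d q := TensorProduct.ext' fun s g => by
    simp only [Module.End.mul_apply, TensorProduct.map_tmul,
      LinearMap.mulLeft_apply, Algebra.lsmul_coe]
    rw [hc.same, divS_mul_same, smul_sub, eE_smul_smul_self, sub_zero]

/-- The projection of a complex with Clifford operators onto its socle. -/
def cliffordResidue (c : Fin v → I.carrier →ₗ[K] I.carrier) :
    List (Fin v) → I.carrier →ₗ[K] I.carrier
  | [] => LinearMap.id
  | r :: l => Algebra.lsmul K K I.carrier (eE e r) ∘ₗ c r ∘ₗ cliffordResidue c l

/-- Moving `e_q` inwards past `e_r` and `c r` costs two signs, until it meets its own factor and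
squares to zero. -/
theorem smul_cliffordResidue (hc : IsClifford e I c) {q : Fin v} {l : List (Fin v)}
    (hq : q ∈ l) (g : I.carrier) : eE e q • cliffordResidue e c l g = 0 := by
  induction l with
  | nil => simp at hq
  | cons r l ih =>
    simp only [cliffordResidue, LinearMap.comp_apply, Algebra.lsmul_coe]
    by_cases h : q = r
    · subst h
      exact eE_smul_smul_self e q _
    · rw [eE_smul_smul_swap, ← neg_neg (eE e q • _), ← hc.ne q r h,
        ih ((List.mem_cons.1 hq).resolve_left h)]
      simp

theorem divResidue_divS_one (l : List (Fin v)) :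
    (divResidue (fun r => (LinearMap.mulLeft K (xS e r) : Module.End K (S K V))) (divS e) l :
      Module.End K (S K V)) 1 = 1 := by
  induction l with
  | nil => rfl
  | cons r l ih =>
    rw [divResidue, Module.End.mul_apply, ih, LinearMap.sub_apply, Module.End.mul_apply, divS_one,
      map_zero, sub_zero]
    rfl

/-- Each factor `1 - x_r Q_r` fixes constants, and the product annihilates the multiples of every
variable, so only the constant term survives. -/
theorem divResidue_divS (s : S K V) :
    (divResidue (fun r => (LinearMap.mulLeft K (xS e r) : Module.End K (S K V))) (divS e)
      (List.finRange v) : Module.End K (S K V)) s = algebraMap K _ (augS s) := by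
  induction s using S_induction e with
  | one c =>
    rw [Algebra.algebraMap_eq_smul_one, map_smul, divResidue_divS_one, map_smul, map_one,
      Algebra.algebraMap_eq_smul_one, smul_eq_mul, mul_one]
  | mul r s =>
    rw [augS_xS_mul, map_zero]
    exact LinearMap.congr_fun (divResidue_mul (𝓡 := Module.End K (S K V))
      (X := fun r => LinearMap.mulLeft K (xS e r)) (Q := divS e)
      (fun q r => LinearMap.ext fun z => mul_left_comm (xS e q) (xS e r) z)
      (fun r => LinearMap.ext fun z => divS_mul_same e r z)
      (fun q r h => LinearMap.ext fun z => divS_mul_ne e h z) (List.mem_finRange r)) s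
  | add s t hs ht => simp only [map_add, hs, ht]

/-- On `s ⊗ g` the Clifford relation turns `1 - d h - h d` into `(s - x_r Q_r s) ⊗ e_r c_r g`, so
the residue is a tensor product of two residues. -/
theorem koszulResidue_tmul (hc : IsClifford e I c) (l : List (Fin v)) (s : S K V)
    (g : I.carrier) :
    (koszulResidue
      (fun r => TensorProduct.map (LinearMap.mulLeft K (xS e r))
        (Algebra.lsmul K K I.carrier (eE e r)))
      (fun r => TensorProduct.map (divS e r) (c r)) l : Module.End K (S K V ⊗[K] I.carrier))
      (s ⊗ₜ g) =
    (divResidue (fun r => (LinearMap.mulLeft K (xS e r) : Module.End K (S K V))) (divS e) l :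
      Module.End K (S K V)) s ⊗ₜ cliffordResidue e c l g := by
  induction l with
  | nil => rfl
  | cons r l ih =>
    simp only [koszulResidue, koszulDefect, divResidue, Module.End.mul_apply,
      LinearMap.sub_apply, Module.End.one_apply, ih, TensorProduct.map_tmul,
      LinearMap.mulLeft_apply, Algebra.lsmul_coe, cliffordResidue, LinearMap.comp_apply]
    rw [hc.same, divS_mul_same, TensorProduct.tmul_sub, TensorProduct.sub_tmul]
    abel

/-- The Koszul homotopy is applied relative to `Z = 1 ⊗ soc`. It vanishes there because division
kills `1`, and the residue lands there: it leaves a constant on the left and an element of the socle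
on the right. The filtration is by polynomial degree, which division lowers. -/
theorem exists_L_boundary (hc : IsClifford e I c) (x : S K V ⊗[K] I.carrier)
    (hx : Ld e I x ∈ socL e I) : ∃ y, x - Ld e I y ∈ socL e I := by
  let Fil : ℕ → Submodule K (S K V ⊗[K] I.carrier) := fun n =>
    Submodule.map₂ (TensorProduct.mk K (S K V) I.carrier) (SFil e n) ⊤
  have hFil : ∀ m n (f : S K V →ₗ[K] S K V) (g : I.carrier →ₗ[K] I.carrier),
      (∀ s ∈ SFil e m, f s ∈ SFil e n) → ∀ x ∈ Fil m, TensorProduct.map f g x ∈ Fil n := by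
    intro m n f g hf x hx
    have : Fil m ≤ (Fil n).comap (TensorProduct.map f g) :=
      Submodule.map₂_le.2 fun s hs g _ => Submodule.apply_mem_map₂ _ (hf s hs) trivial
    exact this hx
  have hsgn : ∀ r z, I.sign (eE e r • z) = eE e r • I.sign z := fun r => I.sign_smul (eE_mem e r)
  set l := List.finRange v with hl
  have hl1 : ∀ q, q ∈ l := List.mem_finRange
  have hl2 : l.Nodup := List.nodup_finRange v
  have H := isKoszul_L e hc
  obtain ⟨y, -, hy⟩ := H.exists_sub_mem hl2 ((Ld e I).restrictScalars K)
    (TensorProduct.map LinearMap.id I.dK) (TensorProduct.map LinearMap.id I.sign) (L e I).d_d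
    (fun x => by
      rw [← LinearMap.comp_apply, ← TensorProduct.map_comp,
        show I.sign ∘ₗ I.sign = LinearMap.id from LinearMap.ext I.sign_sign, LinearMap.id_comp,
        TensorProduct.map_id, LinearMap.id_apply])
    (fun r x => by
      rw [← LinearMap.comp_apply, ← LinearMap.comp_apply, ← TensorProduct.map_comp,
        ← TensorProduct.map_comp, LinearMap.id_comp, LinearMap.comp_id]
      congr 2
      exact LinearMap.ext (hsgn r))
    (fun r x => by
      rw [← LinearMap.comp_apply, ← LinearMap.comp_apply, ← TensorProduct.map_comp,
        ← TensorProduct.map_comp, LinearMap.id_comp, LinearMap.comp_id]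
      congr 2
      exact LinearMap.ext (hc.sign r))
    (fun x => by
      induction x using TensorProduct.induction_on with
      | zero => simp
      | add x y hx hy =>
        simp only [map_add, hx, hy, Finset.sum_add_distrib]
        abel
      | tmul s g => simp [Ld_tmul])
    Fil (by simp only [Fil, SFil_zero, Submodule.map₂_bot_left])
    (fun x => by
      induction x using TensorProduct.induction_on with
      | zero => exact ⟨0, zero_mem _⟩
      | add x y hx hy =>
        obtain ⟨m, hm⟩ := hx
        obtain ⟨n, hn⟩ := hy
        exact ⟨max m n, add_mem
          (Submodule.map₂_le_map₂_left (SFil_mono e (le_max_left m n)) hm)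
          (Submodule.map₂_le_map₂_left (SFil_mono e (le_max_right m n)) hn)⟩
      | tmul s g =>
        obtain ⟨n, hn⟩ := exists_mem_SFil e s
        exact ⟨n, Submodule.apply_mem_map₂ _ hn trivial⟩)
    (fun r n => hFil _ _ _ _ fun s hs => divS_mem_SFil e r hs)
    (fun r n => hFil _ _ _ _ fun s hs => xS_mul_mem_SFil e r hs)
    (fun n => hFil _ _ _ _ fun s hs => hs) (fun n => hFil _ _ _ _ fun s hs => hs)
    ⊤ (socL e I)
    (by
      rintro _ ⟨g, hg, rfl⟩
      refine ⟨I.d g, (mem_soc e).2 fun r => ?_, (Ld_one_tmul e hg).symm⟩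
      rw [← map_smul, (mem_soc e).1 hg r, map_zero])
    (by
      rintro _ ⟨g, hg, rfl⟩
      refine ⟨I.sign g, (mem_soc e).2 fun r => ?_, rfl⟩
      rw [← hsgn, (mem_soc e).1 hg r, map_zero])
    (by
      rintro _ ⟨g, hg, rfl⟩
      have : ∀ l : List (Fin v), (koszulHomotopy
          (fun r => TensorProduct.map (LinearMap.mulLeft K (xS e r))
            (Algebra.lsmul K K I.carrier (eE e r)))
          (fun r => TensorProduct.map (divS e r) (c r)) l : Module.End K (S K V ⊗[K] I.carrier))
            (1 ⊗ₜ g) = 0 := by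
        intro l
        induction l with
        | nil => rfl
        | cons r l ih =>
          rw [koszulHomotopy, LinearMap.add_apply, ih, Module.End.mul_apply,
            koszulResidue_tmul e hc, divResidue_divS_one, TensorProduct.map_tmul, divS_one,
            TensorProduct.zero_tmul, add_zero]
      exact this l)
    (fun _ _ => trivial) (fun _ _ => trivial) (fun _ _ => trivial)
    (fun x _ => by
      induction x using TensorProduct.induction_on with
      | zero => rw [map_zero]; exact zero_mem _
      | add x y hx hy => rw [map_add]; exact add_mem (hx trivial) (hy trivial)
      | tmul s g =>
        rw [koszulResidue_tmul e hc, divResidue_divS]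
        refine ⟨augS s • cliffordResidue e c l g, (mem_soc e).2 fun r => ?_, ?_⟩
        · rw [smul_comm, smul_cliffordResidue e hc (hl1 r), smul_zero]
        · rw [TensorProduct.mk_apply, ← TensorProduct.smul_tmul, Algebra.algebraMap_eq_smul_one])
    (x := x) trivial hx
  exact ⟨y, hy⟩

end Acyclicity

/-! ### The sign twist with respect to the internal degree -/

/-- A sign with `twistSign t = (-1) ^ t * twistSign (t - 1)`. -/
def twistSign (t : ℤ) : ℤˣ := Int.negOnePow (t * (t + 1) / 2)

theorem twistSign_eq (t : ℤ) : twistSign t = Int.negOnePow t * twistSign (t - 1) := by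
  rw [twistSign, twistSign, ← Int.negOnePow_add]
  congr 1
  rw [show t * (t + 1) = (t - 1) * (t - 1 + 1) + 2 * t by ring,
    Int.add_mul_ediv_left _ _ (by norm_num)]
  ring

namespace GrComplex

variable {K : Type u} [Field K] {A : Type u} [Ring A] [Algebra K A] {𝒜 : ℤ → Submodule K A}

/-- The multiplication with `twistSign j` in internal degree `j`. -/
def twist (C : GrComplex K 𝒜) : C.carrier →ₗ[K] C.carrier :=
  glue C.internal fun p => ((twistSign p.2 : ℤˣ) : ℤ) • LinearMap.id

theorem twist_apply (C : GrComplex K 𝒜) {i j : ℤ} {m : C.carrier} (hm : m ∈ C.deg i j) :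
    C.twist m = ((twistSign j : ℤˣ) : ℤ) • m := by
  rw [twist, glue_apply (i := (i, j)) C.internal _ hm]
  rfl

theorem twist_mem (C : GrComplex K 𝒜) {i j : ℤ} {m : C.carrier} (hm : m ∈ C.deg i j) :
    C.twist m ∈ C.deg i j := by
  rw [C.twist_apply hm]
  exact zsmul_mem hm _

theorem twist_twist (C : GrComplex K 𝒜) (m : C.carrier) : C.twist (C.twist m) = m := by
  induction m using C.induction with
  | mem i j m hm =>
    rw [C.twist_apply hm, map_zsmul, C.twist_apply hm, smul_smul, ← Units.val_mul,
      Int.units_mul_self]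
    simp
  | zero => simp
  | add x y hx hy => simp only [map_add, hx, hy]

theorem twist_d (C : GrComplex K 𝒜) (m : C.carrier) : C.twist (C.d m) = C.d (C.twist m) := by
  induction m using C.induction with
  | mem i j m hm => rw [C.twist_apply hm, C.twist_apply (C.d_mem hm), map_zsmul]
  | zero => simp
  | add x y hx hy => simp only [map_add, hx, hy]

/-- A linear map that preserves the cohomological degree commutes with the sign. -/
theorem sign_map {B : Type u} [Ring B] [Algebra K B] {ℬ : ℤ → Submodule K B}
    {C : GrComplex K 𝒜} {D : GrComplex K ℬ} (f : C.carrier →ₗ[K] D.carrier) (n : ℤ)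
    (hf : ∀ i j, ∀ m ∈ C.deg i j, f m ∈ D.deg i (j + n)) (m : C.carrier) :
    D.sign (f m) = f (C.sign m) := by
  induction m using C.induction with
  | mem i j m hm => rw [C.sign_apply hm, D.sign_apply (hf _ _ _ hm), map_zsmul]
  | zero => simp
  | add x y hx hy => simp only [map_add, hx, hy]

/-- A basis over the ground field that consists of bihomogeneous elements. -/
def fieldBasis (C : GrComplex K 𝒜) :
    Module.Basis (Σ p : ℤ × ℤ, Module.Basis.ofVectorSpaceIndex K (C.deg p.1 p.2)) K C.carrier :=
  C.internal.collectedBasis fun p => Module.Basis.ofVectorSpace K (C.deg p.1 p.2)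

theorem fieldBasis_mem (C : GrComplex K 𝒜)
    (i : Σ p : ℤ × ℤ, Module.Basis.ofVectorSpaceIndex K (C.deg p.1 p.2)) :
    C.fieldBasis i ∈ C.deg i.1.1 i.1.2 :=
  C.internal.collectedBasis_mem _ i

end GrComplex

/-! ### Homogeneous bases of L(G) and the map G → R(L(G)) -/

section Units

variable {K : Type u} [Field K] {V : Type u} [AddCommGroup V] [Module K V]
  {v : ℕ} (e : Module.Basis (Fin v) K V)

theorem one_mem_symGrading : (1 : S K V) ∈ symGrading K (Module.Dual K V) 0 := by
  have := symGrading_natCast K (Module.Dual K V) 0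
  rw [Nat.cast_zero, pow_zero] at this
  rw [this]
  exact Submodule.one_le.1 le_rfl

theorem one_mem_extGrading : (1 : E K V) ∈ extGrading K V 0 := by
  have := extGrading_neg_natCast K V 0
  rw [Nat.cast_zero, neg_zero, ExteriorAlgebra.exteriorPower, pow_zero] at this
  rw [this]
  exact Submodule.one_le.1 le_rfl

/-- A homogeneous basis of `L(G)`. -/
def LBasis (G : EComplex K V) : (L e G).HomogeneousBasis where
  index := Σ p : ℤ × ℤ, Module.Basis.ofVectorSpaceIndex K (G.deg p.1 p.2)
  basis := Algebra.TensorProduct.basis (S K V) G.fieldBasis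
  coh i := i.1.1 - i.1.2
  int i := i.1.2
  mem i := by
    have h := tmul_mem_LDeg G one_mem_symGrading (G.fieldBasis_mem i) rfl (zero_add _)
    rw [← Algebra.TensorProduct.basis_apply] at h
    exact h

theorem L_isFree (G : EComplex K V) : (L e G).IsFree := ⟨LBasis e G⟩

/-! ### The unit of the adjunction -/

/-- The map `S ⊗ G → G` given by the augmentation. -/
def augL (G : EComplex K V) : S K V ⊗[K] G.carrier →ₗ[K] G.carrier :=
  TensorProduct.lid K G.carrier ∘ₗ TensorProduct.map augS.toLinearMap LinearMap.id

@[simp] theorem augL_tmul (G : EComplex K V) (s : S K V) (g : G.carrier) :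
    augL G (s ⊗ₜ g) = augS s • g := by
  simp [augL]

theorem augL_smul (G : EComplex K V) (r : Fin v) (x : S K V ⊗[K] G.carrier) :
    augL G (xS e r • x) = 0 := by
  induction x using TensorProduct.induction_on with
  | zero => simp
  | add x y hx hy => simp only [smul_add, map_add, hx, hy, add_zero]
  | tmul s g => rw [TensorProduct.smul_tmul', smul_eq_mul, augL_tmul, augS_xS_mul, zero_smul]

theorem augL_d (G : EComplex K V) (x : S K V ⊗[K] G.carrier) :
    augL G (Ld e G x) = G.d (augL G x) := by
  induction x using TensorProduct.induction_on with
  | zero => simp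
  | add x y hx hy => simp only [map_add, hx, hy]
  | tmul s g =>
    rw [Ld_tmul, map_add, map_sum, Finset.sum_eq_zero, add_zero, augL_tmul, augL_tmul,
      LinearMap.map_smul_of_tower]
    intro r _
    rw [augL_tmul, augS_xS_mul, zero_smul]

theorem mem_mS_of_augL (G : EComplex K V) {x : S K V ⊗[K] G.carrier} (hx : augL G x = 0) :
    x ∈ mS e (L e G) := by
  let N : Submodule K (S K V ⊗[K] G.carrier) := mS e (L e G)
  have key : ∀ x, x - 1 ⊗ₜ augL G x ∈ N := by
    intro x
    induction x using TensorProduct.induction_on with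
    | zero => rw [map_zero, TensorProduct.tmul_zero, sub_zero]; exact zero_mem _
    | add x y hx hy =>
      rw [map_add, TensorProduct.tmul_add, add_sub_add_comm]
      exact add_mem hx hy
    | tmul s g =>
      induction s using S_induction e with
      | one c =>
        rw [augL_tmul, AlgHom.commutes, Algebra.algebraMap_self_apply,
          Algebra.algebraMap_eq_smul_one, TensorProduct.smul_tmul, sub_self]
        exact zero_mem _
      | mul r s =>
        rw [augL_tmul, augS_xS_mul, zero_smul, TensorProduct.tmul_zero, sub_zero]
        exact smul_mem_mS e (L e G) r (s ⊗ₜ g : S K V ⊗[K] G.carrier)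
      | add s t hs ht =>
        rw [augL_tmul] at hs ht
        rw [augL_tmul, TensorProduct.add_tmul, map_add, add_smul, TensorProduct.tmul_add,
          add_sub_add_comm]
        exact add_mem hs ht
  have := key x
  rwa [hx, TensorProduct.tmul_zero, sub_zero] at this

/-- The sign of the cohomological degree on `S ⊗ G`. -/
def Lsign (G : EComplex K V) : S K V ⊗[K] G.carrier →ₗ[K] S K V ⊗[K] G.carrier := (L e G).sign

theorem Lsign_tmul (G : EComplex K V) (s : S K V) {i j : ℤ} {g : G.carrier} (hg : g ∈ G.deg i j) :
    Lsign e G (s ⊗ₜ g) = ((Int.negOnePow (i - j) : ℤˣ) : ℤ) • (s ⊗ₜ[K] g) := by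
  induction s using internal_induction (symGrading_isInternal K (Module.Dual K V)) with
  | mem a s hs => exact (L e G).sign_apply (tmul_mem_LDeg G hs hg rfl rfl)
  | zero => simp
  | add s t hs ht => rw [TensorProduct.add_tmul, map_add, hs, ht, smul_add]

/-- The map underlying the unit `G → R(L(G))`. -/
def unitMap (G : EComplex K V) : G.carrier →ₗ[E K V] HomE K V (S K V ⊗[K] G.carrier) where
  toFun g := (TensorProduct.mk K (S K V) G.carrier 1 ∘ₗ G.twist ∘ₗ
    (LinearMap.toSpanSingleton (E K V) G.carrier g).restrictScalars K :
      E K V →ₗ[K] S K V ⊗[K] G.carrier)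
  map_add' g g' := by
    refine HomE.ext fun a => ?_
    change (1 : S K V) ⊗ₜ[K] G.twist (a • (g + g')) =
      1 ⊗ₜ[K] G.twist (a • g) + 1 ⊗ₜ[K] G.twist (a • g')
    rw [smul_add, map_add, TensorProduct.tmul_add]
  map_smul' b g := by
    refine HomE.ext fun a => ?_
    change (1 : S K V) ⊗ₜ[K] G.twist (a • b • g) = 1 ⊗ₜ[K] G.twist ((a * b) • g)
    rw [mul_smul]

theorem unitMap_apply (G : EComplex K V) (g : G.carrier) (a : E K V) :
    unitMap G g a = 1 ⊗ₜ G.twist (a • g) := rfl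

/-- The twist is chosen for this cancellation, which makes `g ↦ (a ↦ 1 ⊗ twist (a g))` a chain map.
At `e_r n` the sign of `L(G)` is `(-1) ^ i` and that of `R(L(G))` is `(-1) ^ (i - j + 1)`; their
quotient is compensated by the ratio `(-1) ^ j` of consecutive twists. -/
theorem unit_sign (G : EComplex K V) (r : Fin v) (n : G.carrier) :
    xS e r ⊗ₜ[K] G.sign (eE e r • G.twist n) +
      Lsign e G (xS e r ⊗ₜ[K] G.twist (eE e r • n)) = 0 := by
  induction n using G.induction with
  | mem i j n hn =>
    have h1 := G.smul_mem (eE_mem e r) hn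
    rw [G.twist_apply hn, G.twist_apply h1, smul_comm, map_zsmul, G.sign_apply h1,
      TensorProduct.tmul_smul (twistSign j : ℤ), TensorProduct.tmul_smul (Int.negOnePow i : ℤ),
      TensorProduct.tmul_smul (twistSign (-1 + j) : ℤ), map_zsmul, Lsign_tmul e G _ h1, smul_smul, smul_smul, ← add_smul, twistSign_eq j,
      show -1 + j = j - 1 by ring,
      show i - (j - 1) = i + (-j) + 1 by ring, Int.negOnePow_succ, Int.negOnePow_add,
      Int.negOnePow_neg]
    convert zero_smul ℤ _
    push_cast
    ring
  | zero => simp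
  | add x y hx hy =>
    simp only [smul_add, map_add, TensorProduct.tmul_add]
    rw [add_add_add_comm, hx, hy, add_zero]

/-- The differential of `R(L(G))`. -/
def RLd (G : EComplex K V) :
    HomE K V (S K V ⊗[K] G.carrier) →ₗ[E K V] HomE K V (S K V ⊗[K] G.carrier) :=
  Rd e (L e G)

theorem RLd_apply (G : EComplex K V) (α : HomE K V (S K V ⊗[K] G.carrier)) (a : E K V) :
    RLd e G α a = Ld e G (α a) + ∑ r, Lsign e G (xS e r • α (eE e r * a)) := rfl

theorem unitMap_d (G : EComplex K V) (g : G.carrier) :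
    unitMap G (G.d g) = RLd e G (unitMap G g) := by
  refine HomE.ext fun a => ?_
  simp only [RLd_apply, unitMap_apply]
  rw [Ld_tmul, ← map_smul, G.twist_d, add_assoc, ← Finset.sum_add_distrib,
    Finset.sum_eq_zero, add_zero]
  intro r _
  rw [TensorProduct.smul_tmul', smul_eq_mul, mul_one, mul_smul]
  exact unit_sign e G r (a • g)

/-- The unit `G → R(L(G))`. -/
def unit (G : EComplex K V) : GrComplex.Hom G (R e (L e G)) where
  toLin := unitMap G
  map_mem := by
    intro i j g hg s a ha
    refine tmul_mem_LDeg G one_mem_symGrading (G.twist_mem (G.smul_mem ha hg)) ?_ (zero_add _)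
    ring
  comm := unitMap_d e G

theorem augL_value_d (G : EComplex K V) (α : HomE K V (S K V ⊗[K] G.carrier)) :
    augL G (RLd e G α 1) = G.d (augL G (α 1)) := by
  rw [RLd_apply, map_add, augL_d, map_sum, Finset.sum_eq_zero, add_zero]
  intro r _
  have h2 : Lsign e G (xS e r • α (eE e r * 1)) = xS e r • Lsign e G (α (eE e r * 1)) :=
    (L e G).sign_smul (xS_mem e r) _
  rw [h2, augL_smul]

theorem augL_unitMap (G : EComplex K V) (g : G.carrier) : augL G (unitMap G g 1) = G.twist g := by
  rw [unitMap_apply, augL_tmul, map_one, one_smul, one_smul]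

/-- The map `α ↦ augL (α 1)` commutes with the differentials and is, up to the twist, a left inverse
of the unit, which gives injectivity. A cycle `α` and the unit of its twisted image have values at
`1` that agree modulo `mS`, so `exists_R_boundary` for the free complex `L(G)` makes them
homologous. -/
theorem unit_isQuasiIso (G : EComplex K V) : (unit e G).IsQuasiIso := by
  rw [GrComplex.Hom.isQuasiIso_iff]
  constructor
  · intro g hg (β : HomE K V (S K V ⊗[K] G.carrier)) (hβ : unitMap G g = RLd e G β)
    have h := augL_value_d e G β
    rw [← hβ, augL_unitMap] at h
    exact ⟨G.twist (augL G (β 1)), by rw [← G.twist_d, ← h, G.twist_twist]⟩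
  · intro (α : HomE K V (S K V ⊗[K] G.carrier)) (hα : RLd e G α = 0)
    have h := augL_value_d e G α
    rw [hα, HomE.zero_apply, map_zero] at h
    have hd : G.d (G.twist (augL G (α 1))) = 0 := by rw [← G.twist_d, ← h, map_zero]
    refine ⟨G.twist (augL G (α 1)), hd, ?_⟩
    have h1 : RLd e G (unitMap G (G.twist (augL G (α 1))) - α) = 0 := by
      rw [map_sub, ← unitMap_d, hd, map_zero, hα, sub_zero]
    have h2 : augL G ((unitMap G (G.twist (augL G (α 1))) - α) 1) = 0 := by
      rw [HomE.sub_apply, map_sub, augL_unitMap, G.twist_twist, sub_self]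
    obtain ⟨β, -, hβ⟩ := exists_R_boundary e (LBasis e G) _ h1 (mem_mS_of_augL e G h2)
    exact ⟨β, hβ⟩

end Units

section Counit

variable {K : Type u} [Field K] {V : Type u} [AddCommGroup V] [Module K V]
  {v : ℕ} (e : Module.Basis (Fin v) K V)

/-! ### Contractions from the right -/

/-- The contraction of an element of the exterior algebra with `x_r` from the right. -/
def conR (r : Fin v) : E K V →ₗ[K] E K V :=
  (CliffordAlgebra.contractRight (Q := (0 : QuadraticForm K V))).flip (e.coord r)

theorem conR_mul_ι (r : Fin v) (a : E K V) (x : V) :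
    conR e r (a * ExteriorAlgebra.ι K x) =
      e.coord r x • a - conR e r a * ExteriorAlgebra.ι K x :=
  CliffordAlgebra.contractRight_mul_ι (Q := (0 : QuadraticForm K V)) (d := e.coord r) x a

theorem conR_mul_same (r : Fin v) (a : E K V) : conR e r (a * eE e r) = a - conR e r a * eE e r := by
  rw [eE, conR_mul_ι]
  simp

theorem conR_mul_ne {q r : Fin v} (h : q ≠ r) (a : E K V) :
    conR e r (a * eE e q) = -(conR e r a * eE e q) := by
  rw [eE, conR_mul_ι]
  simp [h]

theorem conR_mem (r : Fin v) {s : ℤ} {a : E K V} (ha : a ∈ extGrading K V s) :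
    conR e r a ∈ extGrading K V (s + 1) := by
  have key : ∀ k : ℕ, ⋀[K]^k V ≤ (extGrading K V (-(k : ℤ) + 1)).comap (conR e r) := by
    intro k
    induction k with
    | zero =>
      intro a ha
      rw [ExteriorAlgebra.exteriorPower, pow_zero, Submodule.mem_one] at ha
      obtain ⟨c, rfl⟩ := ha
      have h : conR e r (algebraMap K _ c) = 0 :=
        CliffordAlgebra.contractRight_algebraMap (0 : QuadraticForm K V) (e.coord r) c
      rw [Submodule.mem_comap, h]
      exact zero_mem _
    | succ k ih =>
      rw [ExteriorAlgebra.exteriorPower, pow_succ, Submodule.mul_le]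
      rintro b hb _ ⟨x, rfl⟩
      rw [Submodule.mem_comap, conR_mul_ι]
      have hb' : b ∈ extGrading K V (-(k : ℤ)) := by rwa [extGrading_neg_natCast]
      refine sub_mem (Submodule.smul_mem _ _ ?_) ?_
      · convert hb' using 2
        push_cast
        ring
      · have := mul_mem_extGrading K V (ih hb) (ι_mem_extGrading K V x)
        rw [show -(k : ℤ) + 1 + -1 = -((k + 1 : ℕ) : ℤ) + 1 by push_cast; ring] at this
        exact this
  have : extGrading K V s ≤ (extGrading K V (s + 1)).comap (conR e r) :=
    iSup₂_le fun k hk => hk ▸ key k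
  exact this ha

include e in
theorem E_induction_right {p : E K V → Prop} (one : ∀ c : K, p (algebraMap K _ c))
    (mul : ∀ a r, p (a * eE e r)) (add : ∀ a b, p a → p b → p (a + b)) (a : E K V) : p a := by
  have zero : p 0 := by simpa using one 0
  induction a using CliffordAlgebra.right_induction with
  | algebraMap c => exact one c
  | add x y hx hy => exact add x y hx hy
  | mul_ι x a _ =>
    rw [← e.sum_repr x, map_sum, Finset.mul_sum]
    refine Finset.sum_induction _ p add zero fun r _ => ?_
    rw [map_smul, mul_smul_comm, ← smul_mul_assoc]
    exact mul _ r

/-- The left action on `Hom_K(E, M)` is right multiplication in the argument, so contraction from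
the right provides the Clifford operators. They preserve the cohomological degree and therefore
commute with the sign. -/
theorem isClifford_R (M : SComplex K V) :
    IsClifford e (R e M) fun r => HomE.sandwich LinearMap.id (conR e r) where
  same r := fun (α : HomE K V M.carrier) => HomE.ext fun a => by
    change α (conR e r a * eE e r) = α a - α (conR e r (a * eE e r))
    rw [conR_mul_same, map_sub, sub_sub_cancel]
  ne q r h := fun (α : HomE K V M.carrier) => HomE.ext fun a => by
    change α (conR e r a * eE e q) = -α (conR e r (a * eE e q))
    rw [conR_mul_ne e h, map_neg, neg_neg]
  sign r := by
    refine GrComplex.sign_map _ 1 ?_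
    intro k t α hα s a ha
    have h := hα (s + 1) _ (conR_mem e r ha)
    rw [show s + 1 + t = s + (t + 1) by ring] at h
    exact h

/-! ### The counit of the adjunction -/

/-- The map underlying the counit `L(R(M)) → M`. -/
def counitMap (M : SComplex K V) : S K V ⊗[K] HomE K V M.carrier →ₗ[S K V] M.carrier :=
  LinearMap.liftBaseChange (S K V)
    { toFun := fun α : HomE K V M.carrier => M.twist (α 1)
      map_add' := fun α β => by rw [HomE.add_apply, map_add]
      map_smul' := fun c α => by rw [HomE.smulK_apply, map_smul, RingHom.id_apply] }

theorem counitMap_tmul (M : SComplex K V) (s : S K V) (α : HomE K V M.carrier) :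
    counitMap M (s ⊗ₜ α) = s • M.twist (α 1) :=
  LinearMap.liftBaseChange_tmul ..

/-- The sign of the cohomological degree on `R(M)`. -/
def Rsign (M : SComplex K V) : HomE K V M.carrier →ₗ[K] HomE K V M.carrier := (R e M).sign

/-- The same cancellation of consecutive twists as for the unit, now at the argument `e_r`, where a
map of internal degree `t` takes a value of internal degree `t - 1`. -/
theorem counit_sign (M : SComplex K V) (r : Fin v) (α : HomE K V M.carrier) :
    M.twist (M.sign (xS e r • α (eE e r))) + xS e r • M.twist (Rsign e M (eE e r • α) 1) = 0 := by
  have key : ∀ k t : ℤ, ∀ α ∈ RDeg M k t, M.twist (M.sign (xS e r • α (eE e r))) +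
      xS e r • M.twist (Rsign e M (eE e r • α) 1) = 0 := by
    intro k t α hα
    have h1 := hα _ _ (eE_mem e r)
    have h2 := M.smul_mem (xS_mem e r) h1
    have h3 : Rsign e M (eE e r • α) = ((Int.negOnePow k : ℤˣ) : ℤ) • (eE e r • α) :=
      (R e M).sign_apply ((R e M).smul_mem (eE_mem e r) hα)
    have h4 : (((Int.negOnePow k : ℤˣ) : ℤ) • (eE e r • α)) 1 =
        ((Int.negOnePow k : ℤˣ) : ℤ) • α (eE e r) := by
      refine (LinearMap.smul_apply (((Int.negOnePow k : ℤˣ) : ℤ)) (M := E K V) (M₂ := M.carrier)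
        (σ₁₂ := RingHom.id K) (eE e r • α : HomE K V M.carrier) 1).trans ?_
      exact congrArg (fun z => ((Int.negOnePow k : ℤˣ) : ℤ) • α z) (one_mul (eE e r))
    rw [h3, h4, M.sign_apply h2, map_zsmul, M.twist_apply h2, map_zsmul, M.twist_apply h1,
      smul_comm (xS e r), smul_comm (xS e r), smul_smul, smul_smul, ← add_smul,
      show (1 + (-1 + t) : ℤ) = t by ring, show (-1 + t : ℤ) = t - 1 by ring, twistSign_eq t,
      show k - (t - 1) = k + (-t) + 1 by ring, Int.negOnePow_succ, Int.negOnePow_add,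
      Int.negOnePow_neg]
    convert zero_smul ℤ _
    have : ((Int.negOnePow t : ℤˣ) : ℤ) * ((Int.negOnePow t : ℤˣ) : ℤ) = 1 := by
      rw [← Units.val_mul, Int.units_mul_self, Units.val_one]
    push_cast
    linear_combination (-((Int.negOnePow k : ℤˣ) : ℤ) * (twistSign (t - 1) : ℤ)) * this
  induction α using internal_induction (RDeg_isInternal e M) with
  | mem p α hα => exact key p.1 p.2 α hα
  | zero => simp
  | add α β hα hβ =>
    simp only [HomE.add_apply, smul_add, map_add]
    rw [add_add_add_comm, hα, hβ, add_zero]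

/-- The differential of `L(R(M))`. -/
def LRd (M : SComplex K V) :
    S K V ⊗[K] HomE K V M.carrier →ₗ[S K V] S K V ⊗[K] HomE K V M.carrier :=
  Ld e (R e M)

theorem LRd_tmul (M : SComplex K V) (s : S K V) (α : HomE K V M.carrier) :
    LRd e M (s ⊗ₜ α) = s ⊗ₜ Rd e M α + ∑ r, (xS e r * s) ⊗ₜ[K] Rsign e M (eE e r • α) :=
  Ld_tmul e (R e M) s α

theorem counitMap_d (M : SComplex K V) (x : S K V ⊗[K] HomE K V M.carrier) :
    counitMap M (LRd e M x) = M.d (counitMap M x) := by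
  induction x using TensorProduct.induction_on with
  | zero => simp
  | add x y hx hy => simp only [map_add, hx, hy]
  | tmul s α =>
    simp only [LRd_tmul, map_add, map_sum, counitMap_tmul, Rd_apply, mul_one, smul_add,
      Finset.smul_sum, map_smul, ← M.twist_d]
    rw [add_assoc, ← Finset.sum_add_distrib, Finset.sum_eq_zero, add_zero]
    intro r _
    rw [mul_comm, mul_smul, ← smul_add, counit_sign, smul_zero]

/-- The counit `L(R(M)) → M`. -/
def counit (M : SComplex K V) : GrComplex.Hom (L e (R e M)) M where
  toLin := counitMap M
  map_mem := by
    intro k t m hm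
    refine LDeg_le (R e M) (N := (M.deg k t).comap ((counitMap M).restrictScalars K)) ?_ hm
    intro a i j hk ht s hs (α : HomE K V M.carrier) hα
    change counitMap M (s ⊗ₜ α) ∈ M.deg k t
    rw [counitMap_tmul]
    have h := M.smul_mem hs (M.twist_mem (hα 0 1 one_mem_extGrading))
    rw [zero_add, hk, ht] at h
    exact h
  comm := counitMap_d e M

/-- The map `a ↦ ε(a) m`, where `ε` is the augmentation. -/
def cst {F : Type u} [AddCommGroup F] [Module K F] (m : F) : HomE K V F :=
  ((augE (K := K) (V := V)).toLinearMap.smulRight m : E K V →ₗ[K] F)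

theorem cst_apply {F : Type u} [AddCommGroup F] [Module K F] (m : F) (a : E K V) :
    cst m a = augE a • m := rfl

theorem Rd_cst (M : SComplex K V) (m : M.carrier) : Rd e M (cst m) = cst (M.d m) := by
  refine HomE.ext fun a => ?_
  rw [Rd_apply, Finset.sum_eq_zero, add_zero, cst_apply, cst_apply, LinearMap.map_smul_of_tower]
  intro r _
  rw [cst_apply, augE_eE_mul, zero_smul, smul_zero, map_zero]

theorem mem_soc_cst (M : SComplex K V) (m : M.carrier) : (cst m : HomE K V M.carrier) ∈ soc e (R e M) := by
  refine (mem_soc e).2 fun r => ?_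
  refine HomE.ext fun a => ?_
  change cst m (a * eE e r) = 0
  rw [cst_apply, augE_mul_eE, zero_smul]

theorem eq_cst_of_mem_soc (M : SComplex K V) {α : HomE K V M.carrier} (h : α ∈ soc e (R e M)) :
    α = cst (α 1) := by
  replace h := (mem_soc e).1 h
  refine HomE.ext fun a => ?_
  induction a using E_induction_right e with
  | one c =>
    rw [Algebra.algebraMap_eq_smul_one, map_smul, map_smul, cst_apply, map_one augE, one_smul]
  | mul a r =>
    rw [cst_apply, augE_mul_eE, zero_smul]
    exact congrArg (fun β : HomE K V M.carrier => β a) (h r)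
  | add a c ha hc => rw [map_add, map_add, ha, hc]

theorem LRd_one_cst (M : SComplex K V) (m : M.carrier) :
    LRd e M (1 ⊗ₜ cst m) = 1 ⊗ₜ cst (M.d m) := by
  rw [← Rd_cst e]
  exact Ld_one_tmul e (mem_soc_cst e M m)

theorem counitMap_one_cst (M : SComplex K V) (m : M.carrier) :
    counitMap M ((1 : S K V) ⊗ₜ[K] (cst m : HomE K V M.carrier)) = M.twist m := by
  rw [counitMap_tmul, cst_apply, map_one, one_smul, one_smul]

/-- The socle of `R(M)` consists of the maps `cst m`, and `m ↦ 1 ⊗ cst m` is, up to the twist, a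
right inverse of the counit; this gives surjectivity. By `exists_L_boundary` every cycle is
homologous to some `1 ⊗ cst m`, and if its image is a boundary then so is `m`. -/
theorem counit_isQuasiIso (M : SComplex K V) : (counit e M).IsQuasiIso := by
  rw [GrComplex.Hom.isQuasiIso_iff]
  constructor
  · intro (x : S K V ⊗[K] HomE K V M.carrier) (hx : LRd e M x = 0) z (hz : counitMap M x = M.d z)
    have h0 : Ld e (R e M) x ∈ socL e (R e M) := by
      change LRd e M x ∈ _
      rw [hx]
      exact zero_mem _
    obtain ⟨(y : S K V ⊗[K] HomE K V M.carrier), (α : HomE K V M.carrier), hα,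
      (hy : 1 ⊗ₜ α = x - LRd e M y)⟩ := exists_L_boundary e (isClifford_R e M) x h0
    rw [eq_cst_of_mem_soc e M hα] at hy
    have h1 := congrArg (counitMap M) hy
    rw [map_sub, counitMap_d, hz, ← map_sub, counitMap_one_cst] at h1
    have h2 : α 1 = M.d (M.twist (z - counitMap M y)) := by
      rw [← M.twist_d, ← h1, M.twist_twist]
    refine ⟨(1 ⊗ₜ cst (M.twist (z - counitMap M y)) + y : S K V ⊗[K] HomE K V M.carrier), ?_⟩
    change LRd e M _ = x
    rw [map_add, LRd_one_cst, ← h2, hy, sub_add_cancel]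
  · intro m hm
    have h : M.d (M.twist m) = 0 := by rw [← M.twist_d, hm, map_zero]
    refine ⟨((1 : S K V) ⊗ₜ[K] (cst (M.twist m) : HomE K V M.carrier) :
      S K V ⊗[K] HomE K V M.carrier), ?_, 0, ?_⟩
    · change LRd e M _ = 0
      rw [LRd_one_cst, h]
      have : (cst (0 : M.carrier) : HomE K V M.carrier) = 0 := HomE.ext fun a => smul_zero _
      rw [this, TensorProduct.tmul_zero]
    · change _ = counitMap M _ - m
      rw [counitMap_one_cst, M.twist_twist, sub_self, map_zero]

end Counit

/-! ### Injectivity of the terms -/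

namespace GrComplex

variable {K : Type u} [Field K] {A : Type u} [Ring A] [Algebra K A] {𝒜 : ℤ → Submodule K A}

/-- The projection onto the term of cohomological degree `i`, as a linear map over the field. -/
def cohProjK (C : GrComplex K 𝒜) (i : ℤ) : C.carrier →ₗ[K] C.carrier :=
  glue C.internal fun p => if p.1 = i then LinearMap.id else 0

theorem cohProjK_apply (C : GrComplex K 𝒜) (i : ℤ) {k j : ℤ} {m : C.carrier} (hm : m ∈ C.deg k j) :
    C.cohProjK i m = if k = i then m else 0 := by
  rw [cohProjK, glue_apply (i := (k, j)) C.internal _ hm]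
  by_cases h : k = i <;> simp [h]

/-- The projection onto the term of cohomological degree `i`. -/
def cohProj (h𝒜 : DirectSum.IsInternal 𝒜) (C : GrComplex K 𝒜) (i : ℤ) :
    C.carrier →ₗ[A] C.carrier where
  toFun := C.cohProjK i
  map_add' := map_add _
  map_smul' a m := by
    simp only [RingHom.id_apply]
    induction a using internal_induction h𝒜 with
    | mem s a ha =>
      induction m using C.induction with
      | mem k j m hm =>
        rw [C.cohProjK_apply i hm, C.cohProjK_apply i (C.smul_mem ha hm)]
        by_cases h : k = i <;> simp [h]
      | zero => simp
      | add x y hx hy => rw [smul_add, map_add, hx, hy, map_add, smul_add]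
    | zero => simp
    | add a b ha hb => rw [add_smul, map_add, ha, hb, add_smul]

theorem cohProj_mem (h𝒜 : DirectSum.IsInternal 𝒜) (C : GrComplex K 𝒜) (i : ℤ) (m : C.carrier) :
    C.cohProj h𝒜 i m ∈ C.term i := by
  change C.cohProjK i m ∈ _
  induction m using C.induction with
  | mem k j m hm =>
    rw [C.cohProjK_apply i hm]
    by_cases h : k = i
    · subst h
      rw [if_pos rfl]
      exact Submodule.subset_span (Set.mem_iUnion.2 ⟨j, hm⟩)
    · rw [if_neg h]
      exact zero_mem _
  | zero => rw [map_zero]; exact zero_mem _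
  | add x y hx hy => rw [map_add]; exact add_mem hx hy

theorem cohProj_of_mem (h𝒜 : DirectSum.IsInternal 𝒜) (C : GrComplex K 𝒜) (i : ℤ) {m : C.carrier}
    (hm : m ∈ C.term i) : C.cohProj h𝒜 i m = m := by
  have h : C.term i ≤ LinearMap.eqLocus (C.cohProj h𝒜 i) LinearMap.id := by
    refine Submodule.span_le.2 fun m hm => ?_
    obtain ⟨j, hm⟩ := Set.mem_iUnion.1 hm
    exact (C.cohProjK_apply i hm).trans (if_pos rfl)
  exact h hm

theorem HasInjectiveTerms.of_injective (h𝒜 : DirectSum.IsInternal 𝒜) {C : GrComplex K 𝒜}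
    (hC : Module.Injective A C.carrier) : C.HasInjectiveTerms := fun i =>
  ⟨fun X Y _ _ _ _ f hf g => by
    obtain ⟨h, hh⟩ := hC.out f hf ((C.term i).subtype ∘ₗ g)
    refine ⟨(C.cohProj h𝒜 i).codRestrict (C.term i) (C.cohProj_mem h𝒜 i) ∘ₗ h, fun x => ?_⟩
    refine Subtype.ext ?_
    change C.cohProj h𝒜 i (h (f x)) = g x
    rw [hh]
    exact C.cohProj_of_mem h𝒜 i (g x).2⟩

end GrComplex

/-! ### Coinduced modules, boundedness of R, and reciprocity -/

section Reciprocity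

variable {K : Type u} [Field K] {V : Type u} [AddCommGroup V] [Module K V]
  {v : ℕ} (e : Module.Basis (Fin v) K V)

/-- A coinduced module is injective. -/
theorem HomE.injective (N : Type u) [AddCommGroup N] [Module K N] :
    Module.Injective (E K V) (HomE K V N) :=
  ⟨fun X Y _ _ _ _ f hf g => by
    let _ : Module K X := Module.compHom X (algebraMap K (E K V))
    let _ : Module K Y := Module.compHom Y (algebraMap K (E K V))
    have : IsScalarTower K (E K V) X := ⟨fun c a x => by
      rw [Algebra.smul_def, mul_smul]; rfl⟩
    have : IsScalarTower K (E K V) Y := ⟨fun c a x => by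
      rw [Algebra.smul_def, mul_smul]; rfl⟩
    obtain ⟨p, hp⟩ := (f.restrictScalars K).exists_leftInverse_of_injective
      (LinearMap.ker_eq_bot.2 hf)
    -- A map into a coinduced module is determined by its values at `1`, a `K`-linear datum that
    -- extends along a `K`-linear retraction `p` of `f`.
    let ψ : Y →ₗ[K] N :=
      { toFun := fun y => g (p y) 1
        map_add' := fun y z => by rw [map_add, map_add, HomE.add_apply]
        map_smul' := fun c y => by
          rw [map_smul, LinearMap.map_smul_of_tower, HomE.smulK_apply, RingHom.id_apply] }
    refine ⟨
      { toFun := fun y => (ψ ∘ₗ (LinearMap.toSpanSingleton (E K V) Y y).restrictScalars K :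
          E K V →ₗ[K] N)
        map_add' := fun y z => HomE.ext fun a => ?_
        map_smul' := fun c y => HomE.ext fun a => ?_ }, fun x => HomE.ext fun a => ?_⟩
    · change ψ (a • (y + z)) = ψ (a • y) + ψ (a • z)
      rw [smul_add, map_add]
    · change ψ (a • c • y) = ψ ((a * c) • y)
      rw [mul_smul]
    · change g (p (a • f x)) 1 = g x a
      have : p (a • f x) = a • x := by
        rw [← map_smul]
        exact LinearMap.congr_fun hp (a • x)
      rw [this, map_smul, HomE.smul_apply, one_mul]⟩

theorem R_hasInjectiveTerms (M : SComplex K V) : (R e M).HasInjectiveTerms :=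
  GrComplex.HasInjectiveTerms.of_injective (extGrading_isInternal K V)
    (HomE.injective (V := V) M.carrier)

/-! ### Boundedness -/

theorem symGrading_neg {W : Type u} [AddCommGroup W] [Module K W] {s : ℤ} (hs : s < 0) :
    symGrading K W s = ⊥ := by
  rw [eq_bot_iff]
  exact iSup₂_le fun k hk => by omega

/-- The submodule generated by the components of internal degree at least `t`. -/
def intGE (M : SComplex K V) (t : ℤ) : Submodule (S K V) M.carrier :=
  Submodule.span (S K V) {m | ∃ i j, t ≤ j ∧ m ∈ M.deg i j}

theorem intGE_anti (M : SComplex K V) {t t' : ℤ} (h : t' ≤ t) : intGE M t ≤ intGE M t' :=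
  Submodule.span_mono fun _ ⟨i, j, hj, hm⟩ => ⟨i, j, h.trans hj, hm⟩

theorem exists_mem_intGE (M : SComplex K V) (m : M.carrier) : ∃ t, m ∈ intGE M t := by
  induction m using M.induction with
  | mem i j m hm => exact ⟨j, Submodule.subset_span ⟨i, j, le_rfl, hm⟩⟩
  | zero => exact ⟨0, zero_mem _⟩
  | add x y hx hy =>
    obtain ⟨t, ht⟩ := hx
    obtain ⟨t', ht'⟩ := hy
    exact ⟨min t t', add_mem (intGE_anti M (min_le_left t t') ht)
      (intGE_anti M (min_le_right t t') ht')⟩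

/-- The symmetric algebra lives in nonnegative degrees, so generators of internal degree at least
`t` produce nothing below `t`. -/
theorem projDeg_intGE (M : SComplex K V) {t i j : ℤ} (hj : j < t) {m : M.carrier}
    (hm : m ∈ intGE M t) : M.projDeg (i, j) m = 0 := by
  have key : ∀ s : S K V, ∀ m ∈ {m | ∃ i j, t ≤ j ∧ m ∈ M.deg i j},
      M.projDeg (i, j) (s • m) = 0 := by
    rintro s m ⟨i', j', hj', hm⟩
    induction s using internal_induction (symGrading_isInternal K (Module.Dual K V)) with
    | mem a s hs =>
      by_cases ha : a < 0
      · rw [symGrading_neg ha, Submodule.mem_bot] at hs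
        rw [hs, zero_smul, map_zero]
      · refine M.projDeg_ne (M.smul_mem hs hm) fun h => ?_
        simp only [Prod.mk.injEq] at h
        omega
    | zero => simp
    | add x y hx hy => rw [add_smul, map_add, hx, hy, add_zero]
  induction hm using Submodule.span_induction with
  | mem m hm => rw [← one_smul (S K V) m]; exact key 1 m hm
  | zero => exact map_zero _
  | add x y _ _ hx hy => rw [map_add, hx, hy, add_zero]
  | smul s m hm ih =>
    -- The projection `projDeg` is not linear over `S`, so the induction is repeated with an
    -- arbitrary scalar in front.
    clear ih
    induction hm using Submodule.span_induction generalizing s with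
    | mem m hm => exact key s m hm
    | zero => rw [smul_zero, map_zero]
    | add x y _ _ hx hy => rw [smul_add, map_add, hx, hy, add_zero]
    | smul s' m _ ih => rw [smul_smul]; exact ih _

theorem exists_deg_eq_bot_of_term_fg (M : SComplex K V) {i : ℤ} (h : (M.term i).FG) :
    ∃ t, ∀ j < t, M.deg i j = ⊥ := by
  obtain ⟨T, hT⟩ := h
  obtain ⟨t, ht⟩ : ∃ t, (T : Set M.carrier) ⊆ intGE M t := by
    classical
    clear hT
    induction T using Finset.induction_on with
    | empty => exact ⟨0, by simp⟩
    | insert m T _ ih =>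
      obtain ⟨t, ht⟩ := ih
      obtain ⟨t', ht'⟩ := exists_mem_intGE M m
      refine ⟨min t t', ?_⟩
      rw [Finset.coe_insert, Set.insert_subset_iff]
      exact ⟨intGE_anti M (min_le_right t t') ht', fun x hx =>
        intGE_anti M (min_le_left t t') (ht hx)⟩
  refine ⟨t, fun j hj => ?_⟩
  rw [eq_bot_iff]
  intro m hm
  have h1 : m ∈ intGE M t := by
    refine Submodule.span_le.2 ht ?_
    rw [hT]
    exact Submodule.subset_span (Set.mem_iUnion.2 ⟨j, hm⟩)
  rw [Submodule.mem_bot, ← M.projDeg_same hm, projDeg_intGE M hj h1]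

theorem exists_deg_eq_bot {M : SComplex K V} (hb : M.IsBounded) (hM : M.HasFGTerms) :
    ∃ t, ∀ i, ∀ j < t, M.deg i j = ⊥ := by
  obtain ⟨a, b, hab⟩ := hb
  choose t ht using fun i => exists_deg_eq_bot_of_term_fg M (hM i)
  obtain ⟨t', ht'⟩ := ((Finset.Icc a b).image t).bddBelow
  refine ⟨t', fun i j hj => ?_⟩
  by_cases hi : i ∈ Finset.Icc a b
  · exact ht i j (hj.trans_le (ht' (Finset.mem_coe.2 (Finset.mem_image_of_mem t hi))))
  · refine hab i j ?_
    rw [Finset.mem_Icc] at hi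
    omega

/-- A map of cohomological degree `k` has values in components with `i + m = k`. Boundedness of `M`
bounds `i` from below and finite generation bounds `m` from below, so nothing is left for small `k`.
-/
theorem R_isBoundedBelow {M : SComplex K V} (hb : M.IsBounded) (hM : M.HasFGTerms) :
    (R e M).IsBoundedBelow := by
  obtain ⟨t, ht⟩ := exists_deg_eq_bot hb hM
  obtain ⟨a, b, hab⟩ := hb
  refine ⟨a + t, fun k j hk => ?_⟩
  rw [eq_bot_iff]
  intro (α : HomE K V M.carrier) hα
  refine HomE.ext_of_mem fun s c hc => ?_
  have h := hα s c hc
  have h0 : M.deg (k - (s + j)) (s + j) = ⊥ := by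
    by_cases hs : s + j < t
    · exact ht _ _ hs
    · exact hab _ _ (Or.inl (by omega))
  rwa [h0, Submodule.mem_bot] at h

/-- If `x ⊗ g`, with `x` of degree `p`, occurs in a value of a map of cohomological degree `k`, then
`g` has cohomological degree `k - p ≤ k`. Hence the bound for `G` is also one for `R(L(G))`. -/
theorem RL_isBoundedBelow {G : EComplex K V} (hb : G.IsBoundedBelow) :
    (R e (L e G)).IsBoundedBelow := by
  obtain ⟨a, ha⟩ := hb
  refine ⟨a, fun k j hk => ?_⟩
  rw [eq_bot_iff]
  intro (α : HomE K V (S K V ⊗[K] G.carrier)) hα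
  refine HomE.ext_of_mem fun s c hc => ?_
  have h : LDeg G (k - (s + j)) (s + j) ≤ ⊥ := by
    refine LDeg_le G fun p i l hi hl x hx g hg => ?_
    rw [Submodule.mem_bot]
    by_cases hp : p < 0
    · rw [symGrading_neg hp, Submodule.mem_bot] at hx
      rw [hx, TensorProduct.zero_tmul]
    · rw [ha i l (by omega), Submodule.mem_bot] at hg
      rw [hg, TensorProduct.tmul_zero]
  exact (Submodule.mem_bot K).1 (h (hα s c hc))

theorem GrComplex.IsBounded.isBoundedBelow {A : Type u} [Ring A] [Algebra K A]
    {𝒜 : ℤ → Submodule K A} {C : GrComplex K 𝒜} (h : C.IsBounded) : C.IsBoundedBelow := by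
  obtain ⟨a, b, h⟩ := h
  exact ⟨a, fun i j hi => h i j (Or.inl hi)⟩

theorem GrComplex.IsModule.isBounded {A : Type u} [Ring A] [Algebra K A]
    {𝒜 : ℤ → Submodule K A} {C : GrComplex K 𝒜} (h : C.IsModule) : C.IsBounded :=
  ⟨0, 0, fun i j hi => h i j (by omega)⟩

/-- Reciprocity. -/
theorem isFreeResolution_L_iff {M : SComplex K V} {P : EComplex K V} (hM : M.IsBounded)
    (hM' : M.HasFGTerms) (hP : P.IsBoundedBelow) :
    (L e P).IsFreeResolution M ↔ (R e M).IsInjectiveResolution P := by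
  have hb := R_isBoundedBelow e hM hM'
  constructor
  · rintro ⟨-, f, hf⟩
    -- The composite `P → R(L(P)) → R(M)`.
    exact ⟨R_hasInjectiveTerms e M, hb, (Rmap e f).comp (unit e P),
      (Rmap_isQuasiIso e hf).comp (unit_isQuasiIso e P)⟩
  · rintro ⟨-, -, g, hg⟩
    -- The composite `L(P) → L(R(M)) → M`; here `L` is applied to a map between bounded below
    -- complexes.
    exact ⟨L_isFree e P, (counit e M).comp (Lmap e g),
      (counit_isQuasiIso e M).comp (Lmap_isQuasiIso e hP hb hg)⟩

end Reciprocity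

namespace GrComplex

variable {K : Type u} [Field K] {A : Type u} [Ring A] [Algebra K A] {𝒜 : ℤ → Submodule K A}

/-! ### Homology classes -/

/-- The homology class of a cycle. -/
def cls (C : GrComplex K 𝒜) (x : C.carrier) (hx : C.d x = 0) : C.HomologyModule :=
  C.homologyClass ⟨x, hx⟩

theorem exists_cls (C : GrComplex K 𝒜) (h : C.HomologyModule) : ∃ x hx, C.cls x hx = h := by
  obtain ⟨⟨x, hx⟩, rfl⟩ := C.homologyClass_surjective h
  exact ⟨x, hx, rfl⟩

theorem cls_eq_iff (C : GrComplex K 𝒜) {x y : C.carrier} (hx : C.d x = 0) (hy : C.d y = 0) :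
    C.cls x hx = C.cls y hy ↔ ∃ z, C.d z = x - y :=
  C.homologyClass_eq_iff ⟨x, hx⟩ ⟨y, hy⟩

theorem cls_add (C : GrComplex K 𝒜) {x y : C.carrier} (hx : C.d x = 0) (hy : C.d y = 0)
    (h : C.d (x + y) = 0) : C.cls (x + y) h = C.cls x hx + C.cls y hy :=
  map_add C.homologyClass ⟨x, hx⟩ ⟨y, hy⟩

theorem cls_smul (C : GrComplex K 𝒜) (a : A) {x : C.carrier} (hx : C.d x = 0)
    (h : C.d (a • x) = 0) : C.cls (a • x) h = a • C.cls x hx :=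
  map_smul C.homologyClass a ⟨x, hx⟩

theorem cls_zsmul (C : GrComplex K 𝒜) (n : ℤ) {x : C.carrier} (hx : C.d x = 0)
    (h : C.d (n • x) = 0) : C.cls (n • x) h = n • C.cls x hx :=
  map_zsmul C.homologyClass n ⟨x, hx⟩

theorem cls_mem (C : GrComplex K 𝒜) {i j : ℤ} {x : C.carrier} (hx : C.d x = 0)
    (h : x ∈ C.deg i j) : C.cls x hx ∈ C.homology.deg i j := ⟨⟨x, hx⟩, h, rfl⟩

theorem exists_cls_of_mem (C : GrComplex K 𝒜) {i j : ℤ} {h : C.HomologyModule}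
    (hh : h ∈ C.homologyDeg i j) : ∃ x hx, C.cls x hx = h ∧ x ∈ C.deg i j := by
  obtain ⟨⟨x, hx⟩, hm, rfl⟩ := hh
  exact ⟨x, hx, rfl, hm⟩

theorem d_sign_eq_zero (C : GrComplex K 𝒜) {x : C.carrier} (hx : C.d x = 0) :
    C.d (C.sign x) = 0 := by
  rw [← neg_eq_zero, ← C.sign_d, hx, map_zero]

/-- The sign of the cohomological degree on the homology. -/
def homologySign (C : GrComplex K 𝒜) : C.HomologyModule →ₗ[K] C.HomologyModule := C.homology.sign

theorem homologySign_apply (C : GrComplex K 𝒜) {i j : ℤ} {h : C.HomologyModule}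
    (hh : h ∈ C.homologyDeg i j) : C.homologySign h = ((Int.negOnePow i : ℤˣ) : ℤ) • h :=
  C.homology.sign_apply hh

theorem homologySign_cls (C : GrComplex K 𝒜) {x : C.carrier} (hx : C.d x = 0) :
    C.homologySign (C.cls x hx) = C.cls (C.sign x) (C.d_sign_eq_zero hx) := by
  -- The sign on homology is defined through homogeneous classes, so it is first computed on a
  -- representative adapted to them. It differs from `x` by a boundary, which the sign maps to a
  -- boundary.
  have key : ∀ h : C.HomologyModule, ∃ y hy, C.cls y hy = h ∧
      C.homologySign h = C.cls (C.sign y) (C.d_sign_eq_zero hy) := by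
    intro h
    induction h using internal_induction C.homologyDeg_isInternal with
    | mem p h hh =>
      obtain ⟨y, hy, rfl, hm⟩ := C.exists_cls_of_mem hh
      refine ⟨y, hy, rfl, ?_⟩
      have h1 : C.d (((Int.negOnePow p.1 : ℤˣ) : ℤ) • y) = 0 := by rw [map_zsmul, hy, smul_zero]
      rw [C.homologySign_apply hh, ← C.cls_zsmul _ hy h1]
      congr 1
      exact (C.sign_apply hm).symm
    | zero =>
      refine ⟨0, map_zero _, map_zero C.homologyClass, ?_⟩
      rw [map_zero, eq_comm]
      refine (C.homologyClass_eq_zero_iff _).2 ⟨0, ?_⟩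
      change C.d 0 = C.sign 0
      rw [map_zero, map_zero]
    | add h h' ih ih' =>
      obtain ⟨y, hy, rfl, h1⟩ := ih
      obtain ⟨y', hy', rfl, h1'⟩ := ih'
      have h0 : C.d (y + y') = 0 := by rw [map_add, hy, hy', add_zero]
      refine ⟨y + y', h0, C.cls_add hy hy' h0, ?_⟩
      rw [map_add, h1, h1', ← C.cls_add _ _ (by rw [← map_add]; exact C.d_sign_eq_zero h0)]
      congr 1
      exact (map_add _ _ _).symm
  obtain ⟨y, hy, h, h1⟩ := key (C.cls x hx)
  rw [h1, cls_eq_iff]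
  obtain ⟨z, hz⟩ := (C.cls_eq_iff hy hx).1 h
  exact ⟨-C.sign z, by rw [map_neg, ← C.sign_d, hz, map_sub]⟩

/-- A linear map that vanishes on boundaries, on homology. -/
def homologyLift (C : GrComplex K 𝒜) {N : Type*} [AddCommGroup N] [Module K N]
    (f : C.carrier →ₗ[K] N) (hf : ∀ x, f (C.d x) = 0) : C.HomologyModule →ₗ[K] N :=
  Submodule.liftQ (((LinearMap.range C.d).submoduleOf (LinearMap.ker C.d)).restrictScalars K)
    (f ∘ₗ (LinearMap.ker C.d).subtype.restrictScalars K) (by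
      rintro ⟨x, hx⟩ ⟨y, hy⟩
      exact (congrArg f hy).symm.trans (hf y)) ∘ₗ
    (Submodule.Quotient.restrictScalarsEquiv K _).symm.toLinearMap

/-! ### Coefficients with respect to a homogeneous basis -/

namespace HomogeneousBasis

variable {C : GrComplex K 𝒜} (b : C.HomogeneousBasis)

theorem repr_projDeg (h𝒜 : DirectSum.IsInternal 𝒜) (p q : ℤ) (m : C.carrier) (i : b.index) :
    b.basis.repr (C.projDeg (p, q) m) i =
      if b.coh i = p then proj h𝒜 (q - b.int i) (b.basis.repr m i) else 0 := by
  classical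
  induction m using b.induction with
  | smul a j =>
    induction a using internal_induction h𝒜 with
    | mem s a ha =>
      have hm := C.smul_mem ha (b.mem j)
      by_cases h : (b.coh j, s + b.int j) = (p, q)
      · rw [Prod.mk.injEq] at h
        obtain ⟨rfl, rfl⟩ := h
        rw [C.projDeg_same hm, map_smul, Module.Basis.repr_self, Finsupp.smul_single,
          Finsupp.single_apply]
        by_cases hij : j = i
        · subst hij
          rw [if_pos rfl, if_pos rfl, add_sub_cancel_right, smul_eq_mul, mul_one, proj_same _ ha]
        · simp [hij]
      · rw [C.projDeg_ne hm h, map_smul, Module.Basis.repr_self, Finsupp.smul_single,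
          Finsupp.single_apply, map_zero, Finsupp.zero_apply]
        by_cases hij : j = i
        · subst hij
          rw [if_pos rfl, smul_eq_mul, mul_one]
          split_ifs with h1
          · rw [proj_ne _ ha]
            intro h2
            exact h (by rw [h1, h2, sub_add_cancel])
          · rfl
        · simp [hij]
    | zero => simp
    | add a c ha hc =>
      rw [add_smul, map_add, map_add, map_add, Finsupp.add_apply, Finsupp.add_apply, map_add, ha, hc]
      split_ifs <;> simp
  | zero => simp
  | add x y hx hy =>
    rw [map_add, map_add, map_add, Finsupp.add_apply, Finsupp.add_apply, map_add, hx, hy]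
    split_ifs <;> simp

theorem repr_mem (h𝒜 : DirectSum.IsInternal 𝒜) {p q : ℤ} {m : C.carrier} (hm : m ∈ C.deg p q)
    (i : b.index) : b.basis.repr m i ∈ 𝒜 (q - b.int i) := by
  rw [← C.projDeg_same hm, b.repr_projDeg h𝒜]
  split_ifs
  · exact proj_mem _ _ _
  · exact zero_mem _

theorem repr_eq_zero (h𝒜 : DirectSum.IsInternal 𝒜) {p q : ℤ} {m : C.carrier} (hm : m ∈ C.deg p q)
    {i : b.index} (hi : b.coh i ≠ p) : b.basis.repr m i = 0 := by
  rw [← C.projDeg_same hm, b.repr_projDeg h𝒜, if_neg hi]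

theorem coefMap_eq_sum (φ : A →ₗ[K] A) (m : C.carrier) :
    b.coefMap φ m = (b.basis.repr m).sum fun i a => φ a • b.basis i := by
  conv_lhs => rw [← b.basis.linearCombination_repr m, Finsupp.linearCombination_apply, Finsupp.sum,
    map_sum]
  exact Finset.sum_congr rfl fun i _ => b.coefMap_smul φ _ i

theorem coefMap_mem (h𝒜 : DirectSum.IsInternal 𝒜) {φ : A →ₗ[K] A}
    (n : ℤ) (hφ : ∀ s, ∀ a ∈ 𝒜 s, φ a ∈ 𝒜 (s + n)) {p q : ℤ} {m : C.carrier}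
    (hm : m ∈ C.deg p q) : b.coefMap φ m ∈ C.deg p (q + n) := by
  rw [b.coefMap_eq_sum]
  refine Submodule.sum_mem _ fun i _ => ?_
  by_cases hi : b.coh i = p
  · have h := C.smul_mem (hφ _ _ (b.repr_mem h𝒜 hm i)) (b.mem i)
    rwa [hi, show q - b.int i + n + b.int i = q + n by ring] at h
  · change φ (b.basis.repr m i) • b.basis i ∈ _
    rw [b.repr_eq_zero h𝒜 hm hi, map_zero, zero_smul]
    exact zero_mem _

/-- The reduction of the coefficients along an augmentation. -/
def reduce (aug : A →ₐ[K] K) : C.carrier →ₗ[K] C.carrier :=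
  b.coefMap (Algebra.linearMap K A ∘ₗ aug.toLinearMap)

theorem reduce_smul (aug : A →ₐ[K] K) (a : A) (m : C.carrier) :
    b.reduce aug (a • m) = aug a • b.reduce aug m := by
  induction m using b.induction with
  | smul c i =>
    rw [smul_smul, reduce, coefMap_smul, coefMap_smul]
    simp only [LinearMap.comp_apply, AlgHom.toLinearMap_apply, Algebra.linearMap_apply, map_mul]
    rw [← smul_smul, algebraMap_smul]
  | zero => simp
  | add x y hx hy => simp only [smul_add, map_add, hx, hy]

theorem reduce_basis (aug : A →ₐ[K] K) (i : b.index) : b.reduce aug (b.basis i) = b.basis i := by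
  have := b.coefMap_smul (Algebra.linearMap K A ∘ₗ aug.toLinearMap) 1 i
  rw [one_smul, LinearMap.comp_apply, AlgHom.toLinearMap_apply, map_one, Algebra.linearMap_apply,
    map_one, one_smul] at this
  exact this

theorem reduce_mem_span (aug : A →ₐ[K] K) (m : C.carrier) :
    b.reduce aug m ∈ Submodule.span K (Set.range b.basis) := by
  induction m using b.induction with
  | smul c i =>
    rw [reduce_smul, reduce_basis]
    exact Submodule.smul_mem _ _ (Submodule.subset_span ⟨i, rfl⟩)
  | zero => rw [map_zero]; exact zero_mem _
  | add x y hx hy => rw [map_add]; exact add_mem hx hy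

theorem reduce_d {aug : A →ₐ[K] K} (haug : ∀ s ≠ 0, ∀ a ∈ 𝒜 s, aug a = 0) (hC : C.IsMinimal)
    (m : C.carrier) : b.reduce aug (C.d m) = 0 := by
  have h := hC m
  generalize C.d m = y at h
  induction h using Submodule.span_induction with
  | mem y hy =>
    obtain ⟨s, hs, a, ha, m, rfl⟩ := hy
    rw [reduce_smul, haug s hs a ha, zero_smul]
  | zero => exact map_zero _
  | add x y _ _ hx hy => rw [map_add, hx, hy, add_zero]
  | smul a x _ hx => rw [reduce_smul, hx, smul_zero]

theorem reduce_mem (h𝒜 : DirectSum.IsInternal 𝒜) {aug : A →ₐ[K] K}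
    (haug : ∀ s ≠ 0, ∀ a ∈ 𝒜 s, aug a = 0) (haug0 : ∀ a ∈ 𝒜 0, algebraMap K A (aug a) = a)
    {p q : ℤ} {m : C.carrier} (hm : m ∈ C.deg p q) : b.reduce aug m ∈ C.deg p q := by
  have h := b.coefMap_mem h𝒜 (φ := Algebra.linearMap K A ∘ₗ aug.toLinearMap) 0 (fun s a ha => by
    rw [LinearMap.comp_apply, AlgHom.toLinearMap_apply, Algebra.linearMap_apply, add_zero]
    by_cases hs : s = 0
    · subst hs
      rwa [haug0 a ha]
    · rw [haug s hs a ha, map_zero]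
      exact zero_mem _) hm
  rwa [add_zero] at h

/-- The linear part of a minimal complex picks the entries of degree `n = ± 1` of the matrix of the
differential if there are no entries of degree `- n`. -/
theorem linearPart_basis (h𝒜 : DirectSum.IsInternal 𝒜) {aug : A →ₐ[K] K}
    (haug : ∀ s ≠ 0, ∀ a ∈ 𝒜 s, aug a = 0) (haug0 : ∀ a ∈ 𝒜 0, algebraMap K A (aug a) = a)
    (hC : C.IsMinimal) {n : ℤ} (hn : |n| = 1) (hbot : 𝒜 (-n) = ⊥) (j : b.index) :
    b.linearPart (b.basis j) = b.coefMap (proj h𝒜 n) (C.d (b.basis j)) := by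
  rw [linearPart, Module.Basis.constr_basis, b.coefMap_eq_sum]
  refine Finset.sum_congr rfl fun i _ => ?_
  have hmem := b.repr_mem h𝒜 (C.d_mem (b.mem j)) i
  -- Minimality says that no entry has a constant term.
  have h0 : aug (b.basis.repr (C.d (b.basis j)) i) = 0 := by
    have h1 := b.repr_coefMap (Algebra.linearMap K A ∘ₗ aug.toLinearMap) (C.d (b.basis j)) i
    have h2 := b.reduce_d haug hC (b.basis j)
    rw [reduce] at h2
    rw [h2, map_zero, Finsupp.zero_apply, LinearMap.comp_apply, AlgHom.toLinearMap_apply,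
      Algebra.linearMap_apply] at h1
    have h3 := congrArg aug h1
    rwa [map_zero, AlgHom.commutes, Algebra.algebraMap_self_apply, eq_comm] at h3
  beta_reduce
  generalize b.basis.repr (C.d (b.basis j)) i = a at hmem h0
  generalize b.int j - b.int i = s at hmem ⊢
  by_cases hs : s = n
  · subst hs
    rw [if_pos hn.le, proj_same _ hmem]
  · rw [proj_ne _ hmem hs, zero_smul]
    split_ifs with h
    -- The other degrees that are not erased are `0`, where minimality makes the entry vanish, and
    -- `-n`, where the algebra is zero.
    · have h4 : s = 0 ∨ s = -n := by
        rcases (abs_eq (by norm_num : (0 : ℤ) ≤ 1)).1 hn with rfl | rfl <;>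
        · rw [abs_le] at h
          omega
      have ha : a = 0 := by
        rcases h4 with rfl | rfl
        · rw [← haug0 a hmem, h0, map_zero]
        · rwa [hbot, Submodule.mem_bot] at hmem
      rw [ha, zero_smul]
    · rfl

end HomogeneousBasis

end GrComplex

/-! ### Linear parts over the symmetric algebra -/

section LinearPartS

variable {K : Type u} [Field K] {V : Type u} [AddCommGroup V] [Module K V]
  {v : ℕ} (e : Module.Basis (Fin v) K V)

theorem algebraMap_augS {s : S K V} (hs : s ∈ symGrading K (Module.Dual K V) 0) :
    algebraMap K _ (augS s) = s := by
  have := symGrading_natCast K (Module.Dual K V) 0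
  rw [Nat.cast_zero, pow_zero] at this
  rw [this, Submodule.mem_one] at hs
  obtain ⟨c, rfl⟩ := hs
  rw [AlgHom.commutes, Algebra.algebraMap_self_apply]

theorem proj_one_xS_mul (r : Fin v) (s : S K V) :
    proj (symGrading_isInternal K (Module.Dual K V)) 1 (xS e r * s) =
      xS e r * algebraMap K _ (augS s) := by
  induction s using internal_induction (symGrading_isInternal K (Module.Dual K V)) with
  | mem a s hs =>
    have h := mul_mem_symGrading K _ (xS_mem e r) hs
    by_cases ha : a = 0
    · subst ha
      rw [add_zero] at h
      rw [algebraMap_augS hs, proj_same _ h]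
    · rw [augS_of_mem ha hs, map_zero, mul_zero, proj_ne _ h (by omega)]
  | zero => simp
  | add s t hs ht => simp only [mul_add, map_add, hs, ht]

theorem twist_mem_mS {F : SComplex K V} {z : F.carrier} (hz : z ∈ mS e F) :
    F.twist z ∈ mS e F := by
  refine mS_le e (N := (mS e F).comap F.twist) (fun r z => ?_) hz
  rw [Submodule.mem_comap]
  induction z using F.induction with
  | mem i j z hz =>
    rw [F.twist_apply (F.smul_mem (xS_mem e r) hz)]
    exact zsmul_mem (smul_mem_mS e F r z) _
  | zero => simp
  | add x y hx hy => rw [smul_add, map_add]; exact add_mem hx hy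

variable {F : SComplex K V} (b : F.HomogeneousBasis)

include e in
theorem smul_sub_aug_mem_mS (s : S K V) (m : F.carrier) : s • m - augS s • m ∈ mS e F := by
  induction s using S_induction e with
  | one c =>
    rw [AlgHom.commutes, Algebra.algebraMap_self_apply, algebraMap_smul, sub_self]
    exact zero_mem _
  | mul r s =>
    rw [augS_xS_mul, zero_smul, sub_zero, mul_smul]
    exact smul_mem_mS e F r _
  | add s t hs ht =>
    rw [map_add, add_smul, add_smul, add_sub_add_comm]
    exact add_mem hs ht

include e in
theorem sub_reduce_mem_mS (m : F.carrier) : m - b.reduce augS m ∈ mS e F := by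
  induction m using b.induction with
  | smul s i =>
    rw [b.reduce_smul, b.reduce_basis]
    exact smul_sub_aug_mem_mS e s _
  | zero => rw [map_zero, sub_zero]; exact zero_mem _
  | add x y hx hy => rw [map_add, add_sub_add_comm]; exact add_mem hx hy

theorem reduce_eq_zero_iff (m : F.carrier) : b.reduce augS m = 0 ↔ m ∈ mS e F := by
  constructor
  · intro h
    have := sub_reduce_mem_mS e b m
    rwa [h, sub_zero] at this
  · intro h
    refine mS_le e (N := LinearMap.ker (b.reduce augS)) (fun r z => ?_) h
    have : augS (xS e r) = 0 := augS_of_mem one_ne_zero (xS_mem e r)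
    rw [LinearMap.mem_ker, b.reduce_smul, this, zero_smul]

/-- The part of degree one of the coefficients. -/
def linCoef : F.carrier →ₗ[K] F.carrier :=
  b.coefMap (proj (symGrading_isInternal K (Module.Dual K V)) 1)

theorem linCoef_xS_smul (r : Fin v) (z : F.carrier) :
    linCoef b (xS e r • z) = xS e r • b.reduce augS z := by
  induction z using b.induction with
  | smul s i =>
    rw [smul_smul, linCoef, b.coefMap_smul, proj_one_xS_mul, b.reduce_smul, b.reduce_basis,
      mul_smul, algebraMap_smul]
  | zero => simp
  | add x y hx hy => simp only [smul_add, map_add, hx, hy]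

-- The coefficients of an element of `mS` have no constant term, so in degree one only the constant
-- term of `s` contributes.
include e in
theorem linCoef_smul {z : F.carrier} (hz : z ∈ mS e F) (s : S K V) :
    linCoef b (s • z) = augS s • linCoef b z := by
  refine mS_le e (N := LinearMap.eqLocus (linCoef b ∘ₗ Algebra.lsmul K K F.carrier s)
    (augS s • linCoef b)) (fun r z => ?_) hz
  rw [LinearMap.mem_eqLocus, LinearMap.comp_apply, Algebra.lsmul_coe, LinearMap.smul_apply]
  beta_reduce
  rw [smul_comm s, linCoef_xS_smul, linCoef_xS_smul, b.reduce_smul, smul_comm (xS e r)]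

-- Minimality puts `d` of a basis vector in `mS`, so on both sides a coefficient acts only through
-- its constant term. This leaves basis vectors, for which the linear part consists of the entries
-- of degree one.
include e in
theorem linearPart_reduce (hF : F.IsMinimal) (m : F.carrier) :
    b.linearPart (b.reduce augS m) = linCoef b (F.d m) := by
  induction m using b.induction with
  | smul s i =>
    have hd : F.d (b.basis i) ∈ mS e F := by
      rw [← reduce_eq_zero_iff e b]
      exact b.reduce_d (fun s hs a ha => augS_of_mem hs ha) hF _
    rw [b.reduce_smul, b.reduce_basis, LinearMap.map_smul_of_tower, map_smul, linCoef_smul e b hd]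
    congr 1
    exact b.linearPart_basis _ (fun s hs a ha => augS_of_mem hs ha)
      (fun a ha => algebraMap_augS ha) hF (n := 1) rfl (symGrading_neg (by norm_num)) i
  | zero => simp
  | add x y hx hy => simp only [map_add, hx, hy]

/-- The homology of `R(F)`. -/
abbrev RH (F : SComplex K V) : Type u := (R e F).HomologyModule

/-- The homology class of a cycle of `R(F)`. -/
def Rcls (F : SComplex K V) (α : HomE K V F.carrier) (hα : Rd e F α = 0) : RH e F :=
  (R e F).cls α hα

theorem exists_Rcls (F : SComplex K V) (h : RH e F) : ∃ α hα, Rcls e F α hα = h :=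
  (R e F).exists_cls h

theorem exists_Rcls_of_mem (F : SComplex K V) {i j : ℤ} {h : RH e F}
    (hh : h ∈ (R e F).homologyDeg i j) : ∃ α hα, Rcls e F α hα = h ∧ α ∈ RDeg F i j :=
  (R e F).exists_cls_of_mem hh

theorem Rsign_cycle {α : HomE K V F.carrier} (hα : Rd e F α = 0) : Rd e F (Rsign e F α) = 0 :=
  (R e F).d_sign_eq_zero hα

theorem Rcls_smul (a : E K V) {α : HomE K V F.carrier} (hα : Rd e F α = 0)
    (h : Rd e F (a • α) = 0) : a • Rcls e F α hα = Rcls e F (a • α) h :=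
  ((R e F).cls_smul a hα h).symm

theorem Rcls_sign {α : HomE K V F.carrier} (hα : Rd e F α = 0) :
    (R e F).homologySign (Rcls e F α hα) = Rcls e F (Rsign e F α) (Rsign_cycle e hα) :=
  (R e F).homologySign_cls hα

/-- The reduction of the value at `1`. -/
def evOne : HomE K V F.carrier →ₗ[K] F.carrier where
  toFun α := b.reduce augS (F.twist (α 1))
  map_add' α β := by rw [HomE.add_apply, map_add, map_add]
  map_smul' c α := by rw [HomE.smulK_apply, map_smul, map_smul, RingHom.id_apply]

theorem evOne_eq_zero_iff (α : HomE K V F.carrier) : evOne b α = 0 ↔ α 1 ∈ mS e F := by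
  refine (reduce_eq_zero_iff e b _).trans ⟨fun h => ?_, twist_mem_mS e⟩
  rw [← F.twist_twist (α 1)]
  exact twist_mem_mS e h

theorem evOne_Rd (hF : F.IsMinimal) (α : HomE K V F.carrier) : evOne b (Rd e F α) = 0 := by
  rw [evOne_eq_zero_iff e, Rd_apply]
  refine add_mem ?_ (Submodule.sum_mem _ fun r _ => ?_)
  · rw [← reduce_eq_zero_iff e b]
    exact b.reduce_d (fun s hs a ha => augS_of_mem hs ha) hF _
  · rw [F.sign_smul (xS_mem e r)]
    exact smul_mem_mS e F r _

variable (hF : F.IsMinimal)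

/-- The reduction of the value at `1` of the homology classes of `R(F)`. -/
def evHomology : RH e F →ₗ[K] F.carrier := (R e F).homologyLift (evOne b) (evOne_Rd e b hF)

theorem evHomology_cls (α : HomE K V F.carrier) (hα : Rd e F α = 0) :
    evHomology e b hF (Rcls e F α hα) = evOne b α := rfl

/-- A cycle whose value at `1` lies in `mS` bounds, by `exists_R_boundary`. -/
theorem evHomology_injective : Function.Injective (evHomology e b hF) := by
  rw [← LinearMap.ker_eq_bot, LinearMap.ker_eq_bot']
  intro h hh
  obtain ⟨α, hα, rfl⟩ := exists_Rcls e F h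
  rw [evHomology_cls, evOne_eq_zero_iff e] at hh
  obtain ⟨β, -, hβ⟩ := exists_R_boundary e b α hα hh
  exact ((R e F).homologyClass_eq_zero_iff ⟨α, hα⟩).2 ⟨β, hβ⟩

theorem evOne_cst (y : F.carrier) : evOne b (cst y) = b.reduce augS (F.twist y) := by
  change b.reduce augS (F.twist ((cst y : HomE K V F.carrier) 1)) = _
  rw [cst_apply, map_one augE, one_smul]

-- The map `cst y` has boundary `cst (d y)`, and `d y` lies in `mS` by minimality. So
-- `exists_R_boundary` provides `β` with the same boundary and with `β 1` in `mS`, and `cst y - β`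
-- is a cycle with the reduction of `cst y`.
include hF in
theorem exists_cycle_evOne_eq (i : b.index) : ∃ α, Rd e F α = 0 ∧ evOne b α = b.basis i := by
  obtain ⟨y, hy⟩ : ∃ y, F.twist y = b.basis i := ⟨_, F.twist_twist _⟩
  have h0 : F.d y ∈ mS e F := by
    rw [← reduce_eq_zero_iff e b]
    exact b.reduce_d (fun s hs a ha => augS_of_mem hs ha) hF _
  have h1 : Rd e F (cst (F.d y)) = 0 := by
    rw [Rd_cst, F.d_d]
    exact HomE.ext fun a => smul_zero _
  have h2 : (cst (F.d y) : HomE K V F.carrier) 1 ∈ mS e F := by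
    rw [cst_apply, map_one augE, one_smul]
    exact h0
  obtain ⟨β, hβ, hβ'⟩ := exists_R_boundary e b _ h1 h2
  refine ⟨cst y - β, ?_, ?_⟩
  · rw [map_sub, hβ', Rd_cst, sub_self]
  · rw [map_sub, (evOne_eq_zero_iff e b β).2 hβ, sub_zero, evOne_cst, hy, b.reduce_basis]

theorem exists_evHomology_eq (i : b.index) : ∃ h, evHomology e b hF h = b.basis i := by
  obtain ⟨α, hα, h⟩ := exists_cycle_evOne_eq e b hF i
  exact ⟨Rcls e F α hα, h⟩

theorem evHomology_mem_span (h : RH e F) :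
    evHomology e b hF h ∈ Submodule.span K (Set.range b.basis) := by
  obtain ⟨α, hα, rfl⟩ := exists_Rcls e F h
  exact b.reduce_mem_span augS _

/-- The classes in the homology of `R(F)` that correspond to the basis of `F`. -/
def homologyBasisFun (i : b.index) : RH e F := (exists_evHomology_eq e b hF i).choose

theorem evHomology_homologyBasisFun (i : b.index) :
    evHomology e b hF (homologyBasisFun e b hF i) = b.basis i :=
  (exists_evHomology_eq e b hF i).choose_spec

theorem linearIndependent_field : LinearIndependent K b.basis :=
  b.basis.linearIndependent.restrict_scalars (by
    intro c d h
    have h1 : algebraMap K (S K V) c = algebraMap K (S K V) d := by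
      rw [Algebra.algebraMap_eq_smul_one, Algebra.algebraMap_eq_smul_one]; exact h
    have h2 := congrArg augS h1
    rwa [AlgHom.commutes, AlgHom.commutes] at h2)

/-- The basis of the homology of `R(F)` that corresponds to the basis of `F`. -/
def homologyBasis : Module.Basis b.index K (RH e F) :=
  Module.Basis.mk (v := homologyBasisFun e b hF)
    (LinearIndependent.of_comp (evHomology e b hF) (by
      have : ⇑(evHomology e b hF) ∘ homologyBasisFun e b hF = b.basis :=
        funext (evHomology_homologyBasisFun e b hF)
      rw [this]
      exact linearIndependent_field b)) (by
    rintro h -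
    have h1 := evHomology_mem_span e b hF h
    have h2 : Set.range b.basis = evHomology e b hF '' Set.range (homologyBasisFun e b hF) := by
      rw [← Set.range_comp]
      exact congrArg Set.range (funext (evHomology_homologyBasisFun e b hF)).symm
    rw [h2, ← Submodule.map_span] at h1
    obtain ⟨h', hh', h3⟩ := h1
    rwa [← evHomology_injective e b hF h3])

theorem homologyBasis_apply (i : b.index) :
    homologyBasis e b hF i = homologyBasisFun e b hF i := by
  rw [homologyBasis, Module.Basis.mk_apply]

/-- The isomorphism of `S ⊗ H(R(F))` with `F`. -/
def linearPartEquiv : S K V ⊗[K] RH e F ≃ₗ[S K V] F.carrier :=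
  (Algebra.TensorProduct.basis (S K V) (homologyBasis e b hF)).equiv b.basis (Equiv.refl _)

theorem linearPartEquiv_tmul (s : S K V) (h : RH e F) :
    linearPartEquiv e b hF (s ⊗ₜ h) = s • evHomology e b hF h := by
  have h1 : (linearPartEquiv e b hF).toLinearMap =
      LinearMap.liftBaseChange (S K V) (evHomology e b hF) := by
    refine (Algebra.TensorProduct.basis (S K V) (homologyBasis e b hF)).ext fun i => ?_
    rw [LinearEquiv.coe_coe, linearPartEquiv, Module.Basis.equiv_apply, Equiv.refl_apply,
      Algebra.TensorProduct.basis_apply, LinearMap.liftBaseChange_tmul, one_smul,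
      homologyBasis_apply, evHomology_homologyBasisFun]
  have h2 := LinearMap.congr_fun h1 (s ⊗ₜ h)
  rwa [LinearMap.liftBaseChange_tmul] at h2

theorem linearPartEquiv_mem {k t : ℤ} {x : S K V ⊗[K] RH e F}
    (hx : x ∈ LDeg (R e F).homology k t) : linearPartEquiv e b hF x ∈ F.deg k t := by
  refine LDeg_le (R e F).homology
    (N := (F.deg k t).comap ((linearPartEquiv e b hF).toLinearMap.restrictScalars K)) ?_ hx
  intro a i j hk ht s hs h hh
  obtain ⟨α, hα, rfl, hm⟩ := exists_Rcls_of_mem e F hh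
  have h1 : linearPartEquiv e b hF (s ⊗ₜ[K] Rcls e F α hα) ∈ F.deg k t := by
    rw [linearPartEquiv_tmul, evHomology_cls]
    have h2 := F.smul_mem hs (b.reduce_mem (symGrading_isInternal K (Module.Dual K V))
      (fun s hs a ha => augS_of_mem hs ha) (fun a ha => algebraMap_augS ha)
      (F.twist_mem (hm 0 1 one_mem_extGrading)))
    rw [zero_add, hk, ht] at h2
    exact h2
  exact h1

/-- The differential of `L(H(R(F)))`. -/
def LHRd (F : SComplex K V) : S K V ⊗[K] RH e F →ₗ[S K V] S K V ⊗[K] RH e F :=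
  Ld e (R e F).homology

theorem LHRd_tmul (s : S K V) (h : RH e F) :
    LHRd e F (s ⊗ₜ h) = ∑ r, (xS e r * s) ⊗ₜ[K] (R e F).homologySign (eE e r • h) := by
  refine (Ld_tmul e (R e F).homology s h).trans ?_
  refine (congrArg (fun z => z + _) (TensorProduct.tmul_zero _ s)).trans (zero_add _)

/-- The cycle condition at `1` expresses `d (α 1)` through the elements `x_r α(e_r)`, and `α(e_r)`
is the value of `e_r α` at `1`. Thus the linear entries of `d` are given by the action of the `e_r`
on homology; `counit_sign` matches the signs. -/
theorem linearPart_linearPartEquiv (x : S K V ⊗[K] RH e F) :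
    b.linearPart (linearPartEquiv e b hF x) = linearPartEquiv e b hF (LHRd e F x) := by
  induction x using TensorProduct.induction_on with
  | zero => simp
  | add x y hx hy => simp only [map_add, hx, hy]
  | tmul s h =>
    obtain ⟨α, hα, rfl⟩ := exists_Rcls e F h
    have h1 : ∀ r, evHomology e b hF ((R e F).homologySign (eE e r • Rcls e F α hα)) =
        b.reduce augS (F.twist (Rsign e F (eE e r • α) 1)) := by
      intro r
      have h2 : Rd e F (eE e r • α) = 0 := by rw [map_smul, hα, smul_zero]
      rw [Rcls_smul e (eE e r) hα h2, Rcls_sign e h2]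
      rfl
    rw [linearPartEquiv_tmul, LHRd_tmul, map_sum, map_smul, evHomology_cls]
    simp only [linearPartEquiv_tmul, h1]
    have h3 : b.linearPart (evOne b α) = linCoef b (F.d (F.twist (α 1))) :=
      linearPart_reduce e b hF _
    have h4 : Rd e F α 1 = 0 := by rw [hα, HomE.zero_apply]
    rw [Rd_apply] at h4
    have h5 : F.d (F.twist (α 1)) =
        ∑ r, xS e r • F.twist (Rsign e F (eE e r • α) 1) := by
      rw [← F.twist_d, eq_neg_of_add_eq_zero_left h4, map_neg, map_sum, ← Finset.sum_neg_distrib]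
      refine Finset.sum_congr rfl fun r _ => ?_
      rw [mul_one]
      exact neg_eq_of_add_eq_zero_right (counit_sign e F r α)
    rw [h3, h5, map_sum, Finset.smul_sum]
    refine Finset.sum_congr rfl fun r _ => ?_
    rw [linCoef_xS_smul, mul_comm, mul_smul]

/-- The linear part of a minimal free complex `F` is isomorphic to `L(H(R(F)))`. -/
theorem linearPartIso_L (hF : F.IsMinimal) : b.LinearPartIso (L e (R e F).homology) := by
  refine ⟨(linearPartEquiv e b hF).symm, fun i j m => ?_, fun m => ?_⟩
  · obtain ⟨x, rfl⟩ := (linearPartEquiv e b hF).surjective m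
    have h : (linearPartEquiv e b hF).symm (linearPartEquiv e b hF x) = x :=
      (linearPartEquiv e b hF).symm_apply_apply x
    refine Iff.trans ?_ (iff_of_eq (congrArg (· ∈ LDeg (R e F).homology i j) h.symm))
    exact ⟨fun hm => mem_of_map_mem (i := (i, j)) (LDeg_isInternal (R e F).homology) F.internal
      ((linearPartEquiv e b hF).toLinearMap.restrictScalars K)
      (fun _ _ hm => linearPartEquiv_mem e b hF hm) (linearPartEquiv e b hF).injective hm,
      linearPartEquiv_mem e b hF⟩
  · obtain ⟨x, rfl⟩ := (linearPartEquiv e b hF).surjective m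
    rw [linearPart_linearPartEquiv]
    refine ((linearPartEquiv e b hF).symm_apply_apply _).trans ?_
    exact congrArg (LHRd e F) ((linearPartEquiv e b hF).symm_apply_apply x).symm

/-- The linear part of a minimal free resolution of `M` is isomorphic to `L(H(R(M)))`. -/
theorem IsFreeResolution.linearPartIso {M : SComplex K V} (h : F.IsFreeResolution M)
    (hF : F.IsMinimal) : b.LinearPartIso (L e (R e M).homology) := by
  obtain ⟨-, f, hf⟩ := h
  -- This identifies the graded `E`-modules H(R(F)) and H(R(M)), and `L` turns the identification
  -- into one of complexes.
  have h1 : (Rmap e f).IsQuasiIso := Rmap_isQuasiIso e hf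
  exact (linearPartIso_L e b hF).comp (Lmap e (Rmap e f).homology) (Lmap_bijective e h1)

end LinearPartS

/-! ### The socle of the exterior algebra -/

section Socle

variable {K : Type u} [Field K] {V : Type u} [AddCommGroup V] [Module K V]
  {v : ℕ} (e : Module.Basis (Fin v) K V)

/-- The product of basis vectors. -/
def eProd (l : List (Fin v)) : E K V := (l.map (eE e)).prod

theorem eProd_cons (r : Fin v) (l : List (Fin v)) : eProd e (r :: l) = eE e r * eProd e l := by
  simp [eProd]

theorem eProd_mem (l : List (Fin v)) : eProd e l ∈ extGrading K V (-(l.length : ℤ)) := by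
  induction l with
  | nil => simpa [eProd] using one_mem_extGrading
  | cons r l ih =>
    have h := mul_mem_extGrading K V (eE_mem e r) ih
    rw [eProd_cons, List.length_cons]
    convert h using 2
    push_cast
    ring

theorem eE_mul_eProd {r : Fin v} {l : List (Fin v)} (h : r ∈ l) : eE e r * eProd e l = 0 := by
  induction l with
  | nil => simp at h
  | cons q l ih =>
    rw [eProd_cons]
    by_cases hq : r = q
    · subst hq
      rw [← mul_assoc, eE_mul_self, zero_mul]
    · rw [← mul_assoc, eE_swap, neg_mul, mul_assoc, ih ((List.mem_cons.1 h).resolve_left hq),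
        mul_zero, neg_zero]

theorem exists_eProd_mul_eE (r : Fin v) (l : List (Fin v)) :
    ∃ y, eProd e l * eE e r = eE e r * y := by
  induction l with
  | nil => exact ⟨1, by simp [eProd]⟩
  | cons q l ih =>
    obtain ⟨y, hy⟩ := ih
    exact ⟨-(eE e q * y), by rw [eProd_cons, mul_assoc, hy, ← mul_assoc, eE_swap, neg_mul,
      mul_assoc, mul_neg]⟩

theorem eProd_mul_eE {r : Fin v} {l : List (Fin v)} (h : r ∈ l) : eProd e l * eE e r = 0 := by
  induction l with
  | nil => simp at h
  | cons q l ih =>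
    rw [eProd_cons, mul_assoc]
    by_cases hl : r ∈ l
    · rw [ih hl, mul_zero]
    · obtain rfl := (List.mem_cons.1 h).resolve_right hl
      obtain ⟨y, hy⟩ := exists_eProd_mul_eE e r l
      rw [hy, ← mul_assoc, eE_mul_self, zero_mul]

theorem exists_conE_eProd_mul {r : Fin v} {l : List (Fin v)} (h : r ∉ l) (a : E K V) :
    ∃ y, conE e r (eProd e l * a) = eProd e l * y := by
  induction l generalizing a with
  | nil => exact ⟨conE e r a, by simp [eProd]⟩
  | cons q l ih =>
    rw [List.mem_cons, not_or] at h
    obtain ⟨y, hy⟩ := ih h.2 a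
    refine ⟨-y, ?_⟩
    rw [eProd_cons, mul_assoc, conE_mul_ne e (fun h' => h.1 h'.symm), hy, mul_neg, mul_assoc]

/-- Contracting `e_r c = 0` gives `c = e_r` times the contraction of `c`. The contraction passes the
factors already split off, so `e_r` is split off in addition to them. -/
theorem exists_eq_eProd_mul {c : E K V} (hc : ∀ r, eE e r * c = 0) {l : List (Fin v)}
    (hl : l.Nodup) : ∃ y, c = eProd e l * y := by
  induction l with
  | nil => exact ⟨c, by simp [eProd]⟩
  | cons r l ih =>
    obtain ⟨hr, hl⟩ := List.nodup_cons.1 hl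
    obtain ⟨y, hy⟩ := ih hl
    obtain ⟨z, hz⟩ := exists_conE_eProd_mul e hr y
    refine ⟨z, ?_⟩
    have h := conE_mul_same e r c
    rw [hc r, map_zero, eq_comm, sub_eq_zero] at h
    rw [h]
    conv_lhs => rw [hy, hz]
    rw [eProd_cons, mul_assoc]

/-- The generator of the socle of the exterior algebra. -/
def topE : E K V := eProd e (List.finRange v)

theorem topE_mem : topE e ∈ extGrading K V (-(v : ℤ)) := by
  have := eProd_mem e (List.finRange v)
  rwa [List.length_finRange] at this

theorem eE_mul_topE (r : Fin v) : eE e r * topE e = 0 := eE_mul_eProd e (List.mem_finRange r)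

theorem topE_mul_eE (r : Fin v) : topE e * eE e r = 0 := eProd_mul_eE e (List.mem_finRange r)

theorem topE_mul (a : E K V) : topE e * a = augE a • topE e := by
  induction a using E_induction e with
  | one c =>
    rw [AlgHom.commutes, Algebra.algebraMap_self_apply, Algebra.algebraMap_eq_smul_one,
      mul_smul_comm, mul_one]
  | mul r a => rw [augE_eE_mul, ← mul_assoc, topE_mul_eE, zero_mul, zero_smul]
  | add a c ha hc => rw [mul_add, map_add, add_smul, ha, hc]

theorem exists_eq_smul_topE {c : E K V} (hc : ∀ r, eE e r * c = 0) : ∃ k : K, c = k • topE e := by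
  obtain ⟨y, hy⟩ := exists_eq_eProd_mul e hc (List.nodup_finRange v)
  exact ⟨augE y, hy.trans (topE_mul e y)⟩

/-- An element killed by all `e_r` is a multiple of `topE`. If that were never reached,
multiplication by suitable `e_r` could go on forever without giving zero, but `E` vanishes in very
negative degrees. -/
theorem exists_mul_eq_smul_topE {c : E K V} (hc : c ≠ 0) :
    ∃ n : ℕ, ∃ a ∈ extGrading K V (-(n : ℤ)), ∃ k : K, a * c = k • topE e ∧ a * c ≠ 0 := by
  by_contra! h
  have key : ∀ n : ℕ, ∃ a ∈ extGrading K V (-(n : ℤ)), a * c ≠ 0 := by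
    intro n
    induction n with
    | zero => exact ⟨1, by simpa using one_mem_extGrading, by rwa [one_mul]⟩
    | succ n ih =>
      obtain ⟨a, ha, hac⟩ := ih
      have h1 : ∃ r, eE e r * (a * c) ≠ 0 := by
        by_contra! h2
        obtain ⟨k, hk⟩ := exists_eq_smul_topE e h2
        exact hac (h n a ha k hk)
      obtain ⟨r, hr⟩ := h1
      refine ⟨eE e r * a, ?_, by rwa [mul_assoc]⟩
      have := mul_mem_extGrading K V (eE_mem e r) ha
      convert this using 2
      push_cast
      ring
  obtain ⟨p, hp⟩ := exists_extGrading_eq_bot e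
  obtain ⟨a, ha, hac⟩ := key p
  rw [hp _ le_rfl, Submodule.mem_bot] at ha
  exact hac (by rw [ha, zero_mul])

theorem topE_ne_zero : topE e ≠ 0 := by
  obtain ⟨n, a, -, k, hk, h0⟩ := exists_mul_eq_smul_topE e (one_ne_zero (α := E K V))
  intro h
  rw [hk, h, smul_zero] at h0
  exact h0 rfl

-- A nonzero element of degree `s` has a nonzero multiple in degree `-v`, and multiplication never
-- raises the degree.
include e in
theorem extGrading_eq_bot {s : ℤ} (hs : s < -(v : ℤ)) : extGrading K V s = ⊥ := by
  rw [eq_bot_iff]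
  intro c hc
  rw [Submodule.mem_bot]
  by_contra h0
  obtain ⟨n, a, ha, k, hk, h1⟩ := exists_mul_eq_smul_topE e h0
  have h2 := mul_mem_extGrading K V ha hc
  have h3 : a * c ∈ extGrading K V (-(v : ℤ)) := by
    rw [hk]
    exact Submodule.smul_mem _ _ (topE_mem e)
  have h4 := proj_same (extGrading_isInternal K V) h3
  rw [proj_ne (extGrading_isInternal K V) h2 (by omega)] at h4
  exact h1 h4.symm

theorem exists_eq_smul_topE_of_mem {c : E K V} (hc : c ∈ extGrading K V (-(v : ℤ))) :
    ∃ k : K, c = k • topE e := by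
  refine exists_eq_smul_topE e fun r => ?_
  have h := mul_mem_extGrading K V (eE_mem e r) hc
  rwa [extGrading_eq_bot e (by omega), Submodule.mem_bot] at h

/-- The projection of the exterior algebra onto its socle. -/
def projTop (K V : Type u) [Field K] [AddCommGroup V] [Module K V] (v : ℕ) : E K V →ₗ[K] E K V :=
  proj (extGrading_isInternal K V) (-(v : ℤ))

theorem exists_functional : ∃ ω : E K V →ₗ[K] K, ∀ a, projTop K V v a = ω a • topE e := by
  obtain ⟨f, hf⟩ := (LinearMap.toSpanSingleton K (E K V) (topE e)).exists_leftInverse_of_injective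
    (LinearMap.ker_toSpanSingleton K (topE_ne_zero e))
  refine ⟨f ∘ₗ projTop K V v, fun a => ?_⟩
  obtain ⟨k, hk⟩ := exists_eq_smul_topE_of_mem e
    (proj_mem (extGrading_isInternal K V) (-(v : ℤ)) a)
  rw [LinearMap.comp_apply, projTop, hk]
  have := LinearMap.congr_fun hf k
  rw [LinearMap.comp_apply, LinearMap.toSpanSingleton_apply, LinearMap.id_apply] at this
  rw [this]

/-- A functional on the exterior algebra that gives the coefficient of the generator of the
socle. -/
def ω : E K V →ₗ[K] K := (exists_functional e).choose

theorem projTop_eq (a : E K V) : projTop K V v a = ω e a • topE e :=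
  (exists_functional e).choose_spec a

theorem projTop_topE : projTop K V v (topE e) = topE e := proj_same _ (topE_mem e)

theorem ω_topE : ω e (topE e) = 1 := by
  have h := projTop_eq e (topE e)
  rw [projTop_topE] at h
  have h2 : (ω e (topE e) - 1) • topE e = 0 := by rw [sub_smul, one_smul, ← h, sub_self]
  exact sub_eq_zero.1 ((smul_eq_zero.1 h2).resolve_right (topE_ne_zero e))

/-- A nonzero `c` can be multiplied up to a nonzero multiple of `topE`, where `ω` does not vanish.
This nondegeneracy is the Frobenius property of `E`. -/
theorem eq_zero_of_ω_mul {c : E K V} (h : ∀ a, ω e (a * c) = 0) : c = 0 := by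
  by_contra h0
  obtain ⟨n, a, -, k, hk, h1⟩ := exists_mul_eq_smul_topE e h0
  have h2 := h a
  rw [hk, map_smul, ω_topE, smul_eq_mul, mul_one] at h2
  rw [hk, h2, zero_smul] at h1
  exact h1 rfl

/-- Every functional on the exterior algebra is `a ↦ ω (a c)` for some `c`. -/
theorem exists_eq_ω_mul (f : E K V →ₗ[K] K) : ∃ c, ∀ a, f a = ω e (a * c) := by
  have := E_finite e
  let T : E K V →ₗ[K] Module.Dual K (E K V) :=
    LinearMap.compr₂ (LinearMap.mul K (E K V)).flip (ω e)
  have hT : Function.Injective T := by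
    rw [← LinearMap.ker_eq_bot, LinearMap.ker_eq_bot']
    intro c hc
    exact eq_zero_of_ω_mul e fun a => LinearMap.congr_fun hc a
  -- `E` and its dual have the same finite dimension, so nondegeneracy implies surjectivity.
  obtain ⟨c, hc⟩ := (LinearMap.injective_iff_surjective_of_finrank_eq_finrank
    (Subspace.dual_finrank_eq (K := K) (V := E K V)).symm).1 hT f
  exact ⟨c, fun a => (LinearMap.congr_fun hc a).symm⟩

theorem algebraMap_augE {a : E K V} (ha : a ∈ extGrading K V 0) : algebraMap K _ (augE a) = a := by
  have := extGrading_neg_natCast K V 0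
  rw [Nat.cast_zero, neg_zero, ExteriorAlgebra.exteriorPower, pow_zero] at this
  rw [this, Submodule.mem_one] at ha
  obtain ⟨c, rfl⟩ := ha
  rw [AlgHom.commutes, Algebra.algebraMap_self_apply]

/-! ### The socle of a free complex -/

variable {I : EComplex K V} (b : I.HomogeneousBasis)

theorem isClifford_coefMap : IsClifford e I fun r => b.coefMap (conE e r) where
  same r m := by
    induction m using b.induction with
    | smul a i => rw [smul_smul, b.coefMap_smul, b.coefMap_smul, conE_mul_same, sub_smul, mul_smul]
    | zero => simp
    | add x y hx hy =>
      simp only [smul_add, map_add, hx, hy]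
      abel
  ne q r h m := by
    induction m using b.induction with
    | smul a i =>
      rw [smul_smul, b.coefMap_smul, b.coefMap_smul, conE_mul_ne e h, neg_smul, mul_smul]
    | zero => simp
    | add x y hx hy =>
      simp only [smul_add, map_add, hx, hy, neg_add]
  sign r m := b.sign_coefMap (extGrading_isInternal K V) _ m

/-- The projection of a free complex onto its socle. -/
def socProj : I.carrier →ₗ[K] I.carrier := b.coefMap (projTop K V v)

theorem eE_mul_projTop (r : Fin v) (a : E K V) : eE e r * projTop K V v a = 0 := by
  rw [projTop_eq e, mul_smul_comm, eE_mul_topE, smul_zero]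

theorem socProj_mem (m : I.carrier) : socProj (v := v) b m ∈ soc e I := by
  rw [mem_soc]
  intro r
  induction m using b.induction with
  | smul a i => rw [socProj, b.coefMap_smul, smul_smul, eE_mul_projTop, zero_smul]
  | zero => simp
  | add x y hx hy => rw [map_add, smul_add, hx, hy, add_zero]

theorem projTop_of_soc {c : E K V} (hc : ∀ r, eE e r * c = 0) : projTop K V v c = c := by
  obtain ⟨k, rfl⟩ := exists_eq_smul_topE e hc
  rw [map_smul, projTop_topE]

theorem repr_of_mem_soc {g : I.carrier} (hg : g ∈ soc e I) (i : b.index) (r : Fin v) :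
    eE e r * b.basis.repr g i = 0 := by
  have h := congrArg (fun z => b.basis.repr z i) ((mem_soc e).1 hg r)
  simpa using h

theorem topE_smul (m : I.carrier) : topE e • m = topE e • b.reduce augE m := by
  induction m using b.induction with
  | smul a i => rw [b.reduce_smul, b.reduce_basis, smul_smul, topE_mul, smul_assoc, smul_comm]
  | zero => simp
  | add x y hx hy => simp only [map_add, smul_add, hx, hy]

theorem exists_eq_topE_smul {g : I.carrier} (hg : g ∈ soc e I) :
    ∃ n ∈ Submodule.span K (Set.range b.basis), g = topE e • n := by
  refine ⟨b.coefMap (Algebra.linearMap K (E K V) ∘ₗ ω e) g, ?_, ?_⟩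
  · rw [b.coefMap_eq_sum]
    refine Submodule.sum_mem _ fun i _ => ?_
    beta_reduce
    rw [LinearMap.comp_apply, Algebra.linearMap_apply, algebraMap_smul]
    exact Submodule.smul_mem _ _ (Submodule.subset_span ⟨i, rfl⟩)
  · refine b.basis.repr.injective (Finsupp.ext fun i => ?_)
    rw [map_smul, Finsupp.smul_apply, b.repr_coefMap, LinearMap.comp_apply,
      Algebra.linearMap_apply, smul_eq_mul, ← Algebra.commutes, ← Algebra.smul_def, ← projTop_eq,
      projTop_of_soc e (repr_of_mem_soc e b hg i)]

-- An element of the socle is `topE` times a combination of basis vectors, and `topE` kills the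
-- maximal ideal, where minimality puts the entries of `d`.
include b in
theorem d_of_mem_soc (hI : I.IsMinimal) {g : I.carrier} (hg : g ∈ soc e I) : I.d g = 0 := by
  obtain ⟨n, -, rfl⟩ := exists_eq_topE_smul e b hg
  rw [map_smul, topE_smul e b, b.reduce_d (fun s hs a ha => augE_of_mem hs ha) hI, smul_zero]

theorem socProj_smul (a : E K V) {n : I.carrier} (hn : n ∈ Submodule.span K (Set.range b.basis)) :
    socProj (v := v) b (a • n) = projTop K V v a • n := by
  induction hn using Submodule.span_induction with
  | mem n hn =>
    obtain ⟨i, rfl⟩ := hn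
    exact b.coefMap_smul _ a i
  | zero => simp
  | add x y _ _ hx hy => rw [smul_add, map_add, hx, hy, smul_add]
  | smul c x _ hx => rw [smul_comm a c, map_smul, hx, smul_comm]

theorem twist_mem_soc {g : I.carrier} (hg : g ∈ soc e I) : I.twist g ∈ soc e I := by
  rw [mem_soc] at hg ⊢
  intro r
  -- Since `e_r` lowers the internal degree by one, the twist before `e_r` becomes the shifted twist
  -- after it.
  let T : I.carrier →ₗ[K] I.carrier :=
    glue I.internal fun p => ((twistSign (p.2 + 1) : ℤˣ) : ℤ) • LinearMap.id
  have key : ∀ m, eE e r • I.twist m = T (eE e r • m) := by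
    intro m
    induction m using I.induction with
    | mem i j m hm =>
      rw [I.twist_apply hm, smul_comm]
      refine Eq.trans ?_ (glue_apply (i := (i, -1 + j)) I.internal _
        (I.smul_mem (eE_mem e r) hm)).symm
      rw [LinearMap.smul_apply, LinearMap.id_apply]
      congr 3
      ring
    | zero => simp
    | add x y hx hy => simp only [map_add, smul_add, hx, hy]
  rw [key, hg, map_zero]

end Socle

/-! ### Linear parts over the exterior algebra -/

section LinearPartE

variable {K : Type u} [Field K] {V : Type u} [AddCommGroup V] [Module K V]
  {v : ℕ} (e : Module.Basis (Fin v) K V)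

/-- The homology of `L(I)`. -/
abbrev LH (I : EComplex K V) : Type u := (L e I).HomologyModule

/-- The homology class of a cycle of `L(I)`. -/
def Lcls (I : EComplex K V) (x : S K V ⊗[K] I.carrier) (hx : Ld e I x = 0) : LH e I :=
  (L e I).cls x hx

theorem exists_Lcls (I : EComplex K V) (h : LH e I) : ∃ x hx, Lcls e I x hx = h :=
  (L e I).exists_cls h

section

variable {I : EComplex K V} {x y : S K V ⊗[K] I.carrier}

theorem Lcls_eq_iff (hx : Ld e I x = 0) (hy : Ld e I y = 0) :
    Lcls e I x hx = Lcls e I y hy ↔ ∃ z, Ld e I z = x - y :=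
  (L e I).cls_eq_iff hx hy

theorem Lcls_add (hx : Ld e I x = 0) (hy : Ld e I y = 0) (h : Ld e I (x + y) = 0) :
    Lcls e I (x + y) h = Lcls e I x hx + Lcls e I y hy :=
  (L e I).cls_add hx hy h

theorem Lcls_smul (s : S K V) (hx : Ld e I x = 0) (h : Ld e I (s • x) = 0) :
    s • Lcls e I x hx = Lcls e I (s • x) h :=
  ((L e I).cls_smul s hx h).symm

theorem Lsign_cycle (hx : Ld e I x = 0) : Ld e I (Lsign e I x) = 0 :=
  (L e I).d_sign_eq_zero hx

theorem Lcls_sign (hx : Ld e I x = 0) :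
    (L e I).homologySign (Lcls e I x hx) = Lcls e I (Lsign e I x) (Lsign_cycle e hx) :=
  (L e I).homologySign_cls hx

theorem Lcls_sum {κ : Type*} (T : Finset κ) (f : κ → S K V ⊗[K] I.carrier)
    (hf : ∀ k, Ld e I (f k) = 0) (h : Ld e I (∑ k ∈ T, f k) = 0) :
    ∑ k ∈ T, Lcls e I (f k) (hf k) = Lcls e I (∑ k ∈ T, f k) h := by
  have h1 : ∀ (T : Finset κ), ∃ h, ∑ k ∈ T, Lcls e I (f k) (hf k) = Lcls e I (∑ k ∈ T, f k) h := by
    classical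
    intro T
    induction T using Finset.induction_on with
    | empty => exact ⟨map_zero _, (map_zero (L e I).homologyClass).symm⟩
    | insert k T hk ih =>
      obtain ⟨h, ih⟩ := ih
      simp only [Finset.sum_insert hk]
      exact ⟨by rw [map_add, hf, h, add_zero], by rw [ih, ← Lcls_add]⟩
  exact (h1 T).choose_spec

end

variable {I : EComplex K V} (b : I.HomogeneousBasis) (hI : I.IsMinimal)

include b hI in
theorem Ld_one_twist {g : I.carrier} (hg : g ∈ soc e I) : Ld e I (1 ⊗ₜ I.twist g) = 0 := by
  rw [Ld_one_tmul e (twist_mem_soc e hg), d_of_mem_soc e b hI (twist_mem_soc e hg),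
    TensorProduct.tmul_zero]

/-- The map from the socle to the homology of `L(I)`. -/
def socHomology : soc e I →ₗ[K] LH e I where
  toFun g := Lcls e I (1 ⊗ₜ I.twist g) (Ld_one_twist e b hI g.2)
  map_add' g g' := by
    rw [← Lcls_add]
    · congr 1
      rw [Submodule.coe_add, map_add, TensorProduct.tmul_add]
    · rw [map_add, Ld_one_twist e b hI g.2, Ld_one_twist e b hI g'.2, add_zero]
  map_smul' c g := by
    rw [RingHom.id_apply, ← algebraMap_smul (S K V) c (Lcls e I _ _), Lcls_smul]
    · congr 1
      rw [Submodule.coe_smul, map_smul, algebraMap_smul, TensorProduct.tmul_smul]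
    · rw [map_smul, Ld_one_twist e b hI g.2, smul_zero]

include b hI in
theorem Ld_of_mem_socL {x : S K V ⊗[K] I.carrier} (hx : x ∈ socL e I) : Ld e I x = 0 := by
  obtain ⟨g, hg, rfl⟩ := hx
  rw [TensorProduct.mk_apply, Ld_one_tmul e hg, d_of_mem_soc e b hI hg, TensorProduct.tmul_zero]

/-- If `1 ⊗ twist g` is the boundary of `y`, then `exists_L_boundary` moves `y` by a boundary into
`socL`. By minimality the elements of `socL` are cycles, so the boundary of `y` is zero. -/
theorem socHomology_injective : Function.Injective (socHomology e b hI) := by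
  rw [← LinearMap.ker_eq_bot, LinearMap.ker_eq_bot']
  rintro ⟨g, hg⟩ h
  obtain ⟨y, hy⟩ : ∃ y, Ld e I y = 1 ⊗ₜ I.twist g :=
    ((L e I).homologyClass_eq_zero_iff ⟨_, Ld_one_twist e b hI hg⟩).1 h
  obtain ⟨z, hz⟩ := exists_L_boundary e (isClifford_coefMap e b) y (by
    rw [hy]
    exact ⟨I.twist g, twist_mem_soc e hg, rfl⟩)
  have h1 := Ld_of_mem_socL e b hI hz
  have h2 : Ld e I (Ld e I z) = 0 := (L e I).d_d z
  rw [map_sub, h2, sub_zero, hy] at h1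
  have h3 := congrArg (augL I) h1
  rw [augL_tmul, map_one, one_smul, map_zero] at h3
  refine Subtype.ext ?_
  change g = 0
  rw [← I.twist_twist g, h3, map_zero]

/-- For a cycle, `exists_L_boundary` gives a homologous element of `1 ⊗ soc`. -/
theorem socHomology_surjective : Function.Surjective (socHomology e b hI) := by
  intro h
  obtain ⟨x, hx, rfl⟩ := exists_Lcls e I h
  obtain ⟨y, g, hg, hy⟩ := exists_L_boundary e (isClifford_coefMap e b) x (by
    rw [hx]
    exact zero_mem _)
  refine ⟨⟨I.twist g, twist_mem_soc e hg⟩, ?_⟩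
  refine (Lcls_eq_iff e _ hx).2 ⟨-y, ?_⟩
  change _ = 1 ⊗ₜ I.twist (I.twist g) - x
  rw [I.twist_twist, map_neg, ← sub_eq_zero]
  rw [TensorProduct.mk_apply] at hy
  rw [hy]
  abel

/-- The comparison of `I` with `Hom_K(E, H(L(I)))`. -/
def linearPartMap : I.carrier →ₗ[E K V] HomE K V (LH e I) where
  toFun m := (socHomology e b hI ∘ₗ (socProj (v := v) b).codRestrict (soc e I) (socProj_mem e b) ∘ₗ
    (LinearMap.toSpanSingleton (E K V) I.carrier m).restrictScalars K : E K V →ₗ[K] LH e I)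
  map_add' m n := HomE.ext fun a => by
    change socHomology e b hI ((socProj (v := v) b).codRestrict (soc e I) (socProj_mem e b)
      (a • (m + n))) = socHomology e b hI ((socProj (v := v) b).codRestrict (soc e I)
        (socProj_mem e b) (a • m)) + socHomology e b hI ((socProj (v := v) b).codRestrict (soc e I)
        (socProj_mem e b) (a • n))
    rw [smul_add, map_add, map_add]
  map_smul' c m := HomE.ext fun a => by
    change socHomology e b hI ((socProj (v := v) b).codRestrict (soc e I) (socProj_mem e b)
      (a • c • m)) = socHomology e b hI ((socProj (v := v) b).codRestrict (soc e I)
        (socProj_mem e b) ((a * c) • m))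
    rw [mul_smul]

theorem linearPartMap_apply (m : I.carrier) (a : E K V) :
    linearPartMap e b hI m a = socHomology e b hI ⟨socProj (v := v) b (a • m), socProj_mem e b _⟩ :=
  rfl

/-- The coefficients of the socle projection of `a m` are `ω (a m_i)` times `topE`, and
nondegeneracy of `ω` recovers the coefficients `m_i` of `m`. -/
theorem linearPartMap_injective : Function.Injective (linearPartMap e b hI) := by
  rw [← LinearMap.ker_eq_bot, LinearMap.ker_eq_bot']
  intro m hm
  refine b.basis.repr.injective (Finsupp.ext fun i => ?_)
  rw [map_zero, Finsupp.zero_apply]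
  refine eq_zero_of_ω_mul e fun a => ?_
  have h1 : linearPartMap e b hI m a = 0 := by rw [hm, HomE.zero_apply]
  rw [linearPartMap_apply] at h1
  have h2 := congrArg Subtype.val (socHomology_injective e b hI (h1.trans (map_zero _).symm))
  change socProj (v := v) b (a • m) = 0 at h2
  have h3 := b.repr_coefMap (projTop K V v) (a • m) i
  rw [socProj] at h2
  rw [h2, map_zero, Finsupp.zero_apply, map_smul, Finsupp.smul_apply, smul_eq_mul,
    projTop_eq e, eq_comm] at h3
  exact (smul_eq_zero.1 h3).resolve_right (topE_ne_zero e)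

theorem linearPartMap_surjective : Function.Surjective (linearPartMap e b hI) := by
  intro β
  have := E_finite e
  let ε := Module.finBasis K (E K V)
  choose c hc using fun k => exists_eq_ω_mul e (ε.coord k)
  choose g hg using fun k => socHomology_surjective e b hI (β (ε k))
  choose n hn hgn using fun k => exists_eq_topE_smul e b (g k).2
  -- The `c k` are dual to the basis `ε`, in that `ω (ε l * c k)` is the Kronecker delta, and the
  -- socle element prescribed at `ε k` is `topE • n k`. So `ε l` times the sum has socle projection
  -- `topE • n l`.
  refine ⟨∑ k, c k • n k, ?_⟩
  refine LinearMap.ext_iff.1 (ε.ext (f₁ := (show E K V →ₗ[K] LH e I from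
    linearPartMap e b hI (∑ k, c k • n k))) (f₂ := (show E K V →ₗ[K] LH e I from β))
    fun l => ?_) |> HomE.ext
  refine (linearPartMap_apply e b hI _ (ε l)).trans ((congrArg _ ?_).trans (hg l))
  refine Subtype.ext ?_
  change socProj (v := v) b (ε l • ∑ k, c k • n k) = g l
  rw [Finset.smul_sum, map_sum, Finset.sum_eq_single l]
  · rw [smul_smul, socProj_smul b _ (hn l), projTop_eq e, ← hc, Module.Basis.coord_apply,
      Module.Basis.repr_self, Finsupp.single_eq_same, one_smul, hgn]
  · intro k _ hk
    rw [smul_smul, socProj_smul b _ (hn k), projTop_eq e, ← hc, Module.Basis.coord_apply,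
      Module.Basis.repr_self, Finsupp.single_eq_of_ne hk, zero_smul, zero_smul]
  · exact fun h => absurd (Finset.mem_univ l) h

theorem linearPartMap_mem {k t : ℤ} {m : I.carrier} (hm : m ∈ I.deg k t) :
    linearPartMap e b hI m ∈ RDeg (L e I).homology k t := by
  intro s a ha
  have h1 : socProj (v := v) b (a • m) ∈ I.deg k (s + t) := by
    have h := b.coefMap_mem (extGrading_isInternal K V) (φ := projTop K V v) 0 (fun p c hc => by
      rw [add_zero, projTop]
      by_cases hp : p = -(v : ℤ)
      · subst hp
        exact proj_mem _ _ _
      · rw [proj_ne _ hc hp]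
        exact zero_mem _) (I.smul_mem ha hm)
    rwa [add_zero] at h
  exact (L e I).cls_mem (Ld_one_twist e b hI (socProj_mem e b (a • m)))
    (tmul_mem_LDeg I one_mem_symGrading (I.twist_mem h1) rfl (zero_add _))

/-- The differential of `R(H(L(I)))`. -/
def RHLd (I : EComplex K V) : HomE K V (LH e I) →ₗ[E K V] HomE K V (LH e I) :=
  Rd e (L e I).homology

theorem RHLd_apply (β : HomE K V (LH e I)) (a : E K V) :
    RHLd e I β a = ∑ r, (L e I).homologySign (xS e r • β (eE e r * a)) := by
  refine (Rd_apply e (L e I).homology β a).trans ?_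
  exact zero_add _

include e in
/-- The linear part of the differential, up to elements that are killed by the projection onto the
socle. -/
theorem socProj_smul_linearPart (hI : I.IsMinimal) (j : b.index) {s : ℤ} {a : E K V}
    (ha : a ∈ extGrading K V s) :
    socProj (v := v) b (a • b.linearPart (b.basis j)) =
      if s = -(v : ℤ) + 1 then a • I.d (b.basis j) else 0 := by
  have haug : ∀ s ≠ 0, ∀ a ∈ extGrading K V s, augE a = 0 := fun s hs a ha => augE_of_mem hs ha
  rw [b.linearPart_basis (extGrading_isInternal K V) haug (fun a ha => algebraMap_augE ha) hI
    (n := -1) rfl (extGrading_pos (by norm_num))]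
  refine b.basis.repr.injective (Finsupp.ext fun i => ?_)
  rw [socProj, b.repr_coefMap, map_smul, Finsupp.smul_apply, b.repr_coefMap, smul_eq_mul]
  have h1 := proj_mem (extGrading_isInternal K V) (-1) (b.basis.repr (I.d (b.basis j)) i)
  split_ifs with hs
  · subst hs
    rw [map_smul, Finsupp.smul_apply, smul_eq_mul]
    have hmem := b.repr_mem (extGrading_isInternal K V) (I.d_mem (b.mem j)) i
    have h0 : augE (b.basis.repr (I.d (b.basis j)) i) = 0 := by
      have h2 := b.repr_coefMap (Algebra.linearMap K (E K V) ∘ₗ augE.toLinearMap)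
        (I.d (b.basis j)) i
      have h3 := b.reduce_d haug hI (b.basis j)
      rw [GrComplex.HomogeneousBasis.reduce] at h3
      rw [h3, map_zero, Finsupp.zero_apply, LinearMap.comp_apply, AlgHom.toLinearMap_apply,
        Algebra.linearMap_apply] at h2
      have h4 := congrArg augE h2
      rwa [map_zero, AlgHom.commutes, Algebra.algebraMap_self_apply, eq_comm] at h4
    clear h1
    generalize b.basis.repr (I.d (b.basis j)) i = c at hmem h0 ⊢
    generalize b.int j - b.int i = q at hmem
    -- Below degree `-1` the product with `a` falls below degree `-v` and vanishes; in degree `-1`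
    -- it lands in the socle; above `-1` the entry is zero, by minimality or because `E` has no
    -- positive degrees.
    rcases lt_trichotomy q (-1) with hq | hq | hq
    · rw [proj_ne _ hmem hq.ne, mul_zero, map_zero]
      have h := mul_mem_extGrading K V ha hmem
      rw [extGrading_eq_bot e (by omega), Submodule.mem_bot] at h
      exact h.symm
    · subst hq
      rw [proj_same _ hmem]
      have h := mul_mem_extGrading K V ha hmem
      rw [show -(v : ℤ) + 1 + -1 = -(v : ℤ) by ring] at h
      exact proj_same _ h
    · have hc : c = 0 := by
        by_cases hq0 : q = 0
        · subst hq0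
          rw [← algebraMap_augE hmem, h0, map_zero]
        · rwa [extGrading_pos (by omega), Submodule.mem_bot] at hmem
      rw [hc, map_zero, mul_zero, map_zero]
  · rw [map_zero, Finsupp.zero_apply]
    exact proj_ne _ (mul_mem_extGrading K V ha h1) (by omega)

-- The boundary of `1 ⊗ twist (a b_j)` consists of a term with `a d(b_j)` and of terms with `x_r ⊗
-- e_r a b_j`. If `a` has degree `-v + 1`, these are the two sides to be compared; in all other
-- degrees both socle projections vanish.
include hI in
theorem exists_boundary_linearPart (j : b.index) {s : ℤ} {a : E K V}
    (ha : a ∈ extGrading K V s) :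
    ∃ z, Ld e I z = 1 ⊗ₜ I.twist (socProj (v := v) b (a • b.linearPart (b.basis j))) -
      ∑ r, Lsign e I (xS e r ⊗ₜ I.twist (socProj (v := v) b ((eE e r * a) • b.basis j))) := by
  rw [socProj_smul_linearPart e b hI j ha]
  have h6 := fun r => mul_mem_extGrading K V (eE_mem e r) ha
  split_ifs with hs
  · have h5 : ∀ r, socProj (v := v) b ((eE e r * a) • b.basis j) = eE e r • a • b.basis j := by
      intro r
      have h7 := h6 r
      rw [hs, show -1 + (-(v : ℤ) + 1) = -(v : ℤ) by ring] at h7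
      rw [socProj, b.coefMap_smul, projTop, proj_same _ h7, mul_smul]
    refine ⟨1 ⊗ₜ I.twist (a • b.basis j), ?_⟩
    rw [Ld_tmul, ← I.twist_d, map_smul, sub_eq_add_neg, ← Finset.sum_neg_distrib]
    congr 1
    refine Finset.sum_congr rfl fun r _ => ?_
    rw [h5, mul_one]
    exact eq_neg_of_add_eq_zero_left (unit_sign e I r (a • b.basis j))
  · refine ⟨0, ?_⟩
    rw [map_zero, map_zero, TensorProduct.tmul_zero, zero_sub, eq_comm, neg_eq_zero]
    refine Finset.sum_eq_zero fun r _ => ?_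
    rw [socProj, b.coefMap_smul, projTop, proj_ne _ (h6 r) (by omega), zero_smul, map_zero,
      TensorProduct.tmul_zero, map_zero]

include b hI in
theorem Ld_Lsign_twist (r : Fin v) {g : I.carrier} (hg : g ∈ soc e I) :
    Ld e I (Lsign e I (xS e r ⊗ₜ I.twist g)) = 0 := by
  refine Lsign_cycle e ?_
  have h2 := congrArg (fun z => xS e r • z) (Ld_one_twist e b hI hg)
  beta_reduce at h2
  rwa [← map_smul, TensorProduct.smul_tmul', smul_eq_mul, mul_one, smul_zero] at h2

theorem homologySign_smul_socHomology (r : Fin v) (g : soc e I) :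
    (L e I).homologySign (xS e r • socHomology e b hI g) =
      Lcls e I (Lsign e I (xS e r ⊗ₜ I.twist g)) (Ld_Lsign_twist e b hI r g.2) := by
  have h2 := Ld_one_twist e b hI g.2
  have h3 : Ld e I (xS e r • (1 ⊗ₜ I.twist g)) = 0 := by rw [map_smul, h2, smul_zero]
  have h4 : xS e r • socHomology e b hI g = Lcls e I _ h3 := Lcls_smul e (xS e r) h2 h3
  rw [h4, Lcls_sign]
  congr 2
  rw [TensorProduct.smul_tmul', smul_eq_mul, mul_one]

/-- Both sides are `E`-linear in `m`. At a basis vector and homogeneous `a` they are homology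
classes, whose representatives differ by the boundary from `exists_boundary_linearPart`. -/
theorem linearPartMap_linearPart (m : I.carrier) :
    linearPartMap e b hI (b.linearPart m) = RHLd e I (linearPartMap e b hI m) := by
  have key : linearPartMap e b hI ∘ₗ b.linearPart = RHLd e I ∘ₗ linearPartMap e b hI := by
    refine b.basis.ext fun j => HomE.ext_of_mem fun s a ha => ?_
    rw [LinearMap.comp_apply, LinearMap.comp_apply, RHLd_apply]
    simp only [linearPartMap_apply, homologySign_smul_socHomology]
    have h0 := fun r => Ld_Lsign_twist e b hI r (socProj_mem e b ((eE e r * a) • b.basis j))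
    refine Eq.trans ?_ (Lcls_sum e Finset.univ _ h0
      (by rw [map_sum, Finset.sum_eq_zero fun r _ => h0 r])).symm
    exact (Lcls_eq_iff e (Ld_one_twist e b hI (socProj_mem e b _)) _).2
      (exists_boundary_linearPart e b hI j ha)
  exact LinearMap.congr_fun key m

/-- The linear part of a minimal free complex `I` is isomorphic to `R(H(L(I)))`. -/
theorem linearPartIso_R (hI : I.IsMinimal) : b.LinearPartIso (R e (L e I).homology) := by
  refine ⟨LinearEquiv.ofBijective (linearPartMap e b hI)
    ⟨linearPartMap_injective e b hI, linearPartMap_surjective e b hI⟩, fun i j m => ?_, fun m => ?_⟩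
  · exact ⟨fun hm => linearPartMap_mem e b hI hm,
      fun hm => mem_of_map_mem (i := (i, j)) I.internal (RDeg_isInternal e (L e I).homology)
      ((linearPartMap e b hI).restrictScalars K)
      (fun _ _ hm => linearPartMap_mem e b hI hm) (linearPartMap_injective e b hI) hm⟩
  · exact linearPartMap_linearPart e b hI m

/-- The linear part of a minimal injective resolution of `G` with free terms is isomorphic to
`R(H(L(G)))`. -/
theorem IsInjectiveResolution.linearPartIso {G : EComplex K V} (h : I.IsInjectiveResolution G)
    (hG : G.IsBoundedBelow) (hI : I.IsMinimal) : b.LinearPartIso (R e (L e G).homology) := by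
  obtain ⟨-, hb, f, hf⟩ := h
  have h1 : (Lmap e f).IsQuasiIso := Lmap_isQuasiIso e hG hb hf
  exact (linearPartIso_R e b hI).comp_symm (Rmap e (Lmap e f).homology) (Rmap_bijective e h1)

end LinearPartE

/-! ### Homological perturbation and minimal models -/

namespace GrComplex

variable {K : Type u} [Field K] {A : Type u} [Ring A] [Algebra K A] {𝒜 : ℤ → Submodule K A}

/-- The product of the maximal ideal with a complex. -/
def maxIdealMul (𝒜 : ℤ → Submodule K A) (N : Type u) [AddCommGroup N] [Module A N] :
    Submodule A N :=
  Submodule.span A {y : N | ∃ s : ℤ, s ≠ 0 ∧ ∃ a ∈ 𝒜 s, ∃ m : N, y = a • m}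

theorem map_maxIdealMul {N N' : Type u} [AddCommGroup N] [Module A N] [AddCommGroup N']
    [Module A N'] (f : N →ₗ[A] N') {x : N} (hx : x ∈ maxIdealMul 𝒜 N) :
    f x ∈ maxIdealMul 𝒜 N' := by
  have h : maxIdealMul 𝒜 N ≤ (maxIdealMul 𝒜 N').comap f := by
    refine Submodule.span_le.2 ?_
    rintro _ ⟨s, hs, a, ha, m, rfl⟩
    exact Submodule.subset_span ⟨s, hs, a, ha, f m, map_smul f a m⟩
  exact h hx

/-- Data for the perturbation of a deformation retraction: the differential of `X` is `d₀ + δ`,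
the graded module `Y` is the homology of `d₀`, and `h` is a homotopy for `d₀`. -/
structure Perturbation (X Y : GrComplex K 𝒜) where
  h : X.carrier →ₗ[A] X.carrier
  d₀ : X.carrier →ₗ[A] X.carrier
  δ : X.carrier →ₗ[A] X.carrier
  P : X.carrier →ₗ[A] Y.carrier
  J : Y.carrier →ₗ[A] X.carrier
  d_eq : ∀ x, X.d x = d₀ x + δ x
  h_mem : ∀ {i j : ℤ} {m : X.carrier}, m ∈ X.deg i j → h m ∈ X.deg (i - 1) j
  d₀_mem : ∀ {i j : ℤ} {m : X.carrier}, m ∈ X.deg i j → d₀ m ∈ X.deg (i + 1) j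
  P_mem : ∀ {i j : ℤ} {m : X.carrier}, m ∈ X.deg i j → P m ∈ Y.deg i j
  J_mem : ∀ {i j : ℤ} {m : Y.carrier}, m ∈ Y.deg i j → J m ∈ X.deg i j
  d₀_d₀ : ∀ x, d₀ (d₀ x) = 0
  h_h : ∀ x, h (h x) = 0
  h_d_h : ∀ x, h (d₀ (h x)) = h x
  d_h_d : ∀ x, d₀ (h (d₀ x)) = d₀ x
  P_J : ∀ y, P (J y) = y
  J_P : ∀ x, J (P x) = x - d₀ (h x) - h (d₀ x)
  nilp : LocNilpotent ⇑(h ∘ₗ δ)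
  minimal : ∀ x, δ x ∈ maxIdealMul 𝒜 X.carrier

namespace Perturbation

variable {X Y : GrComplex K 𝒜} (p : Perturbation X Y)

theorem J_injective : Function.Injective p.J := Function.LeftInverse.injective p.P_J

theorem P_d₀ (x : X.carrier) : p.P (p.d₀ x) = 0 := by
  apply p.J_injective
  rw [p.J_P, p.d₀_d₀, p.d_h_d, map_zero, map_zero, sub_zero, sub_self]

theorem h_J (y : Y.carrier) : p.h (p.J y) = 0 := by
  have h1 := p.J_P (p.J y)
  rw [p.P_J, sub_sub, eq_comm, sub_eq_self] at h1
  have h2 := congrArg p.h h1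
  rwa [map_add, p.h_d_h, p.h_h, add_zero, map_zero] at h2

theorem d₀_J (y : Y.carrier) : p.d₀ (p.J y) = 0 := by
  have h1 := p.J_P (p.J y)
  rw [p.P_J, sub_sub, eq_comm, sub_eq_self] at h1
  have h2 := congrArg p.d₀ h1
  rwa [map_add, p.d₀_d₀, p.d_h_d, zero_add, map_zero] at h2

/-- The automorphism `1 + h δ`. -/
def N : X.carrier ≃ₗ[A] X.carrier := LinearEquiv.ofBijective _ p.nilp.bijective_one_add

theorem N_apply (x : X.carrier) : p.N x = x + p.h (p.δ x) := rfl

theorem δ_eq (x : X.carrier) : p.δ x = X.d x - p.d₀ x := by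
  rw [p.d_eq, add_sub_cancel_left]

theorem N_mem {i j : ℤ} {m : X.carrier} (hm : m ∈ X.deg i j) : p.N m ∈ X.deg i j := by
  have h := p.h_mem (sub_mem (X.d_mem hm) (p.d₀_mem hm))
  rw [← p.δ_eq, add_sub_cancel_right] at h
  rw [N_apply]
  exact add_mem hm h

theorem N_symm_mem {i j : ℤ} {m : X.carrier} (hm : m ∈ X.deg i j) : p.N.symm m ∈ X.deg i j := by
  refine mem_of_map_mem (i := (i, j)) X.internal X.internal
    (p.N.toLinearMap.restrictScalars K) (fun _ _ hm => p.N_mem hm) p.N.injective ?_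
  change p.N (p.N.symm m) ∈ X.deg i j
  rwa [LinearEquiv.apply_symm_apply]

theorem N_symm_eq (x : X.carrier) : p.N.symm x = x - p.h (p.δ (p.N.symm x)) := by
  rw [eq_sub_iff_add_eq, ← N_apply, LinearEquiv.apply_symm_apply]

theorem h_N_symm (x : X.carrier) : p.h (p.N.symm x) = p.h x := by
  rw [N_symm_eq, map_sub, p.h_h, sub_zero]

/-- The perturbed inclusion. -/
def incl : Y.carrier →ₗ[A] X.carrier := p.N.symm.toLinearMap ∘ₗ p.J

theorem incl_apply (y : Y.carrier) : p.incl y = p.N.symm (p.J y) := rfl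

theorem incl_injective : Function.Injective p.incl := p.N.symm.injective.comp p.J_injective

theorem h_incl (y : Y.carrier) : p.h (p.incl y) = 0 := by
  rw [incl_apply, h_N_symm, h_J]

/-- The correction in the perturbed inclusion makes the contributions of `h d₀` and `h δ` cancel. -/
theorem h_d_incl (y : Y.carrier) : p.h (X.d (p.incl y)) = 0 := by
  have h1 : p.incl y = p.J y - p.h (p.δ (p.incl y)) := p.N_symm_eq (p.J y)
  have h2 : p.h (p.d₀ (p.incl y)) = -p.h (p.δ (p.incl y)) := by
    conv_lhs => rw [h1]
    rw [map_sub, map_sub, p.d₀_J, p.h_d_h, map_zero, zero_sub]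
  rw [p.d_eq, map_add, h2, neg_add_cancel]

/-- The perturbed homotopy. -/
def w : X.carrier →ₗ[A] X.carrier := p.N.symm.toLinearMap ∘ₗ p.h

theorem h_w (x : X.carrier) : p.h (p.w x) = 0 := (p.h_N_symm _).trans (p.h_h x)

/-- The perturbed form of `h d₀ h = h`. It is the reason why `x - d w x - w d x` is annihilated by
`h` and by `h d`. -/
theorem h_d_w (x : X.carrier) : p.h (X.d (p.w x)) = p.h x := by
  have h1 : p.w x = p.h x - p.h (p.δ (p.w x)) := p.N_symm_eq (p.h x)
  have h2 : p.h (p.d₀ (p.w x)) = p.h x - p.h (p.δ (p.w x)) := by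
    conv_lhs => rw [h1]
    rw [map_sub, map_sub, p.h_d_h, p.h_d_h]
  rw [p.d_eq, map_add, h2, sub_add_cancel]

theorem w_eq_zero {x : X.carrier} (hx : p.h x = 0) : p.w x = 0 := by
  rw [w, LinearMap.comp_apply, hx, map_zero]

/-- If `h z = 0` and `h d z = 0`, then `J P z = z - h d₀ z = z + h δ z = N z`. Hence the image of
`incl` is the common kernel of `h` and `h d`, visibly a subcomplex, and no perturbation series has
to be manipulated. -/
theorem incl_P {z : X.carrier} (h1 : p.h z = 0) (h2 : p.h (X.d z) = 0) : p.incl (p.P z) = z := by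
  rw [incl_apply, LinearEquiv.symm_apply_eq, N_apply, p.J_P, h1, map_zero, sub_zero, p.δ_eq,
    map_sub, h2, zero_sub, sub_eq_add_neg]

/-- The complex with the underlying graded module `Y` and the perturbed differential. -/
def model : GrComplex K 𝒜 where
  carrier := Y.carrier
  deg := Y.deg
  internal := Y.internal
  smul_mem := Y.smul_mem
  d := p.P ∘ₗ X.d ∘ₗ p.incl
  d_mem hm := p.P_mem (X.d_mem (p.N_symm_mem (p.J_mem hm)))
  d_d y := by
    apply p.incl_injective
    change p.incl (p.P (X.d (p.incl (p.P (X.d (p.incl y)))))) = _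
    rw [p.incl_P (z := X.d (p.incl y)) (p.h_d_incl y) (by rw [X.d_d, map_zero]), X.d_d, map_zero]

theorem incl_d (y : Y.carrier) : p.incl (p.P (X.d (p.incl y))) = X.d (p.incl y) :=
  p.incl_P (p.h_d_incl y) (by rw [X.d_d, map_zero])

/-- As `P d₀ = 0`, the differential of the model is `P δ incl`, and `δ` takes values in the
multiples of the maximal ideal. -/
theorem model_isMinimal : p.model.IsMinimal := by
  intro (y : Y.carrier)
  change p.P (X.d (p.incl y)) ∈ maxIdealMul 𝒜 Y.carrier
  rw [p.d_eq, map_add, P_d₀, zero_add]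
  exact map_maxIdealMul p.P (p.minimal _)

/-- The inclusion of the perturbed complex. -/
def inclHom : Hom p.model X where
  toLin := p.incl
  map_mem hm := p.N_symm_mem (p.J_mem hm)
  comm := p.incl_d

/-- The map `x ↦ x - d w x - w d x`. -/
def ret : X.carrier →ₗ[A] X.carrier := LinearMap.id - X.d ∘ₗ p.w - p.w ∘ₗ X.d

theorem ret_apply (x : X.carrier) : p.ret x = x - X.d (p.w x) - p.w (X.d x) := rfl

theorem incl_P_ret (x : X.carrier) : p.incl (p.P (p.ret x)) = p.ret x := by
  apply p.incl_P
  · rw [ret_apply, map_sub, map_sub, p.h_d_w, p.h_w, sub_self, sub_zero]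
  · rw [ret_apply, map_sub X.d, map_sub X.d, X.d_d, sub_zero, map_sub, p.h_d_w, sub_self]

theorem ret_d (x : X.carrier) : p.ret (X.d x) = X.d (p.ret x) := by
  rw [ret_apply, ret_apply, X.d_d, map_zero, sub_zero, map_sub, map_sub, X.d_d, sub_zero]

theorem ret_incl (y : Y.carrier) : p.ret (p.incl y) = p.incl y := by
  rw [ret_apply, p.w_eq_zero (p.h_incl y), p.w_eq_zero (p.h_d_incl y), map_zero, sub_zero, sub_zero]

/-- The projection onto the perturbed complex. -/
def retHom : Hom X p.model where
  toLin := p.P ∘ₗ p.ret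
  map_mem := by
    intro i j m hm
    refine p.P_mem (sub_mem (sub_mem hm ?_) ?_)
    · have h := X.d_mem (p.N_symm_mem (p.h_mem hm))
      rw [sub_add_cancel] at h
      exact h
    · have h := p.N_symm_mem (p.h_mem (X.d_mem hm))
      rw [add_sub_cancel_right] at h
      exact h
  comm x := by
    apply p.incl_injective
    change p.incl (p.P (p.ret (X.d x))) = p.incl (p.P (X.d (p.incl (p.P (p.ret x)))))
    rw [p.incl_P_ret, p.incl_P_ret, ← ret_d, p.incl_P_ret]

theorem ret_inclHom (y : Y.carrier) : p.retHom.toLin (p.inclHom.toLin y) = y := by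
  change p.P (p.ret (p.incl y)) = y
  apply p.incl_injective
  rw [p.incl_P_ret, ret_incl]

theorem incl_ret {x : X.carrier} (hx : X.d x = 0) :
    p.incl (p.P (p.ret x)) = x - X.d (p.w x) := by
  rw [incl_P_ret, ret_apply, hx, map_zero, sub_zero]

/-- The retraction splits the inclusion, and on cycles the other composite differs from the identity
by the boundary `d w x`. -/
theorem inclHom_isQuasiIso : p.inclHom.IsQuasiIso := by
  rw [Hom.isQuasiIso_iff]
  constructor
  · intro (y : Y.carrier) _ x hx
    refine ⟨p.retHom.toLin x, ?_⟩
    rw [← p.retHom.comm, ← hx]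
    exact p.ret_inclHom y
  · intro x hx
    refine ⟨p.retHom.toLin x, ?_, -p.w x, ?_⟩
    · rw [← p.retHom.comm, hx, map_zero]
    · change X.d (-p.w x) = p.incl (p.P (p.ret x)) - x
      rw [p.incl_ret hx, map_neg]
      abel

theorem retHom_isQuasiIso : p.retHom.IsQuasiIso := by
  rw [Hom.isQuasiIso_iff]
  constructor
  · intro x hx (y : Y.carrier) (hy : p.P (p.ret x) = p.P (X.d (p.incl y)))
    refine ⟨p.w x + p.incl y, ?_⟩
    have h1 := p.incl_ret hx
    rw [hy, p.incl_d] at h1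
    rw [map_add, h1, add_sub_cancel]
  · intro (y : Y.carrier) hy
    refine ⟨p.incl y, ?_, 0, ?_⟩
    · rw [← p.incl_d]
      exact (congrArg p.incl hy).trans (map_zero _)
    · rw [map_zero]
      exact (sub_eq_zero.2 (p.ret_inclHom y)).symm

/-- A homogeneous basis of the perturbed complex. -/
def modelBasis (b : Y.HomogeneousBasis) : p.model.HomogeneousBasis where
  index := b.index
  basis := b.basis
  coh := b.coh
  int := b.int
  mem := b.mem

theorem model_isBoundedBelow (hX : X.IsBoundedBelow) : p.model.IsBoundedBelow := by
  obtain ⟨a, ha⟩ := hX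
  refine ⟨a, fun i j hi => ?_⟩
  rw [eq_bot_iff]
  intro (y : Y.carrier) (hy : y ∈ Y.deg i j)
  have h := p.J_mem hy
  rw [ha i j hi, Submodule.mem_bot] at h
  exact (Submodule.mem_bot K).2 (p.J_injective (h.trans (map_zero _).symm))

end Perturbation

/-- The projection of a complex with a splitting onto its homology. -/
def Splitting.toHomology {C : GrComplex K 𝒜} (sp : C.Splitting) :
    C.carrier →ₗ[K] C.HomologyModule :=
  C.homologyClass.restrictScalars K ∘ₗ
    (LinearMap.id - C.dK ∘ₗ sp.h - sp.h ∘ₗ C.dK).codRestrict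
      ((LinearMap.ker C.d).restrictScalars K) fun x => by
        change C.d (x - C.d (sp.h x) - sp.h (C.d x)) = 0
        rw [map_sub, map_sub, C.d_d, sp.d_h_d, sub_zero, sub_self]

/-- The cycles that represent the homology of a complex with a splitting. -/
def Splitting.ofHomology {C : GrComplex K 𝒜} (sp : C.Splitting) :
    C.HomologyModule →ₗ[K] C.carrier :=
  C.homologyLift (LinearMap.id - C.dK ∘ₗ sp.h - sp.h ∘ₗ C.dK) fun x => by
    change C.d x - C.d (sp.h (C.d x)) - sp.h (C.d (C.d x)) = 0
    rw [C.d_d, sp.d_h_d, map_zero, sub_zero, sub_self]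

section Splitting

variable {C : GrComplex K 𝒜} (sp : C.Splitting)

theorem Splitting.ofHomology_toHomology (x : C.carrier) :
    sp.ofHomology (sp.toHomology x) = x - C.d (sp.h x) - sp.h (C.d x) := by
  set y := x - C.d (sp.h x) - sp.h (C.d x) with hy
  -- Both maps apply `1 - d h - h d` to a representative, so the composite applies it twice; it is
  -- idempotent.
  have h1 : sp.ofHomology (sp.toHomology x) = y - C.d (sp.h y) - sp.h (C.d y) := rfl
  have h2 : C.d y = 0 := by rw [hy, map_sub, map_sub, C.d_d, sp.d_h_d, sub_zero, sub_self]
  have h3 : sp.h y = 0 := by rw [hy, map_sub, map_sub, sp.h_d_h, sp.h_h, sub_self, sub_zero]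
  rw [h1, h2, h3, map_zero, map_zero, sub_zero, sub_zero]

theorem Splitting.toHomology_cls {x : C.carrier} (hx : C.d x = 0) :
    sp.toHomology x = C.cls x hx := by
  refine (C.homologyClass_eq_iff _ _).2 ⟨-sp.h x, ?_⟩
  change C.d (-sp.h x) = x - C.d (sp.h x) - sp.h (C.d x) - x
  rw [hx, map_zero, map_neg]
  abel

theorem Splitting.toHomology_ofHomology (h : C.HomologyModule) :
    sp.toHomology (sp.ofHomology h) = h := by
  obtain ⟨x, hx, rfl⟩ := C.exists_cls h
  rw [← sp.toHomology_cls hx, sp.ofHomology_toHomology, hx, map_zero, sub_zero]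
  rw [sp.toHomology_cls (x := x - C.d (sp.h x)) (by rw [map_sub, hx, C.d_d, sub_zero]),
    sp.toHomology_cls hx, cls_eq_iff]
  exact ⟨-sp.h x, by rw [map_neg]; abel⟩

theorem Splitting.toHomology_mem {i j : ℤ} {x : C.carrier} (hx : x ∈ C.deg i j) :
    sp.toHomology x ∈ C.homologyDeg i j := by
  refine ⟨_, ?_, rfl⟩
  change x - C.d (sp.h x) - sp.h (C.d x) ∈ C.deg i j
  have h1 := C.d_mem (sp.mem hx)
  have h2 := sp.mem (C.d_mem hx)
  rw [sub_add_cancel] at h1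
  rw [add_sub_cancel_right] at h2
  exact sub_mem (sub_mem hx h1) h2

theorem Splitting.ofHomology_mem {i j : ℤ} {h : C.HomologyModule} (hh : h ∈ C.homologyDeg i j) :
    sp.ofHomology h ∈ C.deg i j := by
  obtain ⟨x, hx, rfl, hm⟩ := C.exists_cls_of_mem hh
  change x - C.d (sp.h x) - sp.h (C.d x) ∈ C.deg i j
  have h1 := C.d_mem (sp.mem hm)
  rw [sub_add_cancel] at h1
  rw [hx, map_zero, sub_zero]
  exact sub_mem hm h1

end Splitting

end GrComplex

section Existence

variable {K : Type u} [Field K] {V : Type u} [AddCommGroup V] [Module K V]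
  {v : ℕ} (e : Module.Basis (Fin v) K V)

/-! ### Minimal free resolutions -/

theorem Lδ_mem_maxIdealMul (G : EComplex K V) (x : S K V ⊗[K] G.carrier) :
    Lδ e G x ∈ GrComplex.maxIdealMul (symGrading K (Module.Dual K V)) (S K V ⊗[K] G.carrier) := by
  induction x using TensorProduct.induction_on with
  | zero => rw [map_zero]; exact zero_mem _
  | add x y hx hy => rw [map_add]; exact add_mem hx hy
  | tmul s g =>
    rw [Lδ_tmul]
    refine Submodule.sum_mem _ fun r _ => Submodule.subset_span
      ⟨1, one_ne_zero, xS e r, xS_mem e r, s ⊗ₜ G.sign (eE e r • g), ?_⟩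
    rw [TensorProduct.smul_tmul', smul_eq_mul]

theorem baseChange_mem {G : EComplex K V} {H : EComplex K V} (f : G.carrier →ₗ[K] H.carrier)
    (n : ℤ) (hf : ∀ i j, ∀ m ∈ G.deg i j, f m ∈ H.deg (i + n) j) {k t : ℤ}
    {x : S K V ⊗[K] G.carrier} (hx : x ∈ LDeg G k t) :
    f.baseChange (S K V) x ∈ LDeg H (k + n) t := by
  refine LDeg_le G (N := (LDeg H (k + n) t).comap ((f.baseChange (S K V)).restrictScalars K)) ?_ hx
  intro a i j hk ht s hs g hg
  exact tmul_mem_LDeg H hs (hf i j g hg) (by omega) ht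

theorem baseChange_baseChange {M N Q : Type u} [AddCommGroup M] [Module K M] [AddCommGroup N]
    [Module K N] [AddCommGroup Q] [Module K Q] (f : M →ₗ[K] N) (g : N →ₗ[K] Q) (x : S K V ⊗[K] M) :
    g.baseChange (S K V) (f.baseChange (S K V) x) = (g ∘ₗ f).baseChange (S K V) x := by
  rw [LinearMap.baseChange_comp, LinearMap.comp_apply]

theorem baseChange_dK_dK (G : EComplex K V) (x : S K V ⊗[K] G.carrier) :
    G.dK.baseChange (S K V) (G.dK.baseChange (S K V) x) = 0 := by
  rw [baseChange_baseChange, show G.dK ∘ₗ G.dK = 0 from LinearMap.ext G.d_d,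
    LinearMap.baseChange_zero, LinearMap.zero_apply]

section Splitting

variable {G : EComplex K V} (sp : G.Splitting)

theorem GrComplex.Splitting.baseChange_h_h (x : S K V ⊗[K] G.carrier) :
    sp.h.baseChange (S K V) (sp.h.baseChange (S K V) x) = 0 := by
  rw [baseChange_baseChange, show sp.h ∘ₗ sp.h = 0 from LinearMap.ext sp.h_h,
    LinearMap.baseChange_zero, LinearMap.zero_apply]

theorem GrComplex.Splitting.baseChange_h_d_h (x : S K V ⊗[K] G.carrier) :
    sp.h.baseChange (S K V) (G.dK.baseChange (S K V) (sp.h.baseChange (S K V) x)) =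
      sp.h.baseChange (S K V) x := by
  rw [baseChange_baseChange, baseChange_baseChange, LinearMap.comp_assoc,
    show sp.h ∘ₗ G.dK ∘ₗ sp.h = sp.h from LinearMap.ext sp.h_d_h]

theorem GrComplex.Splitting.baseChange_d_h_d (x : S K V ⊗[K] G.carrier) :
    G.dK.baseChange (S K V) (sp.h.baseChange (S K V) (G.dK.baseChange (S K V) x)) =
      G.dK.baseChange (S K V) x := by
  rw [baseChange_baseChange, baseChange_baseChange, LinearMap.comp_assoc,
    show G.dK ∘ₗ sp.h ∘ₗ G.dK = G.dK from LinearMap.ext sp.d_h_d]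

theorem GrComplex.Splitting.baseChange_P_J (x : S K V ⊗[K] G.HomologyModule) :
    sp.toHomology.baseChange (S K V) (sp.ofHomology.baseChange (S K V) x) = x := by
  rw [baseChange_baseChange, show sp.toHomology ∘ₗ sp.ofHomology = LinearMap.id from
    LinearMap.ext sp.toHomology_ofHomology, LinearMap.baseChange_id, LinearMap.id_apply]

theorem GrComplex.Splitting.baseChange_J_P (x : S K V ⊗[K] G.carrier) :
    sp.ofHomology.baseChange (S K V) (sp.toHomology.baseChange (S K V) x) =
      x - G.dK.baseChange (S K V) (sp.h.baseChange (S K V) x) -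
        sp.h.baseChange (S K V) (G.dK.baseChange (S K V) x) := by
  rw [baseChange_baseChange, baseChange_baseChange, baseChange_baseChange,
    show sp.ofHomology ∘ₗ sp.toHomology = LinearMap.id - G.dK ∘ₗ sp.h - sp.h ∘ₗ G.dK from
      LinearMap.ext sp.ofHomology_toHomology, LinearMap.baseChange_sub, LinearMap.baseChange_sub,
    LinearMap.baseChange_id, LinearMap.sub_apply, LinearMap.sub_apply, LinearMap.id_apply]

end Splitting

/-- The perturbation data of `L(G)`. -/
def perturbationL {G : EComplex K V} (sp : G.Splitting) (hG : G.IsBoundedBelow) :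
    GrComplex.Perturbation (L e G) (L e G.homology) where
  h := sp.h.baseChange (S K V)
  d₀ := G.dK.baseChange (S K V)
  δ := Lδ e G
  P := sp.toHomology.baseChange (S K V)
  J := sp.ofHomology.baseChange (S K V)
  d_eq := Ld_eq e G
  h_mem hm := baseChange_mem sp.h (-1) (fun _ _ _ hm => sp.mem hm) hm
  d₀_mem hm := baseChange_mem G.dK 1 (fun _ _ _ hm => G.d_mem hm) hm
  P_mem := fun {i j m} hm => by
    have h := baseChange_mem (H := G.homology) sp.toHomology 0
      (fun i j _ hm => by rw [add_zero]; exact sp.toHomology_mem hm) hm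
    rw [add_zero] at h
    exact h
  J_mem := fun {i j m} hm => by
    have h := baseChange_mem (G := G.homology) sp.ofHomology 0
      (fun i j _ hm => by rw [add_zero]; exact sp.ofHomology_mem hm) hm
    rw [add_zero] at h
    exact h
  d₀_d₀ := baseChange_dK_dK G
  h_h := sp.baseChange_h_h
  h_d_h := sp.baseChange_h_d_h
  d_h_d := sp.baseChange_d_h_d
  P_J := sp.baseChange_P_J
  J_P := sp.baseChange_J_P
  nilp := by
    obtain ⟨a, ha⟩ := hG
    -- The homotopy lowers the cohomological degree in `G`, and `δ` preserves it.
    refine LocNilpotent.of_filtration (fun n : ℕ => LFil G (a + n))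
      (show LFil G (a + (0 : ℕ)) = ⊥ by rw [Nat.cast_zero, add_zero]; exact LFil_eq_bot G ha)
      (exists_mem_LFil G a) fun n x hx => ?_
    rw [Nat.cast_succ, ← add_assoc] at hx
    exact splitting_mem_LFil sp (Lδ_mem_LFil e G hx)
  minimal := Lδ_mem_maxIdealMul e G

/-- Existence of minimal free resolutions. -/
theorem exists_minimal_free_resolution (e : Module.Basis (Fin v) K V) {M : SComplex K V}
    (hb : M.IsBounded) (hM : M.HasFGTerms) :
    ∃ F : SComplex K V, F.IsFreeResolution M ∧ F.IsMinimal := by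
  -- The counit makes `L(R(M))` a free resolution; the perturbed model, with underlying module S ⊗
  -- H(R(M)), includes into it and is minimal.
  obtain ⟨sp⟩ := (R e M).exists_splitting
  let p := perturbationL e sp (R_isBoundedBelow e hb hM)
  exact ⟨p.model, ⟨⟨p.modelBasis (LBasis e (R e M).homology)⟩, (counit e M).comp p.inclHom,
    (counit_isQuasiIso e M).comp p.inclHom_isQuasiIso⟩, p.model_isMinimal⟩

/-! ### Minimal injective resolutions -/

/-- The map `a ↦ ω(a) m`. -/
def ωTensor {F : Type u} [AddCommGroup F] [Module K F] (m : F) : HomE K V F :=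
  ((ω e).smulRight m : E K V →ₗ[K] F)

theorem ωTensor_apply {F : Type u} [AddCommGroup F] [Module K F] (m : F) (a : E K V) :
    ωTensor e m a = ω e a • m := rfl

theorem smul_ωTensor_apply {F : Type u} [AddCommGroup F] [Module K F] (c : E K V) (m : F)
    (a : E K V) : (c • ωTensor e m) a = ω e (a * c) • m := rfl

theorem ω_of_mem {s : ℤ} (hs : s ≠ -(v : ℤ)) {a : E K V} (ha : a ∈ extGrading K V s) :
    ω e a = 0 := by
  have h := projTop_eq e a
  rw [projTop, proj_ne _ ha hs] at h
  exact (smul_eq_zero.1 h.symm).resolve_right (topE_ne_zero e)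

/-- The coefficients of a map with respect to the maps `ω ⊗ m`. -/
theorem exists_eq_sum_ωTensor : ∃ c : Fin (Module.finrank K (E K V)) → E K V,
    ∀ (F : Type u) [AddCommGroup F] [Module K F], ∀ β : HomE K V F,
      ∃ m : Fin (Module.finrank K (E K V)) → F, β = ∑ k, c k • ωTensor e (m k) ∧
        β (topE e) = ∑ k, augE (c k) • m k := by
  have := E_finite e
  let ε := Module.finBasis K (E K V)
  -- The coordinate functionals have the form `a ↦ ω (a c_k)`; at `topE` they only see the constant
  -- terms of the `c_k`.
  choose c hc using fun k => exists_eq_ω_mul e (ε.coord k)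
  refine ⟨c, fun F _ _ β => ⟨fun k => β (ε k), ?_⟩⟩
  have h : ∀ a, β a = ∑ k, ω e (a * c k) • β (ε k) := by
    intro a
    conv_lhs => rw [← ε.sum_repr a]
    rw [map_sum]
    refine Finset.sum_congr rfl fun k _ => ?_
    rw [map_smul, ← hc, Module.Basis.coord_apply]
  refine ⟨HomE.ext fun a => ?_, ?_⟩
  · rw [h, HomE.sum_apply]
    rfl
  · rw [h]
    refine Finset.sum_congr rfl fun k _ => ?_
    rw [topE_mul, map_smul, ω_topE, smul_eq_mul, mul_one]

theorem sub_augE_smul_mem_maxIdealMul {N : Type u} [AddCommGroup N] [Module (E K V) N] (c : E K V)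
    (m : N) : (c - algebraMap K _ (augE c)) • m ∈ GrComplex.maxIdealMul (extGrading K V) N := by
  induction c using internal_induction (extGrading_isInternal K V) with
  | mem s c hc =>
    by_cases hs : s = 0
    · subst hs
      rw [algebraMap_augE hc, sub_self, zero_smul]
      exact zero_mem _
    · rw [augE_of_mem hs hc, map_zero, sub_zero]
      exact Submodule.subset_span ⟨s, hs, c, hc, m, rfl⟩
  | zero => rw [map_zero, map_zero, sub_zero, zero_smul]; exact zero_mem _
  | add c c' hc hc' =>
    rw [map_add, map_add, add_sub_add_comm, add_smul]
    exact add_mem hc hc'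

/-- The value at `topE` is the sum of the constant terms of the `c k` times the `m k`. When it is
zero, these constant terms can be subtracted from the `c k`, which leaves coefficients in the
maximal ideal. -/
theorem mem_maxIdealMul_of_apply_topE {F : Type u} [AddCommGroup F] [Module K F] {β : HomE K V F}
    (hβ : β (topE e) = 0) : β ∈ GrComplex.maxIdealMul (extGrading K V) (HomE K V F) := by
  obtain ⟨c, hc⟩ := exists_eq_sum_ωTensor e
  obtain ⟨m, h1, h2⟩ := hc F β
  have h3 : ∑ k, algebraMap K (E K V) (augE (c k)) • ωTensor e (m k) = 0 := by
    refine HomE.ext fun a => ?_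
    rw [HomE.sum_apply, HomE.zero_apply]
    have h4 := congrArg (fun z => ω e a • z) (h2.symm.trans hβ)
    beta_reduce at h4
    rw [Finset.smul_sum, smul_zero] at h4
    rw [← h4]
    refine Finset.sum_congr rfl fun k _ => ?_
    rw [algebraMap_smul, HomE.smulK_apply, ωTensor_apply, smul_comm]
  rw [h1, ← sub_zero (∑ k, _), ← h3, ← Finset.sum_sub_distrib]
  refine Submodule.sum_mem _ fun k _ => ?_
  rw [← sub_smul]
  exact sub_augE_smul_mem_maxIdealMul (c k) _

/-- At `topE` the Koszul part evaluates maps at the products `e_r topE`, which are zero. -/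
theorem Rδ_mem_maxIdealMul (F : SComplex K V) (α : HomE K V F.carrier) :
    Rδ e F α ∈ GrComplex.maxIdealMul (extGrading K V) (HomE K V F.carrier) := by
  refine mem_maxIdealMul_of_apply_topE e ?_
  rw [Rδ_apply]
  refine Finset.sum_eq_zero fun r _ => ?_
  rw [eE_mul_topE, map_zero, smul_zero, map_zero]

/-- Evaluating a relation at `a` and comparing coefficients over `K` gives `ω (a c_i) = 0` for all
`a`, so nondegeneracy of `ω` applies. -/
theorem linearIndependent_ωTensor {F : Type u} [AddCommGroup F] [Module K F] {ι : Type u}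
    (b : Module.Basis ι K F) : LinearIndependent (E K V) fun i => ωTensor e (b i) := by
  rw [linearIndependent_iff']
  intro T c hc i hi
  refine eq_zero_of_ω_mul e fun a => ?_
  have h1 := congrArg (fun β : HomE K V F => β a) hc
  beta_reduce at h1
  rw [HomE.sum_apply, HomE.zero_apply] at h1
  simp only [smul_ωTensor_apply] at h1
  exact linearIndependent_iff'.1 b.linearIndependent T _ h1 i hi

theorem span_ωTensor {F : Type u} [AddCommGroup F] [Module K F] {ι : Type u}
    (b : Module.Basis ι K F) :
    ⊤ ≤ Submodule.span (E K V) (Set.range fun i => ωTensor e (b i)) := by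
  rintro β -
  obtain ⟨c, hc⟩ := exists_eq_sum_ωTensor e
  obtain ⟨m, h1, -⟩ := hc F β
  rw [h1]
  refine Submodule.sum_mem _ fun k _ => Submodule.smul_mem _ _ ?_
  have h2 := b.mem_span (m k)
  generalize m k = y at h2
  induction h2 using Submodule.span_induction with
  | mem x hx =>
    obtain ⟨i, rfl⟩ := hx
    exact Submodule.subset_span ⟨i, rfl⟩
  | zero =>
    have : ωTensor e (0 : F) = 0 := HomE.ext fun a => smul_zero _
    rw [this]
    exact zero_mem _
  | add x y _ _ hx hy =>
    have : ωTensor e (x + y) = ωTensor e x + ωTensor e y := HomE.ext fun a => smul_add _ _ _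
    rw [this]
    exact add_mem hx hy
  | smul k x _ hx =>
    have : ωTensor e (k • x) = algebraMap K (E K V) k • ωTensor e x := by
      rw [algebraMap_smul]
      exact HomE.ext fun a => smul_comm _ _ _
    rw [this]
    exact Submodule.smul_mem _ _ hx

/-- A homogeneous basis of `R(F)`. -/
def RBasis (F : SComplex K V) : (R e F).HomogeneousBasis where
  index := Σ p : ℤ × ℤ, Module.Basis.ofVectorSpaceIndex K (F.deg p.1 p.2)
  basis := Module.Basis.mk (linearIndependent_ωTensor e F.fieldBasis)
    (span_ωTensor e F.fieldBasis)
  coh i := i.1.1 + i.1.2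
  -- The functional `ω` is supported in degree `-v`, so `ω ⊗ m` with `m` of internal degree `j` has
  -- internal degree `j + v`.
  int i := i.1.2 + v
  mem i := by
    have h : ωTensor e (F.fieldBasis i) ∈ RDeg F (i.1.1 + i.1.2) (i.1.2 + v) := by
      intro s a ha
      rw [ωTensor_apply]
      by_cases hs : s = -(v : ℤ)
      · subst hs
        rw [show i.1.1 + i.1.2 - (-(v : ℤ) + (i.1.2 + v)) = i.1.1 by ring,
          show -(v : ℤ) + (i.1.2 + v) = i.1.2 by ring]
        exact Submodule.smul_mem _ _ (F.fieldBasis_mem i)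
      · rw [ω_of_mem e hs ha, zero_smul]
        exact zero_mem _
    have h2 : Module.Basis.mk (linearIndependent_ωTensor e F.fieldBasis)
        (span_ωTensor e F.fieldBasis) i = ωTensor e (F.fieldBasis i) :=
      Module.Basis.mk_apply _ _ i
    rw [← h2] at h
    exact h

theorem post_mem {F H : SComplex K V} (f : F.carrier →ₗ[K] H.carrier)
    (n : ℤ) (hf : ∀ i j, ∀ m ∈ F.deg i j, f m ∈ H.deg (i + n) j) {k t : ℤ}
    {α : HomE K V F.carrier} (hα : α ∈ RDeg F k t) : HomE.post f α ∈ RDeg H (k + n) t := by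
  intro s a ha
  have h := hf _ _ _ (hα s a ha)
  rw [show k - (s + t) + n = k + n - (s + t) by ring] at h
  exact h

/-- The perturbation data of `R(F)`. -/
def perturbationR {F : SComplex K V} (sp : F.Splitting) :
    GrComplex.Perturbation (R e F) (R e F.homology) where
  h := HomE.post sp.h
  d₀ := HomE.post F.dK
  δ := Rδ e F
  P := HomE.post sp.toHomology
  J := HomE.post sp.ofHomology
  d_eq := Rd_eq e F
  h_mem hm := post_mem sp.h (-1) (fun _ _ _ hm => sp.mem hm) hm
  d₀_mem hm := post_mem F.dK 1 (fun _ _ _ hm => F.d_mem hm) hm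
  P_mem := fun {i j m} hm => by
    have h := post_mem (H := F.homology) sp.toHomology 0
      (fun i j _ hm => by rw [add_zero]; exact sp.toHomology_mem hm) hm
    rw [add_zero] at h
    exact h
  J_mem := fun {i j m} hm => by
    have h := post_mem (F := F.homology) sp.ofHomology 0
      (fun i j _ hm => by rw [add_zero]; exact sp.ofHomology_mem hm) hm
    rw [add_zero] at h
    exact h
  d₀_d₀ := fun (α : HomE K V F.carrier) => HomE.ext fun a => F.d_d (α a)
  h_h := fun (α : HomE K V F.carrier) => HomE.ext fun a => sp.h_h (α a)
  h_d_h := fun (α : HomE K V F.carrier) => HomE.ext fun a => sp.h_d_h (α a)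
  d_h_d := fun (α : HomE K V F.carrier) => HomE.ext fun a => sp.d_h_d (α a)
  P_J := fun (α : HomE K V F.HomologyModule) => HomE.ext fun a => sp.toHomology_ofHomology (α a)
  J_P := fun (α : HomE K V F.carrier) => HomE.ext fun a => sp.ofHomology_toHomology (α a)
  nilp := LocNilpotent.of_filtration (RFil V F.carrier) (RFil_zero _) (exists_mem_RFil e _)
    fun _ _ hα => post_mem_RFil _ (Rδ_mem_RFil e F hα)
  minimal := Rδ_mem_maxIdealMul e F

/-- Existence of minimal injective resolutions with free terms. -/
theorem exists_minimal_injective_resolution (e : Module.Basis (Fin v) K V)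
    {G : EComplex K V} (hG : G.IsBoundedBelow) :
    ∃ I : EComplex K V, I.IsInjectiveResolution G ∧ I.IsMinimal ∧ I.IsFree := by
  -- The unit makes `R(L(G))` an injective resolution. Here the retraction onto the perturbed model
  -- is used rather than the inclusion, as the arrow must point from `G` into the resolution.
  obtain ⟨sp⟩ := (L e G).exists_splitting
  let p := perturbationR e sp
  refine ⟨p.model, ⟨?_, p.model_isBoundedBelow (RL_isBoundedBelow e hG),
    p.retHom.comp (unit e G), p.retHom_isQuasiIso.comp (unit_isQuasiIso e G)⟩,
    p.model_isMinimal, ⟨p.modelBasis (RBasis e (L e G).homology)⟩⟩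
  exact GrComplex.HasInjectiveTerms.of_injective (extGrading_isInternal K V)
    (HomE.injective (V := V) (L e G).HomologyModule)

end Existence

end BGG

end

/-! ### The theorem -/

theorem theorem3p7 {K : Type u} [Field K] {V : Type u} [AddCommGroup V] [Module K V] {v : ℕ}
    (e : Module.Basis (Fin v) K V) :
    -- (a) reciprocity
    (∀ (M : BGG.SComplex K V) (P : BGG.EComplex K V),
      M.IsModule → M.HasFGTerms → P.IsModule → P.HasFGTerms →
        ((BGG.L e P).IsFreeResolution M ↔ (BGG.R e M).IsInjectiveResolution P)) ∧
    -- (b) minimal free resolutions of complexes over the symmetric algebra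
    (∀ M : BGG.SComplex K V, M.IsBounded → M.HasFGTerms →
      (∃ F : BGG.SComplex K V, F.IsFreeResolution M ∧ F.IsMinimal) ∧
      ∀ F : BGG.SComplex K V, F.IsFreeResolution M → F.IsMinimal →
        ∀ b : F.HomogeneousBasis, b.LinearPartIso (BGG.L e (BGG.R e M).homology)) ∧
    -- (b) minimal injective resolutions of complexes over the exterior algebra
    (∀ G : BGG.EComplex K V, G.IsBounded → G.HasFGTerms →
      (∃ I : BGG.EComplex K V, I.IsInjectiveResolution G ∧ I.IsMinimal ∧ I.IsFree) ∧
      ∀ I : BGG.EComplex K V, I.IsInjectiveResolution G → I.IsMinimal →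
        ∀ b : I.HomogeneousBasis, b.LinearPartIso (BGG.R e (BGG.L e G).homology)) := by
  refine ⟨fun M P hM hM' hP _ =>
      BGG.isFreeResolution_L_iff e hM.isBounded hM' hP.isBounded.isBoundedBelow,
    fun M hb hM => ⟨BGG.exists_minimal_free_resolution e hb hM,
      fun F hF hmin b => BGG.IsFreeResolution.linearPartIso e b hF hmin⟩,
    fun G hb _ => ⟨BGG.exists_minimal_injective_resolution e hb.isBoundedBelow,
      fun I hI hmin b => BGG.IsInjectiveResolution.linearPartIso e b hI hb.isBoundedBelow hmin⟩⟩
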